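/- Let $N\ge 1$ and let $\Omega\subseteq\mathbb R^N$ be open, either bounded or equal to $\mathbb R^N$; $\mathbb R_+=[0,\infty)$ and all function spaces are real. Put $X^1=L_1(\Omega)$ and let $X^0=C_0(\Omega)$ be the space of continuous functions on $\overline\Omega$ if $\Omega$ is bounded, and of continuous functions tending to $0$ at infinity if $\Omega=\mathbb R^N$, with the supremum norm. For $r\ge 0$ and $i\in\{0,1\}$ let $\mathcal X^i_r=L_1(\mathbb R_+,X^i,(1+m^r)\,dm)$ (Bochner space), with its natural order. *Coefficients.* Let $a(x,m)\ge 0$ be measurable on $\Omega\times\mathbb R_+$ and let $\alpha_1,\alpha_2\in L_{\infty,loc}(\mathbb R_+)$, $0<M<\infty$ be such that $\alpha_1(m)\le a(x,m)\le\alpha_2(m)\le M\alpha_1(m)$ for a.e. $m,x$. Let $b(x,m,s)\ge 0$ and $\beta(m,s)\ge 0$ be measurable, vanishing for $m>s$, with $b(x,m,s)\le\beta(m,s)$ for a.e. $x\in\Omega$ and a.e. $0\le m\le s$. Suppose that there are $l\ge 0$, $b_0\ge 1$, $\beta_0$ with $$\int_0^s b(x,m,s)\,dm\le b_0(1+s^l)\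 \text{ for a.e. }x\in\Omega,\ s\ge 0,\qquad \int_0^s\beta(m,s)\,dm\le\beta_0(1+s^l)\ \text{ for all }s\ge 0,$$ and that for some $r_0,s_0\ge 0$ the family of functions $z\mapsto s z^{r_0}\beta(zs,s)$, $s\ge s_0$, is bounded and equi-integrable in $L_1([0,1])$. In the case $i=0$ assume in addition that $a(\cdot,m)$ is continuous on $\overline\Omega$ for a.e. $m$ and, for the assertion on $\mathbf K^0$ only, that $b(\cdot,m,s)$ is continuous on $\overline\Omega$ for a.e. $0\le m\le s$ (where the coefficients are taken to be measurable on $\overline\Omega\times\mathbb R_+$, resp. $\overline\Omega\times\mathbb R_+^2$). *Operators.* Let $(T^i_{0,m})_{m\in\mathbb R_+}$ be linear operators in $X^i$. On $\mathcal X^i_r$ define $[\mathbf T^i_0\mathbf u](m)=T^i_{0,m}\mathbf u(m)$, $\mathbf A^i u=-a u$, $\mathfrak A^iu=-\alpha_1u$, $$[\mathbf B^iu](x,m)=\int_m^\infty a(x,s)b(x,m,s)u(x,s)\,ds,\qquad [\mathfrak B^iu](x,m)=\int_m^\infty\alpha_2(s)\beta(m,s)u(x,s)\,ds,$$ each on the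 set of all $\mathbf u\in\mathcal X^i_r$ for which the expression makes sense (in particular $\mathbf u(m)\in D(T^i_{0,m})$ for a.e. $m$ in the case of $\mathbf T^i_0$) and belongs to $\mathcal X^i_r$. Put $\mathfrak K^i=\mathbf T^i_0+\mathfrak A^i+\mathfrak B^i$ and $\mathbf K^i=\mathbf T^i_0+\mathbf A^i+\mathbf B^i$, each on the intersection of the domains of its three summands. Say that (A1) holds in $\mathcal X^i_r$ if for a.e. $m$ the operator $T^i_{0,m}$ generates a substochastic (that is, positive and contractive $C_0$-) semigroup $(G_m(t))_{t\ge 0}$ on $X^i$, and $\mathbf T^i_0$ generates a substochastic semigroup $(\mathbf G(t))_{t\ge0}$ on $\mathcal X^i_r$ with $[\mathbf G(t)\mathbf u](m)=G_m(t)\mathbf u(m)$ for all $t\ge 0$, $\mathbf u\in\mathcal X^i_r$ and a.e. $m$. **Theorem.** There is $r_1>\max\{l,r_0\}$ such that for every $r\ge r_1$ and every $i\in\{0,1\}$ for which (A1) holds in $\mathcal X^i_r$: 1. $D(\mathfrak K^i)=D(\mathbf T^i_0)\cap D(\mathbf A^i)$, and $\mathfrak K^i$ with this domain generates a positive $C_0$-semigroup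 on $\mathcal X^i_r$; 2. $D(\mathbf K^i)=D(\mathbf T^i_0)\cap D(\mathbf A^i)$, and $\mathbf K^i$ with this domain generates a positive $C_0$-semigroup on $\mathcal X^i_r$. -/

import Mathlib

open MeasureTheory Set Filter Topology
open scoped ENNReal ZeroAtInfty

namespace TransFrag

/-! ### Strongly continuous semigroups and their generators -/

section Semigroups

variable {E : Type*} [NormedAddCommGroup E] [NormedSpace ℝ E]

/-- A `C₀`-semigroup of bounded operators; only the values `S t` with `0 ≤ t` matter. -/
structure IsC0Semigroup (S : ℝ → E →L[ℝ] E) : Prop where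
  zero : S 0 = ContinuousLinearMap.id ℝ E
  add : ∀ s t : ℝ, 0 ≤ s → 0 ≤ t → S (s + t) = (S s).comp (S t)
  cont : ∀ u : E, Tendsto (fun t => S t u) (𝓝[>] 0) (𝓝 u)

/-- `A` (with its domain) is the infinitesimal generator of `S`:
`u ∈ D(A)` and `A u = v` if and only if `(S t u - u) / t → v` as `t → 0⁺`. -/
def IsGenerator (S : ℝ → E →L[ℝ] E) (A : E →ₗ.[ℝ] E) : Prop :=
  ∀ u v : E, (u, v) ∈ A.graph ↔ Tendsto (fun t : ℝ => t⁻¹ • (S t u - u)) (𝓝[>] 0) (𝓝 v)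

/-- Positivity of a semigroup with respect to the set `P` of nonnegative elements. -/
def IsPositiveSemigroup (P : Set E) (S : ℝ → E →L[ℝ] E) : Prop :=
  ∀ t : ℝ, 0 ≤ t → ∀ u ∈ P, S t u ∈ P

/-- Substochastic semigroup: a positive `C₀`-semigroup of contractions. -/
structure IsSubstochastic (P : Set E) (S : ℝ → E →L[ℝ] E) : Prop where
  semigroup : IsC0Semigroup S
  positive : IsPositiveSemigroup P S
  contractive : ∀ t : ℝ, 0 ≤ t → ‖S t‖ ≤ 1

/-- The operator `A` (with its domain) generates a positive `C₀`-semigroup. -/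
def GeneratesPositiveC0Semigroup (P : Set E) (A : E →ₗ.[ℝ] E) : Prop :=
  ∃ S : ℝ → E →L[ℝ] E, IsC0Semigroup S ∧ IsPositiveSemigroup P S ∧ IsGenerator S A

end Semigroups

/-! ### The spaces -/

/-- Physical space `ℝᴺ`. -/
abbrev Sp (N : ℕ) := EuclideanSpace ℝ (Fin N)

/-- Lebesgue measure on `ℝ₊ = [0, ∞)`. -/
noncomputable abbrev halfLine : Measure ℝ := volume.restrict (Ici (0 : ℝ))

/-- The measure `dm_r = (1 + m ^ r) dm` on `ℝ₊`. -/
noncomputable def massMeasure (r : ℝ) : Measure ℝ :=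
  halfLine.withDensity fun m => ENNReal.ofReal (1 + m ^ r)

instance (r : ℝ) : SFinite (massMeasure r) := by
  unfold massMeasure; infer_instance

/-- The Bochner space `L₁(ℝ₊, X, dm_r)`. -/
noncomputable abbrev BochnerL1 (X : Type*) [NormedAddCommGroup X] (r : ℝ) := Lp X 1 (massMeasure r)

/-- `X_x¹ = L₁(Ω, dx)`. -/
noncomputable abbrev SpaceL1 {N : ℕ} (Ω : Set (Sp N)) := Lp ℝ 1 (volume.restrict Ω)

/-- `X_x⁰`: continuous functions on the closure of `Ω` that vanish at infinity. This is
`C(closure Ω)` if `Ω` is bounded (the closure is then compact), and the space of continuous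
functions tending to `0` as `‖x‖ → ∞` if `Ω` is the whole space. -/
abbrev SpaceC0 {N : ℕ} (Ω : Set (Sp N)) := C₀(closure Ω, ℝ)

/-- Classes of measurable functions on `Ω` modulo equality almost everywhere. -/
abbrev FunOn {N : ℕ} (Ω : Set (Sp N)) := Sp N →ₘ[(volume.restrict Ω : Measure (Sp N))] ℝ

/-- An element of `L₁(Ω)` as a scalar function on `Ω`. -/
noncomputable def ofL1 {N : ℕ} (Ω : Set (Sp N)) : SpaceL1 Ω →ₗ[ℝ] FunOn Ω where
  toFun u := (u : FunOn Ω)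
  map_add' _ _ := rfl
  map_smul' _ _ := rfl

theorem aesm_extend {N : ℕ} (Ω : Set (Sp N)) (u : SpaceC0 Ω) :
    AEStronglyMeasurable (Function.extend (Subtype.val : closure Ω → Sp N) u 0)
      (volume.restrict Ω) := by
  refine Measurable.aestronglyMeasurable ?_
  exact (MeasurableEmbedding.subtype_coe isClosed_closure.measurableSet).measurable_extend
    u.continuous.measurable measurable_const

/-- A function continuous on the closure of `Ω` as a scalar function on `Ω`. For open `Ω` nothing is
lost: two such functions that agree almost everywhere on `Ω` are equal (see `ofC0_injective`). -/
noncomputable def ofC0 {N : ℕ} (Ω : Set (Sp N)) : SpaceC0 Ω →ₗ[ℝ] FunOn Ω where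
  toFun u := AEEqFun.mk (Function.extend (Subtype.val : closure Ω → Sp N) u 0) (aesm_extend Ω u)
  map_add' u v := by
    rw [AEEqFun.mk_add_mk, AEEqFun.mk_eq_mk]
    refine Eventually.of_forall fun x => ?_
    by_cases hx : ∃ y : closure Ω, (y : Sp N) = x
    · obtain ⟨y, rfl⟩ := hx
      simp
    · simp [Function.extend_apply' _ _ _ hx]
  map_smul' c u := by
    refine (AEEqFun.mk_eq_mk.2 (Eventually.of_forall fun x => ?_)).trans
      (AEEqFun.smul_mk c _ (aesm_extend Ω u))
    by_cases hx : ∃ y : closure Ω, (y : Sp N) = x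
    · obtain ⟨y, rfl⟩ := hx
      simp
    · simp [Function.extend_apply' _ _ _ hx]

theorem ofL1_injective {N : ℕ} (Ω : Set (Sp N)) : Function.Injective (ofL1 Ω) :=
  fun _ _ h => Subtype.ext h

theorem ofC0_coe {N : ℕ} {Ω : Set (Sp N)} (u : SpaceC0 Ω) :
    ∀ᵐ x ∂(volume.restrict Ω : Measure (Sp N)), ∀ hx : x ∈ closure Ω, ofC0 Ω u x = u ⟨x, hx⟩ := by
  have h := AEEqFun.coeFn_mk _ (aesm_extend Ω u)
  filter_upwards [h] with x hx hx'
  refine hx.trans ?_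
  exact Subtype.val_injective.extend_apply u 0 ⟨x, hx'⟩

theorem ofC0_injective {N : ℕ} {Ω : Set (Sp N)} (hΩ : IsOpen Ω) :
    Function.Injective (ofC0 Ω) := by
  intro u v h
  have hu := ofC0_coe u
  have hv := ofC0_coe v
  rw [h] at hu
  -- the set of `x ∈ Ω` where the two functions differ is open and null, hence empty
  set e : Ω → closure Ω := Set.inclusion subset_closure
  have he : Continuous e := continuous_inclusion subset_closure
  have hden : DenseRange e := by
    rw [denseRange_inclusion_iff]
  have hopen : IsOpen (Subtype.val '' {x : Ω | u (e x) ≠ v (e x)}) := by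
    refine hΩ.isOpenMap_subtype_val _ ?_
    exact isOpen_ne_fun (u.continuous.comp he) (v.continuous.comp he)
  have hnull : volume (Subtype.val '' {x : Ω | u (e x) ≠ v (e x)}) = 0 := by
    have h2 : ∀ᵐ x ∂(volume.restrict Ω : Measure (Sp N)), ∀ hx : x ∈ closure Ω,
        u ⟨x, hx⟩ = v ⟨x, hx⟩ := by
      filter_upwards [hu, hv] with x h3 h4 hx
      rw [← h3 hx, ← h4 hx]
    rw [ae_restrict_iff' hΩ.measurableSet] at h2
    refine measure_mono_null ?_ (ae_iff.1 h2)
    rintro _ ⟨x, hx, rfl⟩ hall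
    exact hx (hall x.2 (subset_closure x.2))
  have hempty := hopen.measure_eq_zero_iff volume |>.1 hnull
  have heq : (u : closure Ω → ℝ) ∘ e = v ∘ e := by
    funext x
    by_contra hne
    have : (x : Sp N) ∈ Subtype.val '' {x : Ω | u (e x) ≠ v (e x)} := ⟨x, hne, rfl⟩
    rw [hempty] at this
    exact this
  exact DFunLike.coe_injective (hden.equalizer u.continuous v.continuous heq)

/-! ### The operators

Below `X` is the space of functions of `x`, and `ι` realises its elements as scalar functions
on `Ω`; it is used only with `ι = ofL1 Ω` and `ι = ofC0 Ω`. -/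

section Operators

variable {N : ℕ} {Ω : Set (Sp N)} {X : Type*} [NormedAddCommGroup X] [NormedSpace ℝ X]

/-- Nonnegative elements of `X`. -/
def positiveCone (ι : X →ₗ[ℝ] FunOn Ω) : Set X := {f | 0 ≤ ι f}

/-- Nonnegative elements of `L₁(ℝ₊, X, dm_r)`. -/
def positiveConeL1 (ι : X →ₗ[ℝ] FunOn Ω) (r : ℝ) : Set (BochnerL1 X r) :=
  {u | ∀ᵐ m ∂(massMeasure r), 0 ≤ ι (u m)}

/-- Pairs `(u, v)` with `u(m) ∈ D(T m)` and `v(m) = T m (u(m))` for a.e. `m`. -/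
def transportGraph (T : ℝ → X →ₗ.[ℝ] X) (r : ℝ) : Submodule ℝ (BochnerL1 X r × BochnerL1 X r) where
  carrier := {p | ∀ᵐ m ∂(massMeasure r), (p.1 m, p.2 m) ∈ (T m).graph}
  zero_mem' := by
    have h := Lp.coeFn_zero X 1 (massMeasure r)
    filter_upwards [h] with m hm
    simp only [Prod.fst_zero, Prod.snd_zero, hm]
    exact (T m).graph.zero_mem
  add_mem' := by
    intro p q hp hq
    filter_upwards [hp, hq, Lp.coeFn_add p.1 q.1, Lp.coeFn_add p.2 q.2] with m h1 h2 h3 h4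
    rw [Prod.fst_add, Prod.snd_add, h3, h4]
    exact (T m).graph.add_mem h1 h2
  smul_mem' := by
    intro c p hp
    filter_upwards [hp, Lp.coeFn_smul c p.1, Lp.coeFn_smul c p.2] with m h1 h3 h4
    rw [Prod.smul_fst, Prod.smul_snd, h3, h4]
    exact (T m).graph.smul_mem c h1

/-- The transport operator `𝐓₀` in `L₁(ℝ₊, X, dm_r)`, acting as `T m` for a.e. `m`, on the domain
of all `u` such that `u(m) ∈ D(T m)` and `m ↦ T m (u(m))` belongs to `L₁(ℝ₊, X, dm_r)`. -/
noncomputable def transportOp (T : ℝ → X →ₗ.[ℝ] X) (r : ℝ) : BochnerL1 X r →ₗ.[ℝ] BochnerL1 X r :=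
  (transportGraph T r).toLinearPMap

/-- Pairs `(u, v)` with `v(x, m) = -a(x, m) u(x, m)`. -/
def lossGraph (ι : X →ₗ[ℝ] FunOn Ω) (a : Sp N → ℝ → ℝ) (r : ℝ) :
    Submodule ℝ (BochnerL1 X r × BochnerL1 X r) where
  carrier := {p | ∀ᵐ m ∂(massMeasure r), ∀ᵐ x ∂(volume.restrict Ω),
    ι (p.2 m) x = -a x m * ι (p.1 m) x}
  zero_mem' := by
    have h := Lp.coeFn_zero X 1 (massMeasure r)
    filter_upwards [h] with m hm
    simp only [Prod.fst_zero, Prod.snd_zero, hm, Pi.zero_apply, map_zero]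
    filter_upwards [AEEqFun.coeFn_zero (α := Sp N) (β := ℝ) (μ := volume.restrict Ω)] with x hx
    simp [hx]
  add_mem' := by
    intro p q hp hq
    filter_upwards [hp, hq, Lp.coeFn_add p.1 q.1, Lp.coeFn_add p.2 q.2] with m h1 h2 h3 h4
    rw [Prod.fst_add, Prod.snd_add, h3, h4, Pi.add_apply, Pi.add_apply, map_add, map_add]
    filter_upwards [h1, h2, AEEqFun.coeFn_add (ι (p.1 m)) (ι (q.1 m)),
      AEEqFun.coeFn_add (ι (p.2 m)) (ι (q.2 m))] with x h5 h6 h7 h8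
    rw [h7, h8, Pi.add_apply, Pi.add_apply, h5, h6]
    ring
  smul_mem' := by
    intro c p hp
    filter_upwards [hp, Lp.coeFn_smul c p.1, Lp.coeFn_smul c p.2] with m h1 h3 h4
    rw [Prod.smul_fst, Prod.smul_snd, h3, h4, Pi.smul_apply, Pi.smul_apply, map_smul, map_smul]
    filter_upwards [h1, AEEqFun.coeFn_smul c (ι (p.1 m)),
      AEEqFun.coeFn_smul c (ι (p.2 m))] with x h5 h7 h8
    rw [h7, h8, Pi.smul_apply, Pi.smul_apply, h5, smul_eq_mul, smul_eq_mul]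
    ring

/-- The loss operator `u ↦ -a u` on its maximal domain `{u | a u ∈ L₁(ℝ₊, X, dm_r)}`. -/
noncomputable def lossOp (ι : X →ₗ[ℝ] FunOn Ω) (a : Sp N → ℝ → ℝ) (r : ℝ) :
    BochnerL1 X r →ₗ.[ℝ] BochnerL1 X r :=
  (lossGraph ι a r).toLinearPMap

/-- The scalar function `f` on `Ω × ℝ₊` represents the `X`-valued function `u`:
it is jointly measurable and `f(·, m) = u(m)` for a.e. `m`. -/
def Represents (ι : X →ₗ[ℝ] FunOn Ω) {r : ℝ} (f : Sp N × ℝ → ℝ) (u : BochnerL1 X r) : Prop :=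
  AEStronglyMeasurable f ((volume.restrict Ω).prod (massMeasure r)) ∧
    ∀ᵐ m ∂(massMeasure r), ∀ᵐ x ∂(volume.restrict Ω), f (x, m) = ι (u m) x

/-- Pairs `(u, v)` such that `v(x, m) = ∫_m^∞ κ(x, m, s) u(x, s) ds` for a.e. `(x, m)`, the integral
being absolutely convergent. -/
def gainGraph (ι : X →ₗ[ℝ] FunOn Ω) (κ : Sp N → ℝ → ℝ → ℝ) (r : ℝ) :
    Submodule ℝ (BochnerL1 X r × BochnerL1 X r) where
  carrier := {p | ∃ f : Sp N × ℝ → ℝ, Represents ι f p.1 ∧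
    ∀ᵐ m ∂(massMeasure r), ∀ᵐ x ∂(volume.restrict Ω),
      IntegrableOn (fun s => κ x m s * f (x, s)) (Ioi m) ∧
      ι (p.2 m) x = ∫ s in Ioi m, κ x m s * f (x, s)}
  zero_mem' := by
    have h := Lp.coeFn_zero X 1 (massMeasure r)
    refine ⟨0, ⟨aestronglyMeasurable_zero, ?_⟩, ?_⟩
    · filter_upwards [h] with m hm
      simp only [Prod.fst_zero, hm, Pi.zero_apply, map_zero]
      filter_upwards [AEEqFun.coeFn_zero (α := Sp N) (β := ℝ) (μ := volume.restrict Ω)] with x hx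
      simp [hx]
    · filter_upwards [h] with m hm
      simp only [Prod.snd_zero, hm, Pi.zero_apply, map_zero]
      filter_upwards [AEEqFun.coeFn_zero (α := Sp N) (β := ℝ) (μ := volume.restrict Ω)] with x hx
      simp [hx]
  add_mem' := by
    rintro p q ⟨f, ⟨hf1, hf2⟩, hf3⟩ ⟨g, ⟨hg1, hg2⟩, hg3⟩
    refine ⟨f + g, ⟨hf1.add hg1, ?_⟩, ?_⟩
    · filter_upwards [hf2, hg2, Lp.coeFn_add p.1 q.1] with m h1 h2 h3
      rw [Prod.fst_add, h3, Pi.add_apply, map_add]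
      filter_upwards [h1, h2, AEEqFun.coeFn_add (ι (p.1 m)) (ι (q.1 m))] with x h5 h6 h7
      rw [h7, Pi.add_apply, Pi.add_apply, h5, h6]
    · filter_upwards [hf3, hg3, Lp.coeFn_add p.2 q.2] with m h1 h2 h3
      rw [Prod.snd_add, h3, Pi.add_apply, map_add]
      filter_upwards [h1, h2, AEEqFun.coeFn_add (ι (p.2 m)) (ι (q.2 m))] with x h5 h6 h7
      have e : (fun s => κ x m s * (f + g) (x, s)) =
          fun s => κ x m s * f (x, s) + κ x m s * g (x, s) := by
        funext s; rw [Pi.add_apply]; ring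
      rw [e, h7, Pi.add_apply, h5.2, h6.2]
      exact ⟨h5.1.add h6.1, (integral_add h5.1 h6.1).symm⟩
  smul_mem' := by
    rintro c p ⟨f, ⟨hf1, hf2⟩, hf3⟩
    refine ⟨c • f, ⟨hf1.const_smul c, ?_⟩, ?_⟩
    · filter_upwards [hf2, Lp.coeFn_smul c p.1] with m h1 h3
      rw [Prod.smul_fst, h3, Pi.smul_apply, map_smul]
      filter_upwards [h1, AEEqFun.coeFn_smul c (ι (p.1 m))] with x h5 h7
      rw [h7, Pi.smul_apply, Pi.smul_apply, h5]
    · filter_upwards [hf3, Lp.coeFn_smul c p.2] with m h1 h3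
      rw [Prod.smul_snd, h3, Pi.smul_apply, map_smul]
      filter_upwards [h1, AEEqFun.coeFn_smul c (ι (p.2 m))] with x h5 h7
      have e : (fun s => κ x m s * (c • f) (x, s)) = fun s => c * (κ x m s * f (x, s)) := by
        funext s; rw [Pi.smul_apply, smul_eq_mul]; ring
      rw [e, h7, Pi.smul_apply, h5.2, smul_eq_mul]
      exact ⟨h5.1.const_mul c, (integral_const_mul c _).symm⟩

/-- The gain operator `[B u](x, m) = ∫_m^∞ κ(x, m, s) u(x, s) ds`, defined on all `u` for which this
expression makes sense and belongs to `L₁(ℝ₊, X, dm_r)`. -/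
noncomputable def gainOp (ι : X →ₗ[ℝ] FunOn Ω) (κ : Sp N → ℝ → ℝ → ℝ) (r : ℝ) :
    BochnerL1 X r →ₗ.[ℝ] BochnerL1 X r :=
  (gainGraph ι κ r).toLinearPMap

/-- The transport–fragmentation operator `𝐊 = 𝐓₀ + 𝐀 + 𝐁` with loss rate `a` and gain kernel
`a(x, s) b(x, m, s)`, on the intersection of the domains of the three operators. -/
noncomputable def opK (ι : X →ₗ[ℝ] FunOn Ω) (T : ℝ → X →ₗ.[ℝ] X) (a : Sp N → ℝ → ℝ)
    (b : Sp N → ℝ → ℝ → ℝ) (r : ℝ) : BochnerL1 X r →ₗ.[ℝ] BochnerL1 X r :=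
  transportOp T r + lossOp ι a r + gainOp ι (fun x m s => a x s * b x m s) r

/-- The dominating operator `𝔎 = 𝐓₀ + 𝔄 + 𝔅` with loss rate `α₁(m)` and gain kernel
`α₂(s) β(m, s)`, on the intersection of the domains of the three operators. -/
noncomputable def opFrakK (ι : X →ₗ[ℝ] FunOn Ω) (T : ℝ → X →ₗ.[ℝ] X) (α₁ α₂ : ℝ → ℝ)
    (β : ℝ → ℝ → ℝ) (r : ℝ) : BochnerL1 X r →ₗ.[ℝ] BochnerL1 X r :=
  transportOp T r + lossOp ι (fun _ m => α₁ m) r + gainOp ι (fun _ m s => α₂ s * β m s) r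

/-- Main assumption on the transport part: for a.e. `m` the operator `T m` generates a substochastic
semigroup `G m` on `X`, and `𝐓₀` generates a substochastic semigroup on `L₁(ℝ₊, X, dm_r)` which
acts as `G m` for a.e. `m`. -/
def TransportAssumption (ι : X →ₗ[ℝ] FunOn Ω) (T : ℝ → X →ₗ.[ℝ] X) (r : ℝ) : Prop :=
  ∃ G : ℝ → ℝ → X →L[ℝ] X,
    (∀ᵐ m ∂halfLine, IsSubstochastic (positiveCone ι) (G m) ∧ IsGenerator (G m) (T m)) ∧
    ∃ S : ℝ → BochnerL1 X r →L[ℝ] BochnerL1 X r,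
      IsSubstochastic (positiveConeL1 ι r) S ∧ IsGenerator S (transportOp T r) ∧
      ∀ t : ℝ, 0 ≤ t → ∀ u : BochnerL1 X r, ∀ᵐ m ∂halfLine, S t u m = G m t (u m)

/-! The three graphs are graphs of functions, so that the operators above carry no default value. -/

theorem transportOp_graph (T : ℝ → X →ₗ.[ℝ] X) (r : ℝ) :
    (transportOp T r).graph = transportGraph T r := by
  refine Submodule.toLinearPMap_graph_eq _ ?_
  rintro ⟨u, v⟩ h (rfl : u = 0)
  change v = 0
  refine Lp.ext ?_
  filter_upwards [h, Lp.coeFn_zero X 1 (massMeasure r)] with m hm h0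
  rw [h0] at hm ⊢
  exact (T m).graph_fst_eq_zero_snd hm rfl

theorem lossOp_graph {ι : X →ₗ[ℝ] FunOn Ω} (hι : Function.Injective ι) (a : Sp N → ℝ → ℝ) (r : ℝ) :
    (lossOp ι a r).graph = lossGraph ι a r := by
  refine Submodule.toLinearPMap_graph_eq _ ?_
  rintro ⟨u, v⟩ h (rfl : u = 0)
  change v = 0
  refine Lp.ext ?_
  filter_upwards [h, Lp.coeFn_zero X 1 (massMeasure r)] with m hm h0
  rw [h0, Pi.zero_apply, map_zero] at hm
  rw [h0, Pi.zero_apply]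
  refine hι ?_
  rw [map_zero]
  refine AEEqFun.ext ?_
  filter_upwards [hm, AEEqFun.coeFn_zero (α := Sp N) (β := ℝ) (μ := volume.restrict Ω)] with x h1 h2
  rw [h1, h2]; simp

theorem halfLine_ac (r : ℝ) : halfLine ≪ massMeasure r := by
  refine withDensity_absolutelyContinuous' (by fun_prop) ?_
  filter_upwards [ae_restrict_mem measurableSet_Ici] with m hm
  have : (0 : ℝ) ≤ m ^ r := Real.rpow_nonneg hm r
  simp only [ne_eq, ENNReal.ofReal_eq_zero, not_le]
  linarith

theorem gainOp_graph {ι : X →ₗ[ℝ] FunOn Ω} (hι : Function.Injective ι) (κ : Sp N → ℝ → ℝ → ℝ)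
    (r : ℝ) : (gainOp ι κ r).graph = gainGraph ι κ r := by
  refine Submodule.toLinearPMap_graph_eq _ ?_
  rintro ⟨u, v⟩ ⟨f, ⟨hf1, hf2⟩, hf3⟩ (rfl : u = 0)
  change v = 0
  -- `f` vanishes almost everywhere, first for a.e. `m` and then for a.e. `x`
  have hz : ∀ᵐ m ∂(massMeasure r), ∀ᵐ x ∂(volume.restrict Ω), f (x, m) = 0 := by
    filter_upwards [hf2, Lp.coeFn_zero X 1 (massMeasure r)] with m hm h0
    rw [h0, Pi.zero_apply, map_zero] at hm
    filter_upwards [hm, AEEqFun.coeFn_zero (α := Sp N) (β := ℝ) (μ := volume.restrict Ω)]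
      with x h1 h2
    rw [h1, h2]; rfl
  have hz' : ∀ᵐ x ∂(volume.restrict Ω : Measure (Sp N)), ∀ᵐ m ∂(massMeasure r), f (x, m) = 0 := by
    have e := hf1.ae_eq_mk
    have e1 := Measure.ae_ae_of_ae_prod e
    have e2 : ∀ᵐ m ∂(massMeasure r), ∀ᵐ x ∂(volume.restrict Ω : Measure (Sp N)),
        f (x, m) = hf1.mk f (x, m) := by
      refine Measure.ae_ae_of_ae_prod
        (p := fun z : ℝ × Sp N => f (z.2, z.1) = hf1.mk f (z.2, z.1)) ?_
      have := Measure.measurePreserving_swap (μ := massMeasure r)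
        (ν := (volume.restrict Ω : Measure (Sp N)))
      exact this.quasiMeasurePreserving.ae e
    have hm : MeasurableSet {z : Sp N × ℝ | hf1.mk f (z.1, z.2) = 0} :=
      hf1.stronglyMeasurable_mk.measurable (measurableSet_singleton 0)
    have e3 := (Measure.ae_ae_comm (p := fun (x : Sp N) (m : ℝ) => hf1.mk f (x, m) = 0)
      (μ := (volume.restrict Ω : Measure (Sp N))) (ν := massMeasure r) hm).2 (by
        filter_upwards [hz, e2] with m h1 h2
        filter_upwards [h1, h2] with x h3 h4
        rw [← h4, h3])
    filter_upwards [e1, e3] with x h1 h2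
    filter_upwards [h1, h2] with m h3 h4
    exact h3.trans h4
  have hpos : ∀ᵐ m ∂(massMeasure r), 0 ≤ m :=
    (withDensity_absolutelyContinuous _ _).ae_le (ae_restrict_mem measurableSet_Ici)
  refine Lp.ext ?_
  filter_upwards [hf3, hpos, Lp.coeFn_zero X 1 (massMeasure r)] with m hm hm0 h0
  rw [h0, Pi.zero_apply]
  refine hι ?_
  rw [map_zero]
  refine AEEqFun.ext ?_
  filter_upwards [hm, hz', AEEqFun.coeFn_zero (α := Sp N) (β := ℝ) (μ := volume.restrict Ω)]
    with x h1 h2 h3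
  rw [h1.2, h3, Pi.zero_apply]
  refine integral_eq_zero_of_ae ?_
  have h4 : ∀ᵐ s ∂(volume.restrict (Ioi m)), f (x, s) = 0 :=
    ae_mono (Measure.restrict_mono (fun s (hs : m < s) => hm0.trans hs.le) le_rfl)
      ((halfLine_ac r).ae_le h2)
  filter_upwards [h4] with s hs
  simp [hs]

end Operators

/-! ### Conditions on the coefficients -/

/-- Measurable and locally essentially bounded functions on `ℝ₊ = [0, ∞)`. -/
def LocEssBounded (α : ℝ → ℝ) : Prop :=
  Measurable α ∧ ∀ R : ℝ, ∃ C : ℝ, ∀ᵐ m ∂(volume.restrict (Icc (0 : ℝ) R)), |α m| ≤ C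

/-- The fragmentation rate `a` is measurable, and
`0 ≤ a(x, m)`, `α₁(m) ≤ a(x, m) ≤ α₂(m) ≤ M α₁(m)` for a.e. `m` and `x`. -/
structure RateBounds {N : ℕ} (Ω : Set (Sp N)) (a : Sp N → ℝ → ℝ) (α₁ α₂ : ℝ → ℝ) (M : ℝ) :
    Prop where
  measurable : Measurable fun p : Sp N × ℝ => a p.1 p.2
  locBdd₁ : LocEssBounded α₁
  locBdd₂ : LocEssBounded α₂
  bounds : ∀ᵐ m ∂halfLine, ∀ᵐ x ∂(volume.restrict Ω), 0 ≤ a x m ∧ α₁ m ≤ a x m ∧ a x m ≤ α₂ m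
  comparable : ∀ᵐ m ∂halfLine, α₂ m ≤ M * α₁ m

/-- `x`-dependent fragmentation kernel `b(x, m, s)`: measurable, nonnegative, zero for `m > s`. -/
structure IsFragKernel {N : ℕ} (b : Sp N → ℝ → ℝ → ℝ) : Prop where
  measurable : Measurable fun p : Sp N × ℝ × ℝ => b p.1 p.2.1 p.2.2
  nonneg : ∀ x m s, 0 ≤ b x m s
  support : ∀ x m s, s < m → b x m s = 0

/-- The zeroth moment bound `∫₀ˢ b(x, m, s) dm ≤ b₀ (1 + s ^ l)` at `(x, s)`, for
`k = b(x, ·, s)`. The lower integral is used so that the bound includes integrability. -/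
def MomentBound (k : ℝ → ℝ) (b₀ l s : ℝ) : Prop :=
  ∫⁻ m in Icc 0 s, ENNReal.ofReal (k m) ≤ ENNReal.ofReal (b₀ * (1 + s ^ l))

/-- The family `{z ↦ s z ^ r₀ β(z s, s)}`, `s ≥ s₀`, is bounded and equi-integrable in
`L₁([0, 1])`. -/
def EquiIntegrableKernel (β : ℝ → ℝ → ℝ) (r₀ s₀ : ℝ) : Prop :=
  UniformIntegrable (fun (s : Ici s₀) (z : ℝ) => (s : ℝ) * z ^ r₀ * β (z * s) s) 1
    (volume.restrict (Icc (0 : ℝ) 1))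

end TransFrag

/-! The gain term is dominated by the loss term, with room to spare, once the weight `1 + m ^ r` has
a high enough power. The substitution `m = z s` turns the `r`-th moment of `β(·, s)` into `s ^ r ∫ z
^ (r - r₀) (s z ^ r₀ β(z s, s)) dz`. The factor `z ^ (r - r₀)` is small away from `z = 1`, and
equi-integrability makes the mass near `z = 1` small uniformly in `s`. The zeroth moment, of order
`s ^ l`, is negligible against `s ^ r` for `r > l`. As `α₂ ≤ M α₁`, this gives `α₂(s) ∫ β(m, s) (1 +
m ^ r) dm ≤ (α₁(s) / 2 + C) (1 + s ^ r)` (`exists_gainBound`), hence `‖B u‖ ≤ (∫ α₁ ‖u(m)‖) / 2 + C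
‖u‖` (`norm_gain_le`).

For a.e. `m` the operator `T m` is dissipative, and so is `T m - a(·, m)` with the extra gain `α₁(m)
‖u(m)‖`. Integration in `m` gives the a priori estimate `(c - C) ‖u‖ + (∫ α₁ ‖u(m)‖) / 2 ≤ ‖c u - K
u‖` (`dissipative_estimate`): `K - C` is dissipative, and the loss term is controlled by the
right-hand side.

To solve `c u - K u = f` with `c > C`, let first `f` vanish for `m > n`. Transport acts separately
on each `m`, and fragmentation only produces smaller masses, so the problem stays on `m ≤ n`, where
the loss rate is bounded. There `d + A + B` is bounded and positive for large `d`, of norm at most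
`d + C < d + c`, and a Neumann series around the resolvent of `T₀` at `c + d` gives a solution that
is positive if `f` is (`exists_solution_trunc`). For general `f` one lets `n → ∞`: the a priori
estimate and Fatou's lemma make the solutions and their loss and gain terms converge, and the limit
lies in `D(T₀) ∩ D(A)` itself, so that no closure is needed (`exists_solution`). The Hille–Yosida
theorem, in a form that keeps track of an invariant cone, then yields the positive semigroup.

The argument uses only a few properties shared by `L₁(Ω)` and `C₀(Ω)`, collected in
`IsFunctionSpace`. It covers both operators at once, since each has a loss rate between `α₁` and
`α₂` and a gain kernel below `α₂(s) β(m, s)`. -/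

namespace TransFrag

/-! ### Closed convex cones and integrals in them -/

section Cones

variable {E : Type*} [NormedAddCommGroup E] [NormedSpace ℝ E]

/-- Closed convex cones. -/
structure IsClosedCone (P : Set E) : Prop where
  isClosed : IsClosed P
  zero_mem : (0 : E) ∈ P
  add_mem : ∀ u ∈ P, ∀ v ∈ P, u + v ∈ P
  smul_mem : ∀ c : ℝ, 0 ≤ c → ∀ u ∈ P, c • u ∈ P

theorem IsClosedCone.convex {P : Set E} (hP : IsClosedCone P) : Convex ℝ P :=
  fun _ hu _ hv _ _ ha hb _ => hP.add_mem _ (hP.smul_mem _ ha _ hu) _ (hP.smul_mem _ hb _ hv)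

theorem IsClosedCone.sum_mem {P : Set E} (hP : IsClosedCone P) {ι : Type*} (s : Finset ι)
    (f : ι → E) (hf : ∀ i ∈ s, f i ∈ P) : ∑ i ∈ s, f i ∈ P := by
  classical
  induction s using Finset.induction_on with
  | empty => simpa using hP.zero_mem
  | insert i s hi ih =>
    rw [Finset.sum_insert hi]
    exact hP.add_mem _ (hf i (Finset.mem_insert_self i s)) _
      (ih fun j hj => hf j (Finset.mem_insert_of_mem hj))

theorem IsClosedCone.hasSum_mem {P : Set E} (hP : IsClosedCone P) {ι : Type*} {f : ι → E} {u : E}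
    (h : HasSum f u) (hf : ∀ i, f i ∈ P) : u ∈ P :=
  hP.isClosed.mem_of_tendsto h (Eventually.of_forall fun s => hP.sum_mem s f fun i _ => hf i)

/-- A closed convex cone contains the Bochner integrals of functions with values in it. -/
theorem IsClosedCone.integral_mem [CompleteSpace E] {P : Set E} (hP : IsClosedCone P)
    {α : Type*} [MeasurableSpace α] {μ : Measure α} {h : α → E} (hh : ∀ᵐ a ∂μ, h a ∈ P) :
    ∫ a, h a ∂μ ∈ P := by
  by_cases hi : Integrable h μ
  swap
  · rw [integral_undef hi]; exact hP.zero_mem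
  by_contra hnot
  obtain ⟨f, c, hf, hc⟩ := geometric_hahn_banach_closed_point hP.convex hP.isClosed hnot
  have hc0 : 0 < c := by simpa using hf 0 hP.zero_mem
  -- A functional bounded above on a cone is nonpositive there, since otherwise scaling would reach
  -- the bound `c`. As `c > 0`, this contradicts the separation once `f` is taken under the
  -- integral.
  have hneg : ∀ u ∈ P, f u ≤ 0 := by
    intro u hu
    by_contra! hpos
    have h1 := hf _ (hP.smul_mem (c / f u) (by positivity) u hu)
    rw [map_smul, smul_eq_mul, div_mul_cancel₀ _ hpos.ne'] at h1
    exact lt_irrefl _ h1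
  have h2 : f (∫ a, h a ∂μ) ≤ 0 := by
    rw [← ContinuousLinearMap.integral_comp_comm f hi]
    exact integral_nonpos_of_ae (hh.mono fun a ha => hneg _ ha)
  linarith

end Cones

/-! ### Strong limits of contractions -/

section Convergence

variable {E : Type*} [NormedAddCommGroup E] [NormedSpace ℝ E]

theorem norm_apply_le_of_norm_le_one {L : E →L[ℝ] E} (hL : ‖L‖ ≤ 1) (u : E) : ‖L u‖ ≤ ‖u‖ :=
  (L.le_of_opNorm_le hL u).trans_eq (one_mul _)

theorem tendsto_id_of_dense {ι : Type*} {l : Filter ι} {F : ι → E →L[ℝ] E}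
    (hF : ∀ᶠ i in l, ‖F i‖ ≤ 1) {D : Set E} (hD : Dense D)
    (h : ∀ u ∈ D, Tendsto (fun i => F i u) l (𝓝 u)) (u : E) : Tendsto (fun i => F i u) l (𝓝 u) := by
  rw [Metric.tendsto_nhds]
  intro ε hε
  obtain ⟨w, hw, hd⟩ := hD.exists_dist_lt u (show 0 < ε / 4 by positivity)
  filter_upwards [hF, Metric.tendsto_nhds.1 (h w hw) (ε / 4) (by positivity)] with i h1 h2
  have h3 : dist (F i u) (F i w) ≤ dist u w := by
    rw [dist_eq_norm, dist_eq_norm, ← map_sub]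
    exact norm_apply_le_of_norm_le_one h1 _
  have := dist_triangle4 (F i u) (F i w) w u
  rw [dist_comm w u] at this
  linarith

theorem cauchySeq_of_dense {F : ℕ → E →L[ℝ] E} (hF : ∀ n, ‖F n‖ ≤ 1) {D : Set E} (hD : Dense D)
    (h : ∀ u ∈ D, CauchySeq fun n => F n u) (u : E) : CauchySeq fun n => F n u := by
  rw [Metric.cauchySeq_iff]
  intro ε hε
  obtain ⟨w, hw, hd⟩ := hD.exists_dist_lt u (show 0 < ε / 4 by positivity)
  obtain ⟨n₀, hn⟩ := Metric.cauchySeq_iff.1 (h w hw) (ε / 4) (by positivity)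
  refine ⟨n₀, fun m hm n hn' => ?_⟩
  have h3 : ∀ i, dist (F i u) (F i w) ≤ dist u w := fun i => by
    rw [dist_eq_norm, dist_eq_norm, ← map_sub]
    exact norm_apply_le_of_norm_le_one (hF i) _
  have h4 := dist_triangle4 (F m u) (F m w) (F n w) (F n u)
  have h5 := hn m hm n hn'
  have h6 := h3 m
  have h7 := h3 n
  rw [dist_comm (F n w)] at h4
  linarith

/-- The strong limit of a sequence of contractions. -/
theorem exists_strong_limit [CompleteSpace E] {F : ℕ → E →L[ℝ] E} (hF : ∀ n, ‖F n‖ ≤ 1)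
    (h : ∀ u, CauchySeq fun n => F n u) :
    ∃ L : E →L[ℝ] E, ‖L‖ ≤ 1 ∧ ∀ u, Tendsto (fun n => F n u) atTop (𝓝 (L u)) := by
  choose g hg using fun u => cauchySeq_tendsto_of_complete (h u)
  have hlin : ∀ u, ‖g u‖ ≤ 1 * ‖u‖ := fun u =>
    le_of_tendsto (hg u).norm (Eventually.of_forall fun n => (F n).le_of_opNorm_le (hF n) u)
  let L₀ : E →ₗ[ℝ] E :=
    { toFun := g
      map_add' := fun u v => tendsto_nhds_unique (hg (u + v)) (by
        simpa only [map_add] using (hg u).add (hg v))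
      map_smul' := fun c u => tendsto_nhds_unique (hg (c • u)) (by
        simpa only [map_smul, RingHom.id_apply] using (hg u).const_smul c) }
  exact ⟨L₀.mkContinuous 1 hlin, L₀.mkContinuous_norm_le zero_le_one hlin, hg⟩

theorem tendsto_apply_of_tendsto {F : ℕ → E →L[ℝ] E} (hF : ∀ n, ‖F n‖ ≤ 1) {L : E →L[ℝ] E}
    (h : ∀ u, Tendsto (fun n => F n u) atTop (𝓝 (L u))) {x : ℕ → E} {y : E}
    (hx : Tendsto x atTop (𝓝 y)) : Tendsto (fun n => F n (x n)) atTop (𝓝 (L y)) := by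
  have h1 : Tendsto (fun n => F n (x n - y)) atTop (𝓝 0) := by
    refine squeeze_zero_norm (fun n => norm_apply_le_of_norm_le_one (hF n) _) ?_
    simpa using (hx.sub_const y).norm
  simpa using h1.add (h y)

theorem norm_pow_apply_le (A : E →L[ℝ] E) (n : ℕ) (u : E) : ‖(A ^ n) u‖ ≤ ‖A‖ ^ n * ‖u‖ := by
  induction n with
  | zero => simp
  | succ n ih =>
    rw [pow_succ', mul_apply_eq_comp, pow_succ', mul_assoc]
    exact (A.le_opNorm _).trans (by gcongr)

end Convergence

/-! ### Exponentials of bounded operators -/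

section Exponentials

open NormedSpace

variable {E : Type*} [NormedAddCommGroup E] [NormedSpace ℝ E] [CompleteSpace E]

theorem hasSum_exp_apply (A : E →L[ℝ] E) (u : E) :
    HasSum (fun n : ℕ => ((n.factorial : ℝ)⁻¹) • (A ^ n) u) (exp A u) := by
  have h := (exp_series_hasSum_exp' (𝕂 := ℝ) A).mapL (ContinuousLinearMap.apply ℝ E u)
  simpa using h

theorem norm_exp_le_exp_norm (A : E →L[ℝ] E) : ‖exp A‖ ≤ Real.exp ‖A‖ := by
  refine ContinuousLinearMap.opNorm_le_bound _ (Real.exp_pos _).le fun u => ?_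
  have h1 := hasSum_exp_apply A u
  have h2 : HasSum (fun n : ℕ => ((n.factorial : ℝ)⁻¹ * ‖A‖ ^ n) * ‖u‖) (Real.exp ‖A‖ * ‖u‖) := by
    refine HasSum.mul_right _ ?_
    have := exp_series_hasSum_exp' (𝕂 := ℝ) ‖A‖
    rw [← Real.exp_eq_exp_ℝ] at this
    simpa using this
  rw [← h1.tsum_eq, ← h2.tsum_eq]
  refine tsum_of_norm_bounded h2.summable.hasSum fun n => ?_
  rw [norm_smul, Real.norm_of_nonneg (by positivity), mul_assoc]
  gcongr
  exact norm_pow_apply_le A n u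

theorem exp_sub_smul_one (c : ℝ) (A : E →L[ℝ] E) :
    exp (A - c • (1 : E →L[ℝ] E)) = Real.exp (-c) • exp A := by
  have h1 : A - c • (1 : E →L[ℝ] E) = algebraMap ℝ _ (-c) + A := by
    rw [Algebra.algebraMap_eq_smul_one, neg_smul]; abel
  let _ : NormedAlgebra ℚ (E →L[ℝ] E) := NormedAlgebra.restrictScalars ℚ ℝ _
  rw [h1, exp_add_of_commute (Algebra.commutes _ _), ← algebraMap_exp_comm (𝕂 := ℝ),
    ← Real.exp_eq_exp_ℝ, ← Algebra.smul_def]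

/-- The scalar factor `e ^ (-t c)` pays for the growth `e ^ (t ‖A‖)`. Yosida approximations have
exactly this form, with `A = λ² R(λ)` and `c = λ`. -/
theorem norm_exp_smul_sub_le_one {A : E →L[ℝ] E} {c t : ℝ} (hA : ‖A‖ ≤ c) (ht : 0 ≤ t) :
    ‖exp (t • (A - c • (1 : E →L[ℝ] E)))‖ ≤ 1 := by
  rw [smul_sub, smul_smul, exp_sub_smul_one, norm_smul, Real.norm_of_nonneg (Real.exp_pos _).le]
  calc Real.exp (-(t * c)) * ‖exp (t • A)‖ ≤ Real.exp (-(t * c)) * Real.exp (t * c) := by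
        gcongr
        refine (norm_exp_le_exp_norm _).trans (Real.exp_le_exp.2 ?_)
        rw [norm_smul, Real.norm_of_nonneg ht]
        gcongr
    _ = 1 := by rw [← Real.exp_add]; simp

theorem exp_smul_sub_mem {P : Set E} (hP : IsClosedCone P) {A : E →L[ℝ] E}
    (hA : ∀ u ∈ P, A u ∈ P) {c t : ℝ} (ht : 0 ≤ t) {u : E} (hu : u ∈ P) :
    exp (t • (A - c • (1 : E →L[ℝ] E))) u ∈ P := by
  rw [smul_sub, smul_smul, exp_sub_smul_one, _root_.smul_apply]
  refine hP.smul_mem _ (Real.exp_pos _).le _ (hP.hasSum_mem (hasSum_exp_apply _ u) fun n => ?_)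
  refine hP.smul_mem _ (by positivity) _ ?_
  induction n with
  | zero => simpa using hu
  | succ n ih =>
    rw [pow_succ', mul_apply_eq_comp, _root_.smul_apply]
    exact hP.smul_mem _ ht _ (hA _ ih)

/-- The path `s ↦ e ^ ((t - s) B) e ^ (s A) u` joins the two exponentials. Because `A` and `B`
commute, its derivative is a product of contractions applied to `A u - B u`. -/
theorem norm_exp_smul_sub_exp_smul_le {A B : E →L[ℝ] E} (hAB : Commute A B)
    (hA : ∀ t : ℝ, 0 ≤ t → ‖exp (t • A)‖ ≤ 1) (hB : ∀ t : ℝ, 0 ≤ t → ‖exp (t • B)‖ ≤ 1)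
    {t : ℝ} (ht : 0 ≤ t) (u : E) :
    ‖exp (t • A) u - exp (t • B) u‖ ≤ t * ‖A u - B u‖ := by
  have hder : ∀ s : ℝ, HasDerivAt (fun s : ℝ => (exp ((t - s) • B) * exp (s • A)) u)
      ((exp ((t - s) • B) * exp (s • A)) (A u - B u)) s := by
    intro s
    have h1 := hasDerivAt_exp_smul_const (𝕂 := ℝ) A s
    have h2 : HasDerivAt (fun s : ℝ => exp ((t - s) • B)) (-(exp ((t - s) • B) * B)) s := by
      have := (hasDerivAt_exp_smul_const (𝕂 := ℝ) B (t - s)).scomp s ((hasDerivAt_id s).const_sub t)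
      simpa [Function.comp_def] using this
    have h3 := (h2.mul h1).clm_apply (hasDerivAt_const s u)
    refine h3.congr_deriv ?_
    have hc : exp ((t - s) • B) * B * exp (s • A) = exp ((t - s) • B) * (exp (s • A) * B) := by
      have : Commute B (exp (s • A)) := ((hAB.symm.smul_right s).exp_right)
      rw [mul_assoc, this.eq]
    rw [neg_mul, hc, map_zero, add_zero, map_sub]
    simp only [_root_.add_apply, _root_.neg_apply,
      mul_apply_eq_comp]
    abel
  have hb : ∀ s ∈ Icc (0 : ℝ) t,
      ‖(exp ((t - s) • B) * exp (s • A)) (A u - B u)‖ ≤ ‖A u - B u‖ := by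
    intro s hs
    exact (norm_apply_le_of_norm_le_one (hB _ (by linarith [hs.2])) _).trans
      (norm_apply_le_of_norm_le_one (hA _ hs.1) _)
  have := (convex_Icc (0 : ℝ) t).norm_image_sub_le_of_norm_hasDerivWithin_le
    (fun s _ => (hder s).hasDerivWithinAt) hb (left_mem_Icc.2 ht) (right_mem_Icc.2 ht)
  simpa [abs_of_nonneg ht, mul_comm] using this

theorem norm_exp_smul_sub_le {A : E →L[ℝ] E} (hA : ∀ t : ℝ, 0 ≤ t → ‖exp (t • A)‖ ≤ 1)
    {t : ℝ} (ht : 0 ≤ t) (u : E) : ‖exp (t • A) u - u‖ ≤ t * ‖A u‖ := by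
  have := norm_exp_smul_sub_exp_smul_le (Commute.zero_right A) hA
    (fun t _ => by rw [smul_zero, exp_zero]; exact ContinuousLinearMap.norm_id_le) ht u
  simpa using this

/-- A Taylor bound by `‖A (A u)‖` would be lost in the Yosida limit, where `A u` tends to a vector
that may lie outside the domain of the generator. Replacing `A u` by a nearby vector `w` of the
domain gives a bound all of whose terms converge. -/
theorem norm_exp_smul_sub_sub_le {A : E →L[ℝ] E} (hA : ∀ t : ℝ, 0 ≤ t → ‖exp (t • A)‖ ≤ 1)
    {t : ℝ} (ht : 0 ≤ t) (u w : E) :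
    ‖exp (t • A) u - u - t • A u‖ ≤ t * (2 * ‖A u - w‖ + t * ‖A w‖) := by
  have hder : ∀ s : ℝ, HasDerivAt (fun s : ℝ => exp (s • A) u - s • A u)
      (exp (s • A) (A u) - A u) s := by
    intro s
    have h1 := (hasDerivAt_exp_smul_const (𝕂 := ℝ) A s).clm_apply (hasDerivAt_const s u)
    have h2 := (hasDerivAt_id s).smul_const (A u)
    have h3 := h1.sub h2
    rw [map_zero, add_zero, one_smul] at h3
    exact h3
  have hb : ∀ s ∈ Icc (0 : ℝ) t, ‖exp (s • A) (A u) - A u‖ ≤ 2 * ‖A u - w‖ + t * ‖A w‖ := by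
    intro s hs
    have e : exp (s • A) (A u) - A u =
        exp (s • A) (A u - w) - (A u - w) + (exp (s • A) w - w) := by
      rw [map_sub]; abel
    rw [e]
    refine (norm_add_le _ _).trans (add_le_add ?_ ?_)
    · refine (norm_sub_le _ _).trans ?_
      have := norm_apply_le_of_norm_le_one (hA s hs.1) (A u - w)
      linarith
    · refine (norm_exp_smul_sub_le hA hs.1 w).trans ?_
      gcongr
      exact hs.2
  have := (convex_Icc (0 : ℝ) t).norm_image_sub_le_of_norm_hasDerivWithin_le
    (fun s _ => (hder s).hasDerivWithinAt) hb (left_mem_Icc.2 ht) (right_mem_Icc.2 ht)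
  rw [sub_zero, Real.norm_of_nonneg ht, mul_comm] at this
  refine le_trans (le_of_eq ?_) this
  congr 1
  simp
  abel

end Exponentials

/-! ### The Hille–Yosida theorem with an invariant cone -/

section HilleYosida

open NormedSpace

variable {E : Type*} [NormedAddCommGroup E] [NormedSpace ℝ E]

/-- The difference quotients of a contraction semigroup are dissipative. -/
theorem norm_le_of_tendsto_quotient {S : ℝ → E →L[ℝ] E} (hS : ∀ t : ℝ, 0 ≤ t → ‖S t‖ ≤ 1) {u v : E}
    (h : Tendsto (fun t : ℝ => t⁻¹ • (S t u - u)) (𝓝[>] 0) (𝓝 v)) (c : ℝ) :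
    c * ‖u‖ ≤ ‖c • u - v‖ := by
  have h1 : Tendsto (fun t : ℝ => ‖c • u - t⁻¹ • (S t u - u)‖) (𝓝[>] 0) (𝓝 ‖c • u - v‖) :=
    (h.const_sub _).norm
  refine ge_of_tendsto h1 ?_
  have hpos : ∀ᶠ t : ℝ in 𝓝[>] 0, 0 ≤ c + t⁻¹ := by
    have : Tendsto (fun t : ℝ => t⁻¹) (𝓝[>] 0) atTop := tendsto_inv_nhdsGT_zero
    filter_upwards [this.eventually_ge_atTop (-c)] with t ht
    linarith
  filter_upwards [self_mem_nhdsWithin, hpos] with t ht hc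
  have ht' : (0 : ℝ) < t := ht
  have e : c • u - t⁻¹ • (S t u - u) = (c + t⁻¹) • u - t⁻¹ • S t u := by
    rw [smul_sub, add_smul]; abel
  rw [e]
  have h2 := norm_sub_norm_le ((c + t⁻¹) • u) (t⁻¹ • S t u)
  rw [norm_smul, norm_smul, Real.norm_of_nonneg hc, Real.norm_of_nonneg (by positivity)] at h2
  have h3 : t⁻¹ * ‖S t u‖ ≤ t⁻¹ * ‖u‖ := by
    gcongr
    exact norm_apply_le_of_norm_le_one (hS t ht'.le) u
  linarith

/-- The resolvent of an operator `A` such that `c - A` is bounded below and onto. -/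
theorem exists_resolvent_of_dissipative {A : E →ₗ.[ℝ] E} {P : Set E} {c d : ℝ} (hd : 0 < d)
    (hdiss : ∀ u v, (u, v) ∈ A.graph → d * ‖u‖ ≤ ‖c • u - v‖)
    (hsurj : ∀ f, ∃ u, (u, c • u - f) ∈ A.graph ∧ (f ∈ P → u ∈ P)) :
    ∃ R : E →L[ℝ] E, ‖R‖ ≤ d⁻¹ ∧ (∀ u v, (u, v) ∈ A.graph ↔ u = R (c • u - v)) ∧
      ∀ f ∈ P, R f ∈ P := by
  have hinj : ∀ u u' f, (u, c • u - f) ∈ A.graph → (u', c • u' - f) ∈ A.graph → u = u' := by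
    intro u u' f hu hu'
    have h2 := hdiss _ _ (A.graph.sub_mem hu hu')
    have h3 : c • (u - u') - (c • u - f - (c • u' - f)) = 0 := by rw [smul_sub]; abel
    rw [h3, norm_zero] at h2
    have h4 : ‖u - u'‖ ≤ 0 := by
      by_contra! h
      have : 0 < d * ‖u - u'‖ := mul_pos hd h
      linarith
    exact sub_eq_zero.1 (norm_le_zero_iff.1 h4)
  choose g hg hgP using hsurj
  have hb : ∀ f, ‖g f‖ ≤ d⁻¹ * ‖f‖ := by
    intro f
    have := hdiss _ _ (hg f)
    rw [sub_sub_cancel] at this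
    rwa [inv_mul_eq_div, le_div_iff₀' hd]
  let L : E →ₗ[ℝ] E :=
    { toFun := g
      map_add' := fun f f' => hinj _ _ _ (hg _) (by
        convert A.graph.add_mem (hg f) (hg f') using 1
        rw [Prod.mk_add_mk, smul_add]
        congr 1
        abel)
      map_smul' := fun a f => hinj _ _ _ (hg _) (by
        convert A.graph.smul_mem a (hg f) using 1
        rw [Prod.smul_mk, smul_sub, RingHom.id_apply, smul_comm]) }
  refine ⟨L.mkContinuous _ hb, L.mkContinuous_norm_le (by positivity) hb, fun u v => ⟨fun h => ?_,
    fun h => ?_⟩, hgP⟩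
  · exact hinj u _ (c • u - v) (by rwa [sub_sub_cancel]) (hg _)
  · have h1 : (g (c • u - v), c • g (c • u - v) - (c • u - v)) ∈ A.graph := hg _
    have h2 : u = g (c • u - v) := h
    rw [← h2, sub_sub_cancel] at h1
    exact h1

variable [CompleteSpace E]

/-- The Hille–Yosida theorem for contraction semigroups, for an operator with graph `Gr` and
resolvent `R`; a cone that is invariant under the resolvent is invariant under the semigroup. -/
theorem exists_semigroup_of_resolvent {Gr : E → E → Prop} {R : ℝ → E →L[ℝ] E}
    (hR : ∀ c : ℝ, 0 < c → ‖R c‖ ≤ c⁻¹)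
    (hGr : ∀ c : ℝ, 0 < c → ∀ u v, Gr u v ↔ u = R c (c • u - v))
    (hd : Dense {u | ∃ v, Gr u v}) {P : Set E} (hP : IsClosedCone P)
    (hRP : ∀ c : ℝ, 0 < c → ∀ u ∈ P, R c u ∈ P) :
    ∃ S : ℝ → E →L[ℝ] E, IsSubstochastic P S ∧
      ∀ u v : E, Gr u v ↔ Tendsto (fun t : ℝ => t⁻¹ • (S t u - u)) (𝓝[>] 0) (𝓝 v) := by
  have hrange : ∀ c : ℝ, 0 < c → ∀ f, Gr (R c f) (c • R c f - f) := fun c hc f => by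
    rw [hGr c hc]; simp
  -- the resolvents commute
  have hres : ∀ c d : ℝ, 0 < c → 0 < d → ∀ f, R c f = (d - c) • R d (R c f) + R d f := by
    intro c d hc hd f
    have h1 := (hGr d hd _ _).1 (hrange c hc f)
    conv_lhs => rw [h1]
    rw [map_sub, map_sub, map_smul, map_smul, sub_smul]
    abel
  have hcomm : ∀ c d : ℝ, 0 < c → 0 < d → Commute (R c) (R d) := by
    intro c d hc hd
    rcases eq_or_ne c d with rfl | hne
    · exact Commute.refl _
    refine ContinuousLinearMap.ext fun f => ?_
    rw [mul_apply_eq_comp, mul_apply_eq_comp]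
    have h1 := hres c d hc hd f
    have h2 := hres d c hd hc f
    have h3 : (d - c) • (R d (R c f) - R c (R d f)) = 0 := by
      have h4 : (d - c) • R d (R c f) = R c f - R d f := by
        conv_rhs => rw [h1]
        abel
      have h5 : (c - d) • R c (R d f) = R d f - R c f := by
        conv_rhs => rw [h2]
        abel
      have h6 : (d - c) • R c (R d f) = -((c - d) • R c (R d f)) := by
        rw [← neg_smul, neg_sub]
      rw [smul_sub, h4, h6, h5]; abel
    rcases smul_eq_zero.1 h3 with h4 | h4
    · exact absurd (sub_eq_zero.1 h4).symm hne
    · exact (sub_eq_zero.1 h4).symm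
  -- Yosida approximations
  set lam : ℕ → ℝ := fun n => (n : ℝ) + 1 with hlam
  have hlpos : ∀ n, 0 < lam n := fun n => by positivity
  have hltop : Tendsto lam atTop atTop := tendsto_natCast_atTop_atTop.atTop_add tendsto_const_nhds
  set Y : ℕ → E →L[ℝ] E := fun n => lam n ^ 2 • R (lam n) - lam n • (1 : E →L[ℝ] E) with hY
  have hnormR : ∀ n, ‖lam n ^ 2 • R (lam n)‖ ≤ lam n := fun n => by
    rw [norm_smul, Real.norm_of_nonneg (by positivity)]
    calc lam n ^ 2 * ‖R (lam n)‖ ≤ lam n ^ 2 * (lam n)⁻¹ := by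
          gcongr
          exact hR _ (hlpos n)
      _ = lam n := by have := (hlpos n).ne'; field_simp
  have hYn : ∀ n, ∀ t : ℝ, 0 ≤ t → ‖exp (t • Y n)‖ ≤ 1 := fun n t ht =>
    norm_exp_smul_sub_le_one (hnormR n) ht
  have hYP : ∀ n, ∀ t : ℝ, 0 ≤ t → ∀ u ∈ P, exp (t • Y n) u ∈ P := fun n t ht u hu => by
    refine exp_smul_sub_mem hP (fun w hw => ?_) ht hu
    exact hP.smul_mem _ (by positivity) _ (hRP _ (hlpos n) w hw)
  have hYcomm : ∀ m n, Commute (Y m) (Y n) := fun m n => by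
    refine Commute.sub_left (Commute.sub_right ?_ ?_) (Commute.sub_right ?_ ?_)
    · exact ((hcomm _ _ (hlpos m) (hlpos n)).smul_left _).smul_right _
    · exact (Commute.one_right _).smul_right _
    · exact (Commute.one_left _).smul_left _
    · exact (Commute.one_right _).smul_right _
  -- On the domain `λ R(λ) u - u = R(λ) v`, which is `O(1 / λ)`; the contractions `λ R(λ)` then
  -- converge to the identity everywhere.
  have hJ : ∀ u, Tendsto (fun n => (lam n • R (lam n)) u) atTop (𝓝 u) := by
    refine tendsto_id_of_dense (Eventually.of_forall fun n => ?_) hd ?_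
    · rw [norm_smul, Real.norm_of_nonneg (hlpos n).le]
      calc lam n * ‖R (lam n)‖ ≤ lam n * (lam n)⁻¹ := by
            gcongr
            exact hR _ (hlpos n)
        _ = 1 := mul_inv_cancel₀ (hlpos n).ne'
    · rintro u ⟨v, huv⟩
      rw [tendsto_iff_norm_sub_tendsto_zero]
      have h1 : Tendsto (fun n => (lam n)⁻¹ * ‖v‖) atTop (𝓝 0) := by
        simpa using hltop.inv_tendsto_atTop.mul_const ‖v‖
      refine squeeze_zero (fun _ => norm_nonneg _) (fun n => ?_) h1
      have h2 : (lam n • R (lam n)) u - u = R (lam n) v := by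
        have h3 := (hGr _ (hlpos n) u v).1 huv
        rw [map_sub] at h3
        rw [_root_.smul_apply, ← map_smul, sub_eq_iff_eq_add, add_comm]
        exact (eq_sub_iff_add_eq.1 h3).symm
      rw [h2]
      exact (R (lam n)).le_of_opNorm_le (hR _ (hlpos n)) v
  -- On the domain the Yosida approximation of `u` equals `λ R(λ) v`.
  have hYlim : ∀ u v, Gr u v → Tendsto (fun n => Y n u) atTop (𝓝 v) := by
    intro u v huv
    refine (hJ v).congr fun n => ?_
    have h2 := (hGr _ (hlpos n) u v).1 huv
    have h3 : lam n • u = lam n • R (lam n) (lam n • u) - lam n • R (lam n) v := by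
      rw [← smul_sub, ← map_sub, ← h2]
    simp only [hY, _root_.sub_apply, _root_.smul_apply, one_apply_eq_self]
    rw [h3, map_smul, smul_smul, ← pow_two]
    abel
  -- the limit semigroup
  have hcauchy : ∀ t : ℝ, 0 ≤ t → ∀ u, CauchySeq fun n => exp (t • Y n) u := by
    intro t ht
    refine cauchySeq_of_dense (fun n => hYn n t ht) hd ?_
    rintro u ⟨v, huv⟩
    have h1 := ((hYlim u v huv).const_smul t).cauchySeq
    rw [Metric.cauchySeq_iff] at h1 ⊢
    intro ε hε
    obtain ⟨n₀, hn⟩ := h1 ε hε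
    refine ⟨n₀, fun m hm n hn' => lt_of_le_of_lt ?_ (hn m hm n hn')⟩
    rw [dist_eq_norm, dist_eq_norm, ← smul_sub, norm_smul, Real.norm_of_nonneg ht]
    exact norm_exp_smul_sub_exp_smul_le (hYcomm m n) (hYn m) (hYn n) ht u
  choose! S hS1 hS2 using fun (t : ℝ) (ht : 0 ≤ t) =>
    exists_strong_limit (fun n => hYn n t ht) (hcauchy t ht)
  have hSsub : IsSubstochastic P S := by
    refine ⟨⟨?_, ?_, ?_⟩, ?_, hS1⟩
    · refine ContinuousLinearMap.ext fun u => tendsto_nhds_unique (hS2 0 le_rfl u) ?_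
      simp
    · intro s t hs ht
      refine ContinuousLinearMap.ext fun u =>
        tendsto_nhds_unique (hS2 (s + t) (add_nonneg hs ht) u) ?_
      refine (tendsto_apply_of_tendsto (fun n => hYn n s hs) (hS2 s hs) (hS2 t ht u)).congr
        fun n => ?_
      let _ : NormedAlgebra ℚ (E →L[ℝ] E) := NormedAlgebra.restrictScalars ℚ ℝ _
      rw [add_smul, exp_add_of_commute (((Commute.refl (Y n)).smul_left s).smul_right t),
        mul_apply_eq_comp]
    · refine fun u => tendsto_id_of_dense ?_ hd ?_ u
      · filter_upwards [self_mem_nhdsWithin] with t ht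
        exact hS1 t (le_of_lt ht)
      · rintro u ⟨v, huv⟩
        rw [tendsto_iff_norm_sub_tendsto_zero]
        have h1 : Tendsto (fun t : ℝ => t * ‖v‖) (𝓝[>] 0) (𝓝 0) := by
          have : Tendsto (fun t : ℝ => t * ‖v‖) (𝓝 0) (𝓝 (0 * ‖v‖)) :=
            tendsto_id.mul_const _
          rw [zero_mul] at this
          exact this.mono_left nhdsWithin_le_nhds
        refine squeeze_zero' (Eventually.of_forall fun _ => norm_nonneg _) ?_ h1
        filter_upwards [self_mem_nhdsWithin] with t ht
        have ht' : (0 : ℝ) ≤ t := le_of_lt ht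
        exact le_of_tendsto_of_tendsto ((hS2 t ht' u).sub_const u).norm
          ((hYlim u v huv).norm.const_mul t)
          (Eventually.of_forall fun n => norm_exp_smul_sub_le (hYn n) ht' u)
    · intro t ht u hu
      exact hP.isClosed.mem_of_tendsto (hS2 t ht u)
        (Eventually.of_forall fun n => hYP n t ht u hu)
  have hgen : ∀ u v, Gr u v → Tendsto (fun t : ℝ => t⁻¹ • (S t u - u)) (𝓝[>] 0) (𝓝 v) := by
    intro u v huv
    rw [Metric.tendsto_nhds]
    intro ε hε
    obtain ⟨w, ⟨z, hwz⟩, hw⟩ := hd.exists_dist_lt v (show 0 < ε / 4 by positivity)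
    have h0 : ∀ᶠ t : ℝ in 𝓝[>] 0, t * ‖z‖ < ε / 2 := by
      have : Tendsto (fun t : ℝ => t * ‖z‖) (𝓝 0) (𝓝 (0 * ‖z‖)) := tendsto_id.mul_const _
      rw [zero_mul] at this
      exact (this.mono_left nhdsWithin_le_nhds).eventually_lt_const (by positivity)
    filter_upwards [self_mem_nhdsWithin, h0] with t ht h0t
    have ht' : (0 : ℝ) < t := ht
    have h1 : ‖S t u - u - t • v‖ ≤ t * (2 * ‖v - w‖ + t * ‖z‖) :=
      le_of_tendsto_of_tendsto
        (((hS2 t ht'.le u).sub_const u).sub ((hYlim u v huv).const_smul t)).norm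
        (((((hYlim u v huv).sub_const w).norm.const_mul 2).add
          ((hYlim w z hwz).norm.const_mul t)).const_mul t)
        (Eventually.of_forall fun n => norm_exp_smul_sub_sub_le (hYn n) ht'.le u w)
    have h2 : t⁻¹ • (S t u - u) - v = t⁻¹ • (S t u - u - t • v) := by
      rw [smul_sub t⁻¹ (S t u - u), smul_smul, inv_mul_cancel₀ ht'.ne', one_smul]
    rw [dist_eq_norm, h2, norm_smul, Real.norm_of_nonneg (by positivity)]
    rw [dist_eq_norm] at hw
    calc t⁻¹ * ‖S t u - u - t • v‖ ≤ t⁻¹ * (t * (2 * ‖v - w‖ + t * ‖z‖)) := by gcongr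
      _ = 2 * ‖v - w‖ + t * ‖z‖ := by field_simp
      _ < ε := by linarith
  refine ⟨S, hSsub, fun u v => ⟨hgen u v, fun h => ?_⟩⟩
  -- The generator of `S` is not larger than `Gr`: the vector `u - R(1) (u - v)` equals its own
  -- derivative under `S` at `0`, so dissipativity with `c = 1` forces it to vanish.
  have h1 := hgen _ _ (hrange 1 one_pos (u - v))
  have h2 : Tendsto (fun t : ℝ => t⁻¹ • (S t (u - R 1 (u - v)) - (u - R 1 (u - v)))) (𝓝[>] 0)
      (𝓝 (v - ((1 : ℝ) • R 1 (u - v) - (u - v)))) := by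
    refine (h.sub h1).congr fun t => ?_
    rw [← smul_sub, map_sub (S t) u]
    congr 1
    abel
  have h3 := norm_le_of_tendsto_quotient hSsub.contractive h2 1
  have h4 : (1 : ℝ) • (u - R 1 (u - v)) - (v - ((1 : ℝ) • R 1 (u - v) - (u - v))) = 0 := by
    rw [one_smul, one_smul]; abel
  rw [h4, norm_zero, one_mul] at h3
  have h5 : u = R 1 (u - v) := sub_eq_zero.1 (norm_le_zero_iff.1 h3)
  rw [hGr 1 one_pos, one_smul]
  exact h5

/-- Generation of a positive semigroup by a densely defined operator `A` such that `A - ω` is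
dissipative and `c - A` has a positive inverse for `c > ω`. -/
theorem generatesPositiveC0Semigroup_of_dissipative {A : E →ₗ.[ℝ] E} {P : Set E}
    (hP : IsClosedCone P) (ω : ℝ) (hd : Dense (A.domain : Set E))
    (hdiss : ∀ c : ℝ, ω < c → ∀ u v, (u, v) ∈ A.graph → (c - ω) * ‖u‖ ≤ ‖c • u - v‖)
    (hsurj : ∀ c : ℝ, ω < c → ∀ f, ∃ u, (u, c • u - f) ∈ A.graph ∧ (f ∈ P → u ∈ P)) :
    GeneratesPositiveC0Semigroup P A := by
  have hex : ∀ c : ℝ, 0 < c → ∃ R : E →L[ℝ] E, ‖R‖ ≤ c⁻¹ ∧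
      (∀ u v, (u, v) ∈ A.graph ↔ u = R ((c + ω) • u - v)) ∧ ∀ f ∈ P, R f ∈ P := by
    intro c hc
    have hc' : ω < c + ω := by linarith
    refine exists_resolvent_of_dissipative hc (fun u v huv => ?_) (hsurj _ hc')
    have := hdiss _ hc' u v huv
    rwa [add_sub_cancel_right] at this
  choose! R hR1 hR2 hR3 using hex
  -- The contraction theorem is applied to `A - ω`; the factor `e ^ (ω t)` then restores `A`.
  obtain ⟨S, hS, hSG⟩ := exists_semigroup_of_resolvent
    (Gr := fun u v => (u, v + ω • u) ∈ A.graph) (R := R) hR1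
    (by
      intro c hc u v
      rw [hR2 c hc, add_smul, add_sub_add_right_eq_sub])
    (hd.mono fun u hu => by
      obtain ⟨v, hv⟩ := LinearPMap.mem_domain_iff.1 hu
      exact ⟨v - ω • u, by simpa using hv⟩) hP hR3
  refine ⟨fun t => Real.exp (ω * t) • S t, ⟨?_, ?_, ?_⟩, ?_, ?_⟩
  · simpa using hS.semigroup.zero
  · intro s t hs ht
    rw [hS.semigroup.add s t hs ht, ContinuousLinearMap.smul_comp, ContinuousLinearMap.comp_smul,
      smul_smul, ← Real.exp_add, mul_add]
  · intro u
    have h1 : Tendsto (fun t : ℝ => Real.exp (ω * t)) (𝓝[>] 0) (𝓝 1) := by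
      have : Tendsto (fun t : ℝ => Real.exp (ω * t)) (𝓝 0) (𝓝 (Real.exp (ω * 0))) :=
        Continuous.tendsto (by fun_prop) 0
      rw [mul_zero, Real.exp_zero] at this
      exact this.mono_left nhdsWithin_le_nhds
    simpa using h1.smul (hS.semigroup.cont u)
  · intro t ht u hu
    exact hP.smul_mem _ (Real.exp_pos _).le _ (hS.positive t ht u hu)
  · intro u v
    have h1 : Tendsto (fun t : ℝ => Real.exp (ω * t)) (𝓝[>] 0) (𝓝 1) := by
      have : Tendsto (fun t : ℝ => Real.exp (ω * t)) (𝓝 0) (𝓝 (Real.exp (ω * 0))) :=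
        Continuous.tendsto (by fun_prop) 0
      rw [mul_zero, Real.exp_zero] at this
      exact this.mono_left nhdsWithin_le_nhds
    have h2 : Tendsto (fun t : ℝ => (t⁻¹ * (Real.exp (ω * t) - 1)) • u) (𝓝[>] 0) (𝓝 (ω • u)) := by
      refine Tendsto.smul_const ?_ u
      have hder : HasDerivAt (fun t : ℝ => Real.exp (ω * t)) ω 0 := by
        have := ((hasDerivAt_id (0 : ℝ)).const_mul ω).exp
        simpa using this
      have := hder.tendsto_slope_zero_right
      simpa using this
    have h3 : ∀ t : ℝ, t⁻¹ • ((Real.exp (ω * t) • S t) u - u) =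
        Real.exp (ω * t) • (t⁻¹ • (S t u - u)) + (t⁻¹ * (Real.exp (ω * t) - 1)) • u := by
      intro t
      rw [_root_.smul_apply]
      module
    have h4 := hSG u (v - ω • u)
    rw [sub_add_cancel] at h4
    rw [h4]
    simp only [h3]
    constructor
    · intro h
      have := (h1.smul h).add h2
      simpa using this
    · intro h
      have h5 := (h1.inv₀ one_ne_zero).smul (h.sub h2)
      rw [inv_one, one_smul] at h5
      refine h5.congr fun t => ?_
      rw [add_sub_cancel_right, smul_smul, inv_mul_cancel₀ (Real.exp_pos _).ne', one_smul]

end HilleYosida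

/-! ### Resolvent and domain of the generator of a contraction semigroup -/

section Resolvent

variable {E : Type*} [NormedAddCommGroup E] [NormedSpace ℝ E]

theorem IsC0Semigroup.norm_sub_le {S : ℝ → E →L[ℝ] E} (hS : IsC0Semigroup S)
    (hc : ∀ t : ℝ, 0 ≤ t → ‖S t‖ ≤ 1) (u : E) {s t : ℝ} (hs : 0 ≤ s) (ht : 0 ≤ t) :
    ‖S t u - S s u‖ ≤ ‖S |t - s| u - u‖ := by
  wlog hst : s ≤ t generalizing s t
  · rw [norm_sub_rev, abs_sub_comm]
    exact this ht hs (le_of_not_ge hst)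
  rw [abs_of_nonneg (sub_nonneg.2 hst)]
  have h1 : S t u = S s (S (t - s) u) := by
    have := hS.add s (t - s) hs (sub_nonneg.2 hst)
    rw [add_sub_cancel] at this
    rw [this, ContinuousLinearMap.comp_apply]
  rw [h1, ← map_sub]
  exact norm_apply_le_of_norm_le_one (hc s hs) _

theorem IsC0Semigroup.continuousOn {S : ℝ → E →L[ℝ] E} (hS : IsC0Semigroup S)
    (hc : ∀ t : ℝ, 0 ≤ t → ‖S t‖ ≤ 1) (u : E) : ContinuousOn (fun t => S t u) (Ici 0) := by
  intro s hs
  have h0 : Tendsto (fun t => ‖S t u - u‖) (𝓝[≥] 0) (𝓝 0) := by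
    rw [← Ioi_insert, nhdsWithin_insert]
    refine Tendsto.sup ?_ ?_
    · rw [tendsto_pure_left]
      intro U hU
      rw [hS.zero]
      simpa using mem_of_mem_nhds hU
    · exact tendsto_iff_norm_sub_tendsto_zero.1 (hS.cont u)
  have h1 : Tendsto (fun t : ℝ => |t - s|) (𝓝[Ici 0] s) (𝓝[≥] 0) := by
    refine tendsto_nhdsWithin_iff.2 ⟨?_, Eventually.of_forall fun t => mem_Ici.2 (abs_nonneg _)⟩
    have : Tendsto (fun t : ℝ => |t - s|) (𝓝 s) (𝓝 |s - s|) := Continuous.tendsto (by fun_prop) s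
    rw [sub_self, abs_zero] at this
    exact this.mono_left nhdsWithin_le_nhds
  rw [ContinuousWithinAt, tendsto_iff_norm_sub_tendsto_zero]
  refine squeeze_zero' (Eventually.of_forall fun _ => norm_nonneg _) ?_ (h0.comp h1)
  filter_upwards [self_mem_nhdsWithin] with t ht
  exact hS.norm_sub_le hc u hs ht

variable [CompleteSpace E]

/-- The Laplace transform of a contraction semigroup is the resolvent of its generator. -/
theorem IsSubstochastic.laplace_mem_graph {S : ℝ → E →L[ℝ] E} {P : Set E}
    (hS : IsSubstochastic P S) {A : E →ₗ.[ℝ] E} (hA : IsGenerator S A) {c : ℝ} (hc : 0 < c)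
    (f : E) :
    (∫ t in Ioi (0 : ℝ), Real.exp (-(c * t)) • S t f,
      c • (∫ t in Ioi (0 : ℝ), Real.exp (-(c * t)) • S t f) - f) ∈ A.graph := by
  have hcont := hS.semigroup.continuousOn hS.contractive f
  set g : ℝ → E := fun t => Real.exp (-(c * t)) • S t f with hg
  have hgc : ContinuousOn g (Ici 0) := (Continuous.continuousOn (by fun_prop)).smul hcont
  have hexp : IntegrableOn (fun t : ℝ => Real.exp (-(c * t))) (Ioi 0) := by
    simpa using exp_neg_integrableOn_Ioi 0 hc
  have hint : IntegrableOn g (Ioi 0) := by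
    refine Integrable.mono' (hexp.mul_const ‖f‖)
      ((hgc.mono Ioi_subset_Ici_self).aestronglyMeasurable measurableSet_Ioi) ?_
    filter_upwards [ae_restrict_mem measurableSet_Ioi] with t ht
    rw [hg, norm_smul, Real.norm_of_nonneg (Real.exp_pos _).le]
    gcongr
    exact norm_apply_le_of_norm_le_one (hS.contractive t (le_of_lt ht)) f
  set u : E := ∫ t in Ioi 0, g t with hu
  rw [hA]
  -- `S h u = e ^ (c h) (u - ∫₀ʰ g)`
  have hshift : ∀ h : ℝ, 0 < h → S h u = Real.exp (c * h) • (u - ∫ t in (0 : ℝ)..h, g t) := by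
    intro h hh
    have h1 : u - ∫ t in (0 : ℝ)..h, g t = ∫ t in Ioi h, g t := by
      rw [hu, ← intervalIntegral.integral_Ioi_sub_Ioi hint hh.le]
      abel
    have h2 : ∫ t in Ioi h, g t = ∫ t in Ioi (0 : ℝ), g (t + h) := by
      have := (measurePreserving_add_right (volume : Measure ℝ) h).setIntegral_preimage_emb
        (measurableEmbedding_addRight h) g (Ioi h)
      rw [← this]
      simp
    rw [h1, h2, hu, ← ContinuousLinearMap.integral_comp_comm (S h) hint, ← integral_smul]
    refine setIntegral_congr_fun measurableSet_Ioi fun t ht => ?_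
    have ht' : (0 : ℝ) ≤ t := le_of_lt ht
    simp only [hg]
    rw [map_smul, add_comm t h, hS.semigroup.add h t hh.le ht', ContinuousLinearMap.comp_apply,
      smul_smul, ← Real.exp_add]
    congr 2
    ring
  have hg0 : g 0 = f := by simp [hg, hS.semigroup.zero]
  have hI : Tendsto (fun h : ℝ => h⁻¹ • ∫ t in (0 : ℝ)..h, g t) (𝓝[>] 0) (𝓝 f) := by
    have hw : ContinuousWithinAt g (Ioi 0) 0 := (hgc 0 self_mem_Ici).mono Ioi_subset_Ici_self
    have h1 : HasDerivWithinAt (fun h => ∫ t in (0 : ℝ)..h, g t) (g 0) (Ici 0) 0 := by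
      refine intervalIntegral.integral_hasDerivWithinAt_right (by simp) ?_ hw
      exact ⟨Ioi 0, self_mem_nhdsWithin,
        (hgc.mono Ioi_subset_Ici_self).aestronglyMeasurable measurableSet_Ioi⟩
    have h2 := (hasDerivWithinAt_iff_tendsto_slope' (notMem_Ioi.2 le_rfl)).1
      (h1.mono Ioi_subset_Ici_self)
    rw [hg0] at h2
    refine h2.congr fun h => ?_
    simp [slope]
  have he : Tendsto (fun h : ℝ => Real.exp (c * h)) (𝓝[>] 0) (𝓝 1) := by
    have : Tendsto (fun t : ℝ => Real.exp (c * t)) (𝓝 0) (𝓝 (Real.exp (c * 0))) :=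
      Continuous.tendsto (by fun_prop) 0
    rw [mul_zero, Real.exp_zero] at this
    exact this.mono_left nhdsWithin_le_nhds
  have hd : Tendsto (fun h : ℝ => (h⁻¹ * (Real.exp (c * h) - 1)) • u) (𝓝[>] 0) (𝓝 (c • u)) := by
    refine Tendsto.smul_const ?_ u
    have hder : HasDerivAt (fun t : ℝ => Real.exp (c * t)) c 0 := by
      have := ((hasDerivAt_id (0 : ℝ)).const_mul c).exp
      simpa using this
    have := hder.tendsto_slope_zero_right
    simpa using this
  have hlim := hd.sub (he.smul hI)
  rw [one_smul] at hlim
  refine hlim.congr' ?_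
  filter_upwards [self_mem_nhdsWithin] with h hh
  rw [hshift h hh]
  module

theorem IsSubstochastic.resolvent {S : ℝ → E →L[ℝ] E} {P : Set E} (hS : IsSubstochastic P S)
    (hP : IsClosedCone P) {A : E →ₗ.[ℝ] E} (hA : IsGenerator S A) {c : ℝ} (hc : 0 < c) (f : E) :
    ∃ u, (u, c • u - f) ∈ A.graph ∧ (f ∈ P → u ∈ P) := by
  refine ⟨_, hS.laplace_mem_graph hA hc f, fun hf => hP.integral_mem ?_⟩
  filter_upwards [ae_restrict_mem measurableSet_Ioi] with t ht
  exact hP.smul_mem _ (Real.exp_pos _).le _ (hS.positive t (le_of_lt ht) f hf)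

/-- The vectors `c ∫ e ^ (-c t) S(t) f dt` lie in the domain. Rescaled to `∫ e ^ (-t) S(t / c) f
dt`, they tend to `f` as `c → ∞` by dominated convergence. -/
theorem IsSubstochastic.dense_domain {S : ℝ → E →L[ℝ] E} {P : Set E} (hS : IsSubstochastic P S)
    {A : E →ₗ.[ℝ] E} (hA : IsGenerator S A) : Dense (A.domain : Set E) := by
  intro f
  have hcont := hS.semigroup.continuousOn hS.contractive f
  set c : ℕ → ℝ := fun n => (n : ℝ) + 1 with hc
  have hcpos : ∀ n, 0 < c n := fun n => by positivity
  have hctop : Tendsto c atTop atTop := tendsto_natCast_atTop_atTop.atTop_add tendsto_const_nhds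
  have hexp : IntegrableOn (fun t : ℝ => Real.exp (-t)) (Ioi 0) := by
    simpa using exp_neg_integrableOn_Ioi 0 one_pos
  have hlim : Tendsto (fun n => ∫ t in Ioi (0 : ℝ), Real.exp (-t) • S ((c n)⁻¹ * t) f) atTop
      (𝓝 (∫ t in Ioi (0 : ℝ), Real.exp (-t) • f)) := by
    refine tendsto_integral_of_dominated_convergence (fun t => Real.exp (-t) * ‖f‖)
      (fun n => ?_) (hexp.mul_const _) (fun n => ?_) ?_
    · refine ContinuousOn.aestronglyMeasurable ?_ measurableSet_Ioi
      refine (Continuous.continuousOn (by fun_prop)).smul (hcont.comp (by fun_prop) ?_)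
      intro t ht
      have : (0 : ℝ) < t := ht
      have := hcpos n
      exact mem_Ici.2 (by positivity)
    · filter_upwards [ae_restrict_mem measurableSet_Ioi] with t ht
      rw [norm_smul, Real.norm_of_nonneg (Real.exp_pos _).le]
      gcongr
      have h1 : (0 : ℝ) < t := ht
      have h2 := hcpos n
      exact norm_apply_le_of_norm_le_one (hS.contractive _ (by positivity)) f
    · filter_upwards [ae_restrict_mem measurableSet_Ioi] with t ht
      refine Tendsto.const_smul ((hS.semigroup.cont f).comp ?_) _
      refine tendsto_nhdsWithin_iff.2 ⟨?_, Eventually.of_forall fun n => ?_⟩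
      · simpa using hctop.inv_tendsto_atTop.mul_const t
      · exact mul_pos (inv_pos.2 (hcpos n)) ht
  rw [integral_smul_const, integral_exp_neg_Ioi, neg_zero, Real.exp_zero, one_smul] at hlim
  refine mem_closure_of_tendsto hlim (Eventually.of_forall fun n => ?_)
  have h1 := LinearPMap.mem_domain_of_mem_graph (hS.laplace_mem_graph hA (hcpos n) f)
  have h2 : ∫ t in Ioi (0 : ℝ), Real.exp (-t) • S ((c n)⁻¹ * t) f =
      c n • ∫ t in Ioi (0 : ℝ), Real.exp (-(c n * t)) • S t f := by
    have := integral_comp_mul_left_Ioi (fun t => Real.exp (-t) • S ((c n)⁻¹ * t) f) 0 (hcpos n)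
    simp only [mul_zero, inv_mul_cancel_left₀ (hcpos n).ne'] at this
    rw [this, smul_smul, mul_inv_cancel₀ (hcpos n).ne', one_smul]
  rw [h2]
  exact A.domain.smul_mem _ h1

end Resolvent

/-! ### Properties common to the two function spaces, and their proof for integrable functions -/

section FunctionSpaces

/-- A map into a separable metric space is measurable if its distances to points are. -/
theorem measurable_of_measurable_dist {P X : Type*} [MeasurableSpace P] [PseudoMetricSpace X]
    [SecondCountableTopology X] [MeasurableSpace X] [BorelSpace X] {w : P → X}
    (h : ∀ g : X, Measurable fun p => dist (w p) g) : Measurable w := by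
  refine measurable_of_isOpen fun U hU => ?_
  choose! r hr0 hr using Metric.isOpen_iff.1 hU
  obtain ⟨T, hT, hTU⟩ := TopologicalSpace.isOpen_iUnion_countable
    (fun x : U => Metric.ball (x : X) (r x)) fun _ => Metric.isOpen_ball
  have hU' : U = ⋃ x ∈ T, Metric.ball (x : X) (r x) := by
    rw [hTU]
    refine Subset.antisymm (fun x hx => ?_) (iUnion_subset fun x => hr x x.2)
    exact mem_iUnion.2 ⟨⟨x, hx⟩, Metric.mem_ball_self (hr0 x hx)⟩
  rw [hU', preimage_iUnion₂]
  refine MeasurableSet.biUnion hT fun x _ => ?_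
  exact measurableSet_lt (h x) measurable_const

variable {N : ℕ} {Ω : Set (Sp N)} {X : Type*} [NormedAddCommGroup X] [NormedSpace ℝ X]

/-- The properties of the realization `ι` of a Banach function space `X` on `Ω` that are shared
by `L₁(Ω)` and `C₀(Ω)`: closed positive cone, monotone norm, a jointly measurable evaluation, a
measurable dependence on parameters of the product with multipliers satisfying `Reg`, and
pointwise evaluation of Bochner integrals. -/
structure IsFunctionSpace [MeasurableSpace X] (ι : X →ₗ[ℝ] FunOn Ω) (Reg : (Sp N → ℝ) → Prop) :
    Prop where
  reg_zero : Reg fun _ => 0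
  isClosed_cone : IsClosed (positiveCone ι)
  norm_le : ∀ (f g : X) (c : ℝ), 0 ≤ c →
    (∀ᵐ x ∂(volume.restrict Ω), |ι f x| ≤ c * |ι g x|) → ‖f‖ ≤ c * ‖g‖
  eval : ∃ ev : Sp N → X → ℝ, Measurable (fun q : Sp N × X => ev q.1 q.2) ∧
    ∀ g, ∀ᵐ x ∂(volume.restrict Ω), ev x g = ι g x
  mul : ∀ (P : Type) [MeasurableSpace P] (ν : Measure P) (φ : P → Sp N → ℝ),
    (Measurable fun q : P × Sp N => φ q.1 q.2) →
    (∀ᵐ p ∂ν, Reg (φ p) ∧ ∃ C : ℝ, ∀ᵐ x ∂(volume.restrict Ω), |φ p x| ≤ C) →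
    ∀ u : P → X, AEStronglyMeasurable u ν → ∃ w : P → X, AEStronglyMeasurable w ν ∧
      ∀ᵐ p ∂ν, ∀ᵐ x ∂(volume.restrict Ω), ι (w p) x = φ p x * ι (u p) x
  integral : ∀ (ν : Measure ℝ) [SFinite ν] (h : ℝ → X) (H : Sp N → ℝ → ℝ), Integrable h ν →
    (Measurable fun q : Sp N × ℝ => H q.1 q.2) →
    (∀ᵐ s ∂ν, ∀ᵐ x ∂(volume.restrict Ω), ι (h s) x = H x s) →
    ∀ᵐ x ∂(volume.restrict Ω), Integrable (H x) ν ∧ ι (∫ s, h s ∂ν) x = ∫ s, H x s ∂ν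

theorem ae_map_add (ι : X →ₗ[ℝ] FunOn Ω) (f g : X) :
    ∀ᵐ x ∂(volume.restrict Ω), ι (f + g) x = ι f x + ι g x := by
  rw [map_add]; exact AEEqFun.coeFn_add _ _

theorem ae_map_sub (ι : X →ₗ[ℝ] FunOn Ω) (f g : X) :
    ∀ᵐ x ∂(volume.restrict Ω), ι (f - g) x = ι f x - ι g x := by
  rw [map_sub]; exact AEEqFun.coeFn_sub _ _

theorem ae_map_smul (ι : X →ₗ[ℝ] FunOn Ω) (c : ℝ) (f : X) :
    ∀ᵐ x ∂(volume.restrict Ω), ι (c • f) x = c * ι f x := by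
  rw [map_smul]; exact AEEqFun.coeFn_smul _ _

theorem ae_map_zero (ι : X →ₗ[ℝ] FunOn Ω) : ∀ᵐ x ∂(volume.restrict Ω), ι 0 x = 0 := by
  rw [map_zero]; exact AEEqFun.coeFn_zero

theorem mem_positiveCone_iff {ι : X →ₗ[ℝ] FunOn Ω} {f : X} :
    f ∈ positiveCone ι ↔ ∀ᵐ x ∂(volume.restrict Ω), 0 ≤ ι f x := by
  rw [positiveCone, mem_ofPred_eq, ← AEEqFun.coeFn_le]
  refine ⟨fun h => ?_, fun h => ?_⟩
  · filter_upwards [h, AEEqFun.coeFn_zero (α := Sp N) (β := ℝ) (μ := volume.restrict Ω)]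
      with x h1 h2
    rwa [h2] at h1
  · filter_upwards [h, AEEqFun.coeFn_zero (α := Sp N) (β := ℝ) (μ := volume.restrict Ω)]
      with x h1 h2
    rwa [h2]

namespace IsFunctionSpace

variable [MeasurableSpace X] {ι : X →ₗ[ℝ] FunOn Ω} {Reg : (Sp N → ℝ) → Prop}

theorem eq_of_ae_eq (h : IsFunctionSpace ι Reg) {f g : X}
    (hfg : ∀ᵐ x ∂(volume.restrict Ω), ι f x = ι g x) : f = g := by
  have h1 := h.norm_le (f - g) 0 0 le_rfl (by
    filter_upwards [hfg, ae_map_sub ι f g] with x h1 h2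
    rw [h2, h1]; simp)
  rw [zero_mul] at h1
  exact sub_eq_zero.1 (norm_le_zero_iff.1 h1)

theorem injective (h : IsFunctionSpace ι Reg) : Function.Injective ι :=
  fun _ _ hfg => h.eq_of_ae_eq (Eventually.of_forall fun x => by rw [hfg])

theorem isClosedCone (h : IsFunctionSpace ι Reg) : IsClosedCone (positiveCone ι) where
  isClosed := h.isClosed_cone
  zero_mem := by
    rw [mem_positiveCone_iff]
    exact (ae_map_zero ι).mono fun x hx => hx.ge
  add_mem u hu v hv := by
    rw [mem_positiveCone_iff] at *
    filter_upwards [hu, hv, ae_map_add ι u v] with x h1 h2 h3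
    rw [h3]; positivity
  smul_mem c hc u hu := by
    rw [mem_positiveCone_iff] at *
    filter_upwards [hu, ae_map_smul ι c u] with x h1 h2
    rw [h2]; positivity

end IsFunctionSpace

/-! ### The space `L₁(Ω)` -/

instance (Ω : Set (Sp N)) : SecondCountableTopology (SpaceL1 Ω) :=
  have : Fact ((1 : ℝ≥0∞) ≠ ∞) := ⟨ENNReal.one_ne_top⟩
  Lp.SecondCountableTopology

/-- Classes of functions have no point values, and representatives chosen class by class need not be
jointly measurable. Instead `g` is approximated by the first member of a dense sequence within `2 ^
(-k)`, a measurable choice among countably many fixed representatives. The errors are summable in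
`L₁`, so these approximations converge to `g` almost everywhere. -/
theorem exists_measurable_eval_L1 (Ω : Set (Sp N)) [MeasurableSpace (SpaceL1 Ω)]
    [BorelSpace (SpaceL1 Ω)] :
    ∃ ev : Sp N → SpaceL1 Ω → ℝ, Measurable (fun q : Sp N × SpaceL1 Ω => ev q.1 q.2) ∧
      ∀ g, ∀ᵐ x ∂(volume.restrict Ω), ev x g = ofL1 Ω g x := by
  classical
  set d : ℕ → SpaceL1 Ω := TopologicalSpace.denseSeq (SpaceL1 Ω) with hd
  have hex : ∀ (k : ℕ) (g : SpaceL1 Ω), ∃ n, edist (d n) g < 2⁻¹ ^ k := by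
    intro k g
    obtain ⟨n, hn⟩ := (TopologicalSpace.denseRange_denseSeq (SpaceL1 Ω)).exists_mem_open
      (Metric.isOpen_eball (x := g) (ε := 2⁻¹ ^ k))
      ⟨g, Metric.mem_eball_self (ENNReal.pow_pos (by simp) k)⟩
    exact ⟨n, hn⟩
  set n : ℕ → SpaceL1 Ω → ℕ := fun k g => Nat.find (hex k g) with hn
  have hnm : ∀ k, Measurable (n k) := fun k =>
    measurable_find (hex k) fun m => measurableSet_lt (by fun_prop) measurable_const
  have hnd : ∀ k g, edist (d (n k g)) g < 2⁻¹ ^ k := fun k g => Nat.find_spec (hex k g)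
  set F : ℕ → Sp N × SpaceL1 Ω → ℝ := fun k q => d (n k q.2) q.1 with hF
  have hFm : ∀ k, Measurable (F k) := by
    intro k
    have h1 : Measurable fun q : Sp N × ℕ => (d q.2 : Sp N → ℝ) q.1 :=
      measurable_from_prod_countable_left fun m => (Lp.stronglyMeasurable (d m)).measurable
    exact h1.comp (measurable_fst.prodMk ((hnm k).comp measurable_snd))
  refine ⟨fun x g => limsup (fun k => F k (x, g)) atTop, Measurable.limsup hFm, fun g => ?_⟩
  have hmeas : ∀ k, AEMeasurable (fun x => ‖F k (x, g) - g x‖ₑ) (volume.restrict Ω) := fun k =>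
    (((hFm k).comp (measurable_id.prodMk measurable_const)).sub
      (Lp.stronglyMeasurable g).measurable).enorm.aemeasurable
  have hsum : ∫⁻ x in Ω, ∑' k, ‖F k (x, g) - g x‖ₑ < ∞ := by
    rw [lintegral_tsum hmeas]
    refine lt_of_le_of_lt (ENNReal.tsum_le_tsum (g := fun k => 2⁻¹ ^ k) fun k => ?_) ?_
    · refine le_trans (le_of_eq ?_) (hnd k g).le
      rw [Lp.edist_def, eLpNorm_one_eq_lintegral_enorm]
      rfl
    · rw [ENNReal.tsum_geometric]
      simp
  have hlt := ae_lt_top' (AEMeasurable.tsum hmeas) hsum.ne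
  filter_upwards [hlt] with x hx
  have h1 := ENNReal.tendsto_atTop_zero_of_tsum_ne_top hx.ne
  refine Tendsto.limsup_eq ?_
  rw [tendsto_iff_edist_tendsto_0]
  refine h1.congr fun k => ?_
  rw [edist_eq_enorm_sub]
  rfl

theorem isFunctionSpace_ofL1 (Ω : Set (Sp N)) [MeasurableSpace (SpaceL1 Ω)]
    [BorelSpace (SpaceL1 Ω)] : IsFunctionSpace (ofL1 Ω) fun _ => True where
  reg_zero := trivial
  isClosed_cone := (isClosed_Ici : IsClosed (Ici (0 : SpaceL1 Ω)))
  norm_le f g c _ h := Lp.norm_le_mul_norm_of_ae_le_mul h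
  eval := exists_measurable_eval_L1 Ω
  mul := by
    intro P _ ν φ hφ hreg u hu
    classical
    obtain ⟨ev, hev, hevι⟩ := exists_measurable_eval_L1 Ω
    set u' := hu.mk u with hu'
    have hu'm : Measurable u' := hu.stronglyMeasurable_mk.measurable
    set Φ : P → Sp N → ℝ := fun p x => φ p x * ev x (u' p) with hΦ
    have hΦm : Measurable fun q : P × Sp N => Φ q.1 q.2 :=
      hφ.mul (hev.comp (measurable_snd.prodMk (hu'm.comp measurable_fst)))
    have hΦp : ∀ p, Measurable (Φ p) := fun p => hΦm.comp measurable_prodMk_left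
    have hmem : ∀ p, MemLp (Φ p) 1 (volume.restrict Ω) ↔ ∫⁻ x in Ω, ‖Φ p x‖ₑ < ∞ := by
      intro p
      rw [MemLp, eLpNorm_one_eq_lintegral_enorm]
      exact and_iff_right (hΦp p).aestronglyMeasurable
    have hset : MeasurableSet {p | MemLp (Φ p) 1 (volume.restrict Ω)} := by
      simp only [hmem]
      exact measurableSet_lt (hΦm.enorm.lintegral_prod_right') measurable_const
    -- The default value `0` is taken on the measurable set of those `p` for which the product is
    -- not integrable; this set is null because almost every multiplier is essentially bounded.
    set w : P → SpaceL1 Ω := fun p =>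
      if h : MemLp (Φ p) 1 (volume.restrict Ω) then h.toLp (Φ p) else 0 with hw
    have hwm : Measurable w := by
      refine measurable_of_measurable_dist fun g => ?_
      have hgm : Measurable (g : Sp N → ℝ) := (Lp.stronglyMeasurable g).measurable
      have h1 : Measurable fun p => if p ∈ {p | MemLp (Φ p) 1 (volume.restrict Ω)} then
          (∫⁻ x in Ω, ‖Φ p x - g x‖ₑ).toReal else dist 0 g := by
        refine Measurable.ite hset (Measurable.ennreal_toReal ?_) measurable_const
        exact Measurable.lintegral_prod_right'
          (f := fun q : P × Sp N => ‖Φ q.1 q.2 - g q.2‖ₑ)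
          ((hΦm.sub (hgm.comp measurable_snd)).enorm)
      convert h1 using 2 with p
      by_cases hp : MemLp (Φ p) 1 (volume.restrict Ω)
      · simp only [hw, hp, dif_pos, mem_ofPred_eq, if_true]
        rw [dist_edist, Lp.edist_def, eLpNorm_one_eq_lintegral_enorm]
        congr 1
        refine lintegral_congr_ae ?_
        filter_upwards [hp.coeFn_toLp] with x hx
        simp [hx]
      · simp [hw, hp]
    refine ⟨w, hwm.stronglyMeasurable.aestronglyMeasurable, ?_⟩
    filter_upwards [hreg, hu.ae_eq_mk] with p ⟨_, C, hC⟩ hup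
    have hp : MemLp (Φ p) 1 (volume.restrict Ω) := by
      refine (Lp.memLp (u' p)).of_le_mul (c := C) (hΦp p).aestronglyMeasurable ?_
      filter_upwards [hC, hevι (u' p)] with x h1 h2
      simp only [hΦ]
      rw [norm_mul, h2]
      exact mul_le_mul_of_nonneg_right h1 (norm_nonneg _)
    have hwp : w p = hp.toLp (Φ p) := by simp [hw, hp]
    rw [hwp, hup]
    filter_upwards [hp.coeFn_toLp, hevι (u' p)] with x h1 h2
    refine Eq.trans h1 ?_
    simp only [hΦ]
    rw [h2]
  integral := by
    intro ν _ h H hh hH hhH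
    -- By Tonelli, the integral of `|H|` over the product is the integral of `‖h s‖`.
    have hint : Integrable (fun q : Sp N × ℝ => H q.1 q.2)
        ((volume.restrict Ω).prod ν) := by
      rw [integrable_prod_iff' hH.aestronglyMeasurable]
      constructor
      · filter_upwards [hhH] with s hs
        exact (L1.integrable_coeFn (h s)).congr hs
      · refine hh.norm.congr ?_
        filter_upwards [hhH] with s hs
        rw [L1.norm_eq_integral_norm]
        refine integral_congr_ae ?_
        filter_upwards [hs] with x hx
        rw [← hx]
        rfl
    -- Both functions are integrable, and they have the same integral over every measurable set:
    -- integration over a set is a continuous functional on `L₁(Ω)`, hence passes under the Bochner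
    -- integral, and Fubini treats the other side.
    have heq : (fun x => ofL1 Ω (∫ s, h s ∂ν) x) =ᵐ[volume.restrict Ω]
        fun x => ∫ s, H x s ∂ν := by
      refine Integrable.ae_eq_of_forall_setIntegral_eq _ _ (L1.integrable_coeFn _)
        hint.integral_prod_left fun s _ _ => ?_
      let L : SpaceL1 Ω →L[ℝ] ℝ :=
        { toFun := fun f => ∫ x in s, f x ∂(volume.restrict Ω)
          map_add' := fun f g => by
            rw [← integral_add (L1.integrable_coeFn f).restrict (L1.integrable_coeFn g).restrict]
            exact integral_congr_ae (ae_restrict_of_ae (Lp.coeFn_add f g))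
          map_smul' := fun c f => by
            rw [RingHom.id_apply, ← integral_smul]
            exact integral_congr_ae (ae_restrict_of_ae (Lp.coeFn_smul c f))
          cont := continuous_setIntegral s }
      have h1 : L (∫ s, h s ∂ν) = ∫ s, L (h s) ∂ν := (L.integral_comp_comm hh).symm
      refine Eq.trans h1 ?_
      rw [integral_integral_swap (hint.mono_measure
        (Measure.prod_mono Measure.restrict_le_self le_rfl))]
      refine integral_congr_ae ?_
      filter_upwards [hhH] with t ht
      exact integral_congr_ae (ae_restrict_of_ae ht)
    filter_upwards [hint.prod_right_ae, heq] with x h1 h2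
    exact ⟨h1, h2⟩

end FunctionSpaces

/-! ### The space of continuous functions vanishing at infinity -/

section ContinuousFunctions

theorem norm_C0_le_iff {Y : Type*} [TopologicalSpace Y] {f : C₀(Y, ℝ)} {C : ℝ} (hC : 0 ≤ C) :
    ‖f‖ ≤ C ↔ ∀ y, |f y| ≤ C := by
  rw [← ZeroAtInftyContinuousMap.norm_toBCF_eq_norm, BoundedContinuousFunction.norm_le hC]
  rfl

theorem abs_C0_apply_le {Y : Type*} [TopologicalSpace Y] (f : C₀(Y, ℝ)) (y : Y) : |f y| ≤ ‖f‖ :=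
  (norm_C0_le_iff (norm_nonneg f)).1 le_rfl y

/-- Evaluation at a point as a continuous functional on `C₀`. -/
noncomputable def evalC0 {Y : Type*} [TopologicalSpace Y] (y : Y) : C₀(Y, ℝ) →L[ℝ] ℝ :=
  LinearMap.mkContinuous
    { toFun := fun f => f y
      map_add' := fun _ _ => rfl
      map_smul' := fun _ _ => rfl } 1 fun f => by
    rw [one_mul]; exact abs_C0_apply_le f y

theorem evalC0_apply {Y : Type*} [TopologicalSpace Y] (y : Y) (f : C₀(Y, ℝ)) :
    evalC0 y f = f y := rfl

theorem continuous_eval_C0 {Y : Type*} [TopologicalSpace Y] :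
    Continuous fun q : Y × C₀(Y, ℝ) => q.2 q.1 := by
  have h1 : Continuous fun f : C₀(Y, ℝ) => f.toBCF :=
    (ZeroAtInftyContinuousMap.isometry_toBCF (α := Y) (β := ℝ)).continuous
  exact (continuous_eval (F := BoundedContinuousFunction Y ℝ)).comp
    ((h1.comp continuous_snd).prodMk continuous_fst)

/-- Soft thresholding. -/
theorem exists_C0_truncation {Y : Type*} [TopologicalSpace Y] (f : C₀(Y, ℝ)) {ε : ℝ}
    (hε : 0 < ε) : ∃ (g : C₀(Y, ℝ)) (K : Set Y), IsCompact K ∧ (∀ y ∉ K, g y = 0) ∧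
      dist f g ≤ ε := by
  have h0 := Metric.tendsto_nhds.1 (zero_at_infty f) ε hε
  obtain ⟨K, hK, hKf⟩ := mem_cocompact.1 h0
  have hz : ∀ y ∉ K, f y - max (-ε) (min ε (f y)) = 0 := by
    intro y hy
    have h1 : dist (f y) 0 < ε := hKf hy
    rw [Real.dist_0_eq_abs, abs_lt] at h1
    rw [min_eq_right h1.2.le, max_eq_right h1.1.le, sub_self]
  refine ⟨⟨⟨fun y => f y - max (-ε) (min ε (f y)), by fun_prop⟩, ?_⟩, K, hK, hz, ?_⟩
  · refine tendsto_const_nhds.congr' ?_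
    filter_upwards [hK.compl_mem_cocompact] with y hy
    exact (hz y hy).symm
  · rw [dist_eq_norm, norm_C0_le_iff hε.le]
    intro y
    have : ∀ a : ℝ, |a - (a - max (-ε) (min ε a))| ≤ ε := by
      intro a
      rw [sub_sub_cancel, abs_le]
      exact ⟨le_max_left _ _, max_le (by linarith) (min_le_left _ _)⟩
    exact this (f y)

/-- Functions vanishing off a fixed compact set `K` embed isometrically into the separable space
`C(K)`. By soft thresholding, the union over a compact exhaustion is dense. -/
theorem secondCountableTopology_C0 (Y : Type*) [MetricSpace Y] [ProperSpace Y] :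
    SecondCountableTopology C₀(Y, ℝ) := by
  classical
  set K : CompactExhaustion Y := default
  set Z : ℕ → Set C₀(Y, ℝ) := fun n => {f | ∀ y ∉ K n, f y = 0} with hZ
  have hsep : ∀ n, TopologicalSpace.IsSeparable (Z n) := by
    intro n
    have : CompactSpace (K n) := isCompact_iff_compactSpace.1 (K.isCompact n)
    let ρ : Z n → C(K n, ℝ) := fun f =>
      ⟨fun y => (f : C₀(Y, ℝ)) y, (f : C₀(Y, ℝ)).continuous.comp continuous_subtype_val⟩
    have hρ : Isometry ρ := by
      refine Isometry.of_dist_eq fun f g => le_antisymm ?_ ?_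
      · rw [ContinuousMap.dist_le dist_nonneg]
        intro y
        rw [Real.dist_eq, Subtype.dist_eq, dist_eq_norm]
        exact abs_C0_apply_le ((f : C₀(Y, ℝ)) - (g : C₀(Y, ℝ))) y
      · rw [Subtype.dist_eq, dist_eq_norm, norm_C0_le_iff dist_nonneg]
        intro y
        by_cases hy : y ∈ K n
        · exact ContinuousMap.dist_apply_le_dist (f := ρ f) (g := ρ g) ⟨y, hy⟩
        · have h1 := f.2 y hy
          have h2 := g.2 y hy
          have : ((f : C₀(Y, ℝ)) - (g : C₀(Y, ℝ))) y = (f : C₀(Y, ℝ)) y - (g : C₀(Y, ℝ)) y := rfl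
          rw [this, h1, h2]
          simp
    have := hρ.isEmbedding.isInducing.secondCountableTopology
    exact TopologicalSpace.IsSeparable.of_subtype _
  have hall : TopologicalSpace.IsSeparable (univ : Set C₀(Y, ℝ)) := by
    refine (TopologicalSpace.IsSeparable.iUnion hsep).closure.mono fun f _ => ?_
    rw [Metric.mem_closure_iff]
    intro ε hε
    obtain ⟨g, L, hL, hg, hd⟩ := exists_C0_truncation f (half_pos hε)
    obtain ⟨n, hn⟩ := K.exists_superset_of_isCompact hL
    exact ⟨g, mem_iUnion.2 ⟨n, fun y hy => hg y fun h => hy (hn h)⟩,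
      hd.trans_lt (half_lt_self hε)⟩
  have : TopologicalSpace.SeparableSpace C₀(Y, ℝ) := TopologicalSpace.isSeparable_univ_iff.1 hall
  exact UniformSpace.secondCountable_of_separable _

variable {N : ℕ} {Ω : Set (Sp N)}

instance (Ω : Set (Sp N)) : SecondCountableTopology (SpaceC0 Ω) :=
  have : ProperSpace (closure Ω) := ProperSpace.of_isClosed isClosed_closure
  secondCountableTopology_C0 _

/-- An inequality on `closure Ω` between continuous functions that holds almost everywhere on the
open set `Ω` holds everywhere. -/
theorem nonneg_of_ae_nonneg (hΩ : IsOpen Ω) {F : closure Ω → ℝ} (hF : Continuous F)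
    (h : ∀ᵐ x ∂(volume.restrict Ω : Measure (Sp N)), ∀ hx : x ∈ closure Ω, 0 ≤ F ⟨x, hx⟩)
    (y : closure Ω) : 0 ≤ F y := by
  set e : Ω → closure Ω := Set.inclusion subset_closure
  have he : Continuous e := continuous_inclusion subset_closure
  have hden : DenseRange e := by
    rw [denseRange_inclusion_iff]
  have hopen : IsOpen (Subtype.val '' {x : Ω | F (e x) < 0}) :=
    hΩ.isOpenMap_subtype_val _ (isOpen_lt (hF.comp he) continuous_const)
  have hnull : volume (Subtype.val '' {x : Ω | F (e x) < 0}) = 0 := by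
    rw [ae_restrict_iff' hΩ.measurableSet] at h
    refine measure_mono_null ?_ (ae_iff.1 h)
    rintro _ ⟨x, hx, rfl⟩ hall
    exact not_le.2 hx (hall x.2 (subset_closure x.2))
  have hempty := hopen.measure_eq_zero_iff volume |>.1 hnull
  have hclosed : IsClosed {y | 0 ≤ F y} := isClosed_le continuous_const hF
  have hall : ∀ x, e x ∈ {y | 0 ≤ F y} := by
    intro x
    by_contra hne
    have : (x : Sp N) ∈ Subtype.val '' {x : Ω | F (e x) < 0} := ⟨x, mem_ofPred.2 (not_le.1 hne), rfl⟩
    rw [hempty] at this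
    exact this
  exact hden.induction_on y hclosed hall

theorem mem_positiveCone_ofC0_iff (hΩ : IsOpen Ω) {f : SpaceC0 Ω} :
    f ∈ positiveCone (ofC0 Ω) ↔ ∀ y, 0 ≤ f y := by
  rw [mem_positiveCone_iff]
  refine ⟨fun h => nonneg_of_ae_nonneg hΩ f.continuous ?_, fun h => ?_⟩
  · filter_upwards [h, ofC0_coe f] with x h1 h2 hx
    rwa [← h2 hx]
  · filter_upwards [ofC0_coe f, ae_restrict_mem hΩ.measurableSet] with x h1 hx
    rw [h1 (subset_closure hx)]
    exact h _

theorem measurable_eval_C0 (Ω : Set (Sp N)) [MeasurableSpace (SpaceC0 Ω)]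
    [BorelSpace (SpaceC0 Ω)] :
    Measurable fun q : Sp N × SpaceC0 Ω =>
      Function.extend (Subtype.val : closure Ω → Sp N) q.2 0 q.1 := by
  have hemb : MeasurableEmbedding
      (Prod.map (Subtype.val : closure Ω → Sp N) (id : SpaceC0 Ω → SpaceC0 Ω)) :=
    (MeasurableEmbedding.subtype_coe isClosed_closure.measurableSet).prodMap MeasurableEmbedding.id
  have h1 := hemb.measurable_extend (g := fun q : closure Ω × SpaceC0 Ω => q.2 q.1)
    (g' := fun _ => 0) continuous_eval_C0.measurable measurable_const
  convert h1 using 1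
  funext q
  by_cases hx : q.1 ∈ closure Ω
  · have e1 := Subtype.val_injective.extend_apply (⇑q.2) 0 (⟨q.1, hx⟩ : closure Ω)
    have e2 := hemb.injective.extend_apply (fun q : closure Ω × SpaceC0 Ω => q.2 q.1)
      (fun _ => 0) (⟨q.1, hx⟩, q.2)
    exact e1.trans e2.symm
  · rw [Function.extend_apply' _ _ _ (by rintro ⟨y, hy⟩; exact hx (hy ▸ y.2)),
      Function.extend_apply' _ _ _ (by rintro ⟨y, hy⟩; exact hx (hy ▸ y.1.2))]
    rfl

theorem exists_C0_mul {φ : Sp N → ℝ} (hφ : ContinuousOn φ (closure Ω)) {C : ℝ}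
    (hC : ∀ y ∈ closure Ω, |φ y| ≤ C) (g : SpaceC0 Ω) :
    ∃ w : SpaceC0 Ω, ∀ y : closure Ω, w y = φ y * g y := by
  refine ⟨⟨⟨fun y => φ y * g y, (continuousOn_iff_continuous_domRestrict.1 hφ).mul g.continuous⟩,
    ?_⟩, fun y => rfl⟩
  have h1 : Tendsto (fun y => C * |g y|) (cocompact (closure Ω)) (𝓝 0) := by
    simpa using (zero_at_infty g).abs.const_mul C
  refine squeeze_zero_norm (fun y => ?_) h1
  rw [norm_mul]
  exact mul_le_mul_of_nonneg_right (hC y y.2) (abs_nonneg _)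

theorem abs_le_of_ae_abs_le (hΩ : IsOpen Ω) {φ : Sp N → ℝ} (hφ : ContinuousOn φ (closure Ω))
    {C : ℝ} (hC : ∀ᵐ x ∂(volume.restrict Ω : Measure (Sp N)), |φ x| ≤ C) :
    ∀ y ∈ closure Ω, |φ y| ≤ C := by
  intro y hy
  have := nonneg_of_ae_nonneg hΩ (F := fun y => C - |φ y|)
    (continuous_const.sub (continuousOn_iff_continuous_domRestrict.1 hφ).abs)
    (hC.mono fun x hx _ => sub_nonneg.2 hx) ⟨y, hy⟩
  exact sub_nonneg.1 this

/-- Inequalities known almost everywhere on `Ω` extend by continuity to all of `closure Ω`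
(`nonneg_of_ae_nonneg`), and evaluation at a point is a continuous functional. Multipliers must be
continuous on the closure for the product to stay in the space. -/
theorem isFunctionSpace_ofC0 (hΩ : IsOpen Ω) [MeasurableSpace (SpaceC0 Ω)]
    [BorelSpace (SpaceC0 Ω)] :
    IsFunctionSpace (ofC0 Ω) fun φ => ContinuousOn φ (closure Ω) where
  reg_zero := continuousOn_const
  isClosed_cone := by
    have : positiveCone (ofC0 Ω) = ⋂ y, {f : SpaceC0 Ω | 0 ≤ evalC0 y f} := by
      ext f
      rw [mem_positiveCone_ofC0_iff hΩ, mem_iInter]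
      rfl
    rw [this]
    exact isClosed_iInter fun y => isClosed_le continuous_const (evalC0 y).continuous
  norm_le f g c hc h := by
    rw [norm_C0_le_iff (by positivity)]
    intro y
    have h1 := nonneg_of_ae_nonneg hΩ (F := fun y => c * |g y| - |f y|)
      ((continuous_const.mul g.continuous.abs).sub f.continuous.abs) (by
        filter_upwards [h, ofC0_coe f, ofC0_coe g] with x h1 h2 h3 hx
        rw [← h2 hx, ← h3 hx]
        linarith) y
    have h2 := abs_C0_apply_le g y
    have h3 : c * |g y| ≤ c * ‖g‖ := by gcongr
    linarith
  eval := ⟨_, measurable_eval_C0 Ω, fun g => (AEEqFun.coeFn_mk _ (aesm_extend Ω g)).symm⟩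
  mul := by
    intro P _ ν φ hφ hreg u hu
    classical
    -- The parameters with bad multipliers are enclosed in a measurable null set, on which the
    -- product is set to `0`.
    obtain ⟨t, ht, htm, ht0⟩ := exists_measurable_superset_of_null (ae_iff.1 hreg)
    have hgood : ∀ p ∉ t, ContinuousOn (φ p) (closure Ω) ∧
        ∃ C : ℝ, ∀ᵐ x ∂(volume.restrict Ω : Measure (Sp N)), |φ p x| ≤ C := by
      intro p hp
      by_contra hcon
      exact hp (ht hcon)
    set u' := hu.mk u with hu'
    have hu'm : Measurable u' := hu.stronglyMeasurable_mk.measurable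
    have hex : ∀ p, p ∉ t → ∃ w : SpaceC0 Ω, ∀ y : closure Ω, w y = φ p y * u' p y := by
      intro p hp
      obtain ⟨h1, C, hC⟩ := hgood p hp
      exact exists_C0_mul h1 (abs_le_of_ae_abs_le hΩ h1 hC) (u' p)
    choose! w₀ hw₀ using hex
    set w : P → SpaceC0 Ω := fun p => if p ∈ t then 0 else w₀ p with hw
    have hwy : ∀ y : closure Ω, Measurable fun p => w p y := by
      intro y
      have h1 : Measurable fun p => if p ∈ t then 0 else φ p y * u' p y := by
        refine Measurable.ite htm measurable_const ?_
        exact (hφ.comp (measurable_id.prodMk measurable_const)).mul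
          ((evalC0 y).continuous.measurable.comp hu'm)
      convert h1 using 2 with p
      by_cases hp : p ∈ t
      · simp [hw, hp]
      · simp [hw, hp, hw₀ p hp y]
    -- The sup distance is determined by a countable dense set of points, so measurability of all
    -- point values suffices.
    have hwm : Measurable w := by
      refine measurable_of_measurable_dist fun g => ?_
      obtain ⟨D, hD, hDd⟩ := TopologicalSpace.exists_countable_dense (closure Ω)
      refine measurable_of_Iic fun r => ?_
      have h1 : (fun p => dist (w p) g) ⁻¹' Iic r =
          {_p | 0 ≤ r} ∩ ⋂ y ∈ D, {p | |w p y - g y| ≤ r} := by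
        ext p
        simp only [mem_preimage, mem_Iic, mem_inter_iff, mem_ofPred_eq, mem_iInter]
        constructor
        · intro h
          have hr : 0 ≤ r := dist_nonneg.trans h
          rw [dist_eq_norm, norm_C0_le_iff hr] at h
          exact ⟨hr, fun y _ => h y⟩
        · rintro ⟨hr, h⟩
          rw [dist_eq_norm, norm_C0_le_iff hr]
          have hcl : IsClosed {y : closure Ω | |w p y - g y| ≤ r} :=
            isClosed_le ((w p).continuous.sub g.continuous).abs continuous_const
          exact fun y => (hcl.closure_subset_iff.2 h) (hDd y)
      rw [h1]
      refine MeasurableSet.inter (MeasurableSet.const _) (MeasurableSet.biInter hD fun y _ => ?_)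
      exact measurableSet_le ((hwy y).sub_const _).abs measurable_const
    refine ⟨w, hwm.stronglyMeasurable.aestronglyMeasurable, ?_⟩
    have hnt : ∀ᵐ p ∂ν, p ∉ t := measure_eq_zero_iff_ae_notMem.1 ht0
    filter_upwards [hnt, hu.ae_eq_mk] with p hp hup
    rw [hup]
    filter_upwards [ofC0_coe (w p), ofC0_coe (u' p), ae_restrict_mem hΩ.measurableSet]
      with x h1 h2 hx
    have hx' : x ∈ closure Ω := subset_closure hx
    rw [h1 hx', h2 hx']
    simp only [hw, hp, if_false]
    exact hw₀ p hp ⟨x, hx'⟩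
  integral := by
    intro ν _ h H hh hH hhH
    set h' := hh.1.mk h with hh'
    have hm : MeasurableSet {q : Sp N × ℝ |
        Function.extend (Subtype.val : closure Ω → Sp N) (h' q.2) 0 q.1 = H q.1 q.2} := by
      refine measurableSet_eq_fun ?_ hH
      exact (measurable_eval_C0 Ω).comp (measurable_fst.prodMk
        (hh.1.stronglyMeasurable_mk.measurable.comp measurable_snd))
    -- The hypothesis holds for a.e. `s` and then a.e. `x`, but evaluation at a fixed `x` needs the
    -- reverse order. Exchanging them requires the measurable version `h'` of `h`.
    have hsw := (Measure.ae_ae_comm (μ := (volume.restrict Ω : Measure (Sp N))) (ν := ν)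
      (p := fun x s => Function.extend (Subtype.val : closure Ω → Sp N) (h' s) 0 x = H x s) hm).2
      (by
        filter_upwards [hhH, hh.1.ae_eq_mk] with s h1 h2
        rw [h2] at h1
        filter_upwards [h1, AEEqFun.coeFn_mk _ (aesm_extend Ω (h' s))] with x h3 h4
        exact h4.symm.trans h3)
    filter_upwards [hsw, ofC0_coe (∫ s, h s ∂ν), ae_restrict_mem hΩ.measurableSet] with x h1 h2 hx
    have hx' : x ∈ closure Ω := subset_closure hx
    have h3 : ∀ᵐ s ∂ν, evalC0 (⟨x, hx'⟩ : closure Ω) (h s) = H x s := by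
      filter_upwards [h1, hh.1.ae_eq_mk] with s h4 h5
      rw [h5, ← h4]
      exact (Subtype.val_injective.extend_apply (⇑(h' s)) 0 (⟨x, hx'⟩ : closure Ω)).symm
    refine ⟨((evalC0 (⟨x, hx'⟩ : closure Ω)).integrable_comp hh).congr h3, ?_⟩
    rw [h2 hx', ← evalC0_apply, ← ContinuousLinearMap.integral_comp_comm _ hh]
    exact integral_congr_ae h3

end ContinuousFunctions

/-! ### Moments of the dominating kernel -/

section Coefficients

theorem lintegral_Icc_zero_eq_mul {s : ℝ} (hs : 0 < s) {g : ℝ → ℝ≥0∞} (hg : Measurable g) :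
    ∫⁻ m in Icc 0 s, g m = ENNReal.ofReal s * ∫⁻ z in Icc (0 : ℝ) 1, g (z * s) := by
  have h1 := Real.smul_map_volume_mul_right hs.ne'
  have h2 : MeasurableSet (Icc (0 : ℝ) s) := measurableSet_Icc
  have hpre : (fun z : ℝ => z * s) ⁻¹' Icc 0 s = Icc 0 1 := by
    rw [preimage_mul_const_Icc₀ _ _ hs, zero_div, div_self hs.ne']
  conv_lhs => rw [← h1]
  rw [Measure.restrict_smul, lintegral_smul_measure, setLIntegral_map h2 hg (by fun_prop), hpre,
    abs_of_pos hs, smul_eq_mul]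

/-- On `[0, q]` the weight is at most `q ^ p`, which is small for `q < 1` and large `p`; on `(q, 1]`
it is at most `1`, and there the mass of `F` itself is small. -/
theorem lintegral_rpow_mul_le {F : ℝ → ℝ} (hF : Measurable F)
    {p q C ε : ℝ} (hp : 0 ≤ p) (hq0 : 0 ≤ q) (hq : q ≤ 1)
    (hC : ∫⁻ z in Icc (0 : ℝ) 1, ‖F z‖ₑ ≤ ENNReal.ofReal C)
    (hε : ∫⁻ z in Ioc q 1, ‖F z‖ₑ ≤ ENNReal.ofReal ε) (hC0 : 0 ≤ C) (hε0 : 0 ≤ ε) :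
    ∫⁻ z in Icc (0 : ℝ) 1, ENNReal.ofReal (z ^ p) * ENNReal.ofReal (F z) ≤
      ENNReal.ofReal (q ^ p * C + ε) := by
  have hsplit : Icc (0 : ℝ) 1 = Icc 0 q ∪ Ioc q 1 := (Icc_union_Ioc_eq_Icc hq0 hq).symm
  have hdisj : Disjoint (Icc (0 : ℝ) q) (Ioc q 1) :=
    Set.disjoint_left.2 fun z hz hz' => absurd hz.2 (not_le.2 hz'.1)
  have hFe : ∀ z : ℝ, ENNReal.ofReal (F z) ≤ ‖F z‖ₑ := fun z => by
    rw [← ofReal_norm]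
    exact ENNReal.ofReal_le_ofReal (le_abs_self _)
  have hqp : 0 ≤ q ^ p := Real.rpow_nonneg hq0 p
  conv_lhs => rw [hsplit]
  rw [lintegral_union measurableSet_Ioc hdisj, ENNReal.ofReal_add (by positivity) hε0]
  refine add_le_add ?_ ?_
  · calc ∫⁻ z in Icc 0 q, ENNReal.ofReal (z ^ p) * ENNReal.ofReal (F z)
        ≤ ∫⁻ z in Icc 0 q, ENNReal.ofReal (q ^ p) * ‖F z‖ₑ := by
          refine setLIntegral_mono' measurableSet_Icc fun z hz => ?_
          gcongr
          · exact hz.1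
          · exact hz.2
          · exact hFe z
      _ ≤ ENNReal.ofReal (q ^ p) * ENNReal.ofReal C := by
          rw [lintegral_const_mul _ hF.enorm]
          gcongr
          refine (lintegral_mono_set ?_).trans hC
          exact Icc_subset_Icc_right hq
      _ = ENNReal.ofReal (q ^ p * C) := (ENNReal.ofReal_mul hqp).symm
  · refine le_trans (setLIntegral_mono' measurableSet_Ioc fun z hz => ?_) hε
    have hz0 : 0 ≤ z := hq0.trans hz.1.le
    calc ENNReal.ofReal (z ^ p) * ENNReal.ofReal (F z) ≤ 1 * ‖F z‖ₑ := by
          gcongr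
          · rw [ENNReal.ofReal_le_one]
            exact Real.rpow_le_one hz0 hz.2 hp
          · exact hFe z
      _ = ‖F z‖ₑ := one_mul _

/-- The moments of order `r` of the kernel are small compared with `s ^ r` if `r` is large. -/
theorem exists_moment_le {β : ℝ → ℝ → ℝ} (hβmeas : Measurable fun p : ℝ × ℝ => β p.1 p.2)
    (hβnonneg : ∀ m s, 0 ≤ β m s) {r₀ s₀ : ℝ} (hr₀ : 0 ≤ r₀)
    (hequi : EquiIntegrableKernel β r₀ s₀) {ε : ℝ} (hε : 0 < ε) :
    ∃ r₁, r₀ < r₁ ∧ ∀ r, r₁ ≤ r → ∀ s, s₀ ≤ s → 0 < s →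
      ∫⁻ m in Icc 0 s, ENNReal.ofReal (β m s) * ENNReal.ofReal (m ^ r) ≤
        ENNReal.ofReal (ε * s ^ r) := by
  obtain ⟨-, hui, C, hC⟩ := hequi
  obtain ⟨δ, hδ, hδε⟩ := hui (half_pos hε)
  -- The interval `(q, 1]` has length at most the `δ` of equi-integrability; the cap `1 / 2` keeps
  -- `q` positive.
  set q : ℝ := 1 - min δ (1 / 2) with hq
  have hδ1 : 0 < min δ (1 / 2) := lt_min hδ (by norm_num)
  have hδ2 : min δ (1 / 2) ≤ 1 / 2 := min_le_right _ _
  have hq0 : 0 < q := by linarith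
  have hq1 : q < 1 := by linarith
  have hlim : Tendsto (fun p : ℝ => q ^ p * C) atTop (𝓝 0) := by
    simpa using (tendsto_rpow_atTop_of_base_lt_one q (by linarith) hq1).mul_const (C : ℝ)
  obtain ⟨p₁, hp₁⟩ := eventually_atTop.1 (hlim.eventually_le_const (half_pos hε))
  -- Beyond `p₁` the part on `[0, q]` is at most `ε / 2`; the `1` makes the threshold exceed `r₀`
  -- strictly.
  refine ⟨r₀ + max p₁ 1, by linarith [le_max_right p₁ 1], fun r hr s hs hs0 => ?_⟩
  have hp1 : p₁ ≤ r - r₀ := by linarith [le_max_left p₁ 1]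
  have hp0 : 1 ≤ r - r₀ := by linarith [le_max_right p₁ 1]
  set F : ℝ → ℝ := fun z => s * z ^ r₀ * β (z * s) s with hF
  have hFm : Measurable F := by
    have : Measurable fun z : ℝ => β (z * s) s :=
      hβmeas.comp ((measurable_id.mul_const s).prodMk measurable_const)
    exact (measurable_const.mul (measurable_id.pow_const r₀)).mul this
  have hCs : ∫⁻ z in Icc (0 : ℝ) 1, ‖F z‖ₑ ≤ ENNReal.ofReal C := by
    have := hC ⟨s, hs⟩
    rw [eLpNorm_one_eq_lintegral_enorm] at this
    rwa [ENNReal.ofReal_coe_nnreal]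
  have hsub : Ioc q 1 ⊆ Icc (0 : ℝ) 1 := fun z hz => ⟨hq0.le.trans hz.1.le, hz.2⟩
  have hεs : ∫⁻ z in Ioc q 1, ‖F z‖ₑ ≤ ENNReal.ofReal (ε / 2) := by
    have h1 := hδε ⟨s, hs⟩ (Ioc q 1) measurableSet_Ioc (by
      rw [Measure.restrict_apply measurableSet_Ioc]
      refine (measure_mono inter_subset_left).trans ?_
      rw [Real.volume_Ioc]
      exact ENNReal.ofReal_le_ofReal (by linarith [min_le_left δ (1 / 2)]))
    rw [eLpNorm_indicator_eq_eLpNorm_restrict measurableSet_Ioc, eLpNorm_one_eq_lintegral_enorm,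
      Measure.restrict_restrict measurableSet_Ioc, inter_eq_left.2 hsub] at h1
    exact h1
  have hmain := lintegral_rpow_mul_le hFm (p := r - r₀) (by linarith) hq0.le hq1.le hCs hεs
    C.2 (by linarith)
  have hmeas : Measurable fun m => ENNReal.ofReal (β m s) * ENNReal.ofReal (m ^ r) := by
    refine Measurable.mul (Measurable.ennreal_ofReal ?_) (Measurable.ennreal_ofReal ?_)
    · exact hβmeas.comp (measurable_id.prodMk measurable_const)
    · exact measurable_id.pow_const r
  have hsr : 0 ≤ s ^ r := Real.rpow_nonneg hs0.le r
  -- After `m = z s`, the integrand `m ^ r β(m, s) dm` becomes `s ^ r z ^ (r - r₀) F(z) dz`, where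
  -- `F` is the member of the equi-integrable family with index `s`.
  rw [lintegral_Icc_zero_eq_mul hs0 hmeas]
  calc ENNReal.ofReal s *
        ∫⁻ z in Icc (0 : ℝ) 1, ENNReal.ofReal (β (z * s) s) * ENNReal.ofReal ((z * s) ^ r)
      = ENNReal.ofReal (s ^ r) *
        ∫⁻ z in Icc (0 : ℝ) 1, ENNReal.ofReal (z ^ (r - r₀)) * ENNReal.ofReal (F z) := by
        have hmeas' : Measurable fun z : ℝ =>
            ENNReal.ofReal (β (z * s) s) * ENNReal.ofReal ((z * s) ^ r) :=
          hmeas.comp (measurable_id.mul_const s)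
        rw [← lintegral_const_mul _ hmeas', ← lintegral_const_mul]
        · refine setLIntegral_congr_fun measurableSet_Icc fun z hz => ?_
          have hz0 : 0 ≤ z := hz.1
          have h1 : z ^ r = z ^ (r - r₀) * z ^ r₀ := by
            rw [← Real.rpow_add_of_nonneg hz0 (by linarith) hr₀, sub_add_cancel]
          have h2 : 0 ≤ z ^ (r - r₀) := Real.rpow_nonneg hz0 _
          have h3 := hβnonneg (z * s) s
          simp only [hF]
          rw [← ENNReal.ofReal_mul h3, ← ENNReal.ofReal_mul hs0.le, ← ENNReal.ofReal_mul h2,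
            ← ENNReal.ofReal_mul hsr, Real.mul_rpow hz0 hs0.le, h1]
          congr 1
          ring
        · exact ((measurable_id.pow_const _).ennreal_ofReal).mul hFm.ennreal_ofReal
    _ ≤ ENNReal.ofReal (s ^ r) * ENNReal.ofReal (q ^ (r - r₀) * C + ε / 2) := by gcongr
    _ ≤ ENNReal.ofReal (s ^ r) * ENNReal.ofReal ε := by
        gcongr
        linarith [hp₁ _ hp1]
    _ = ENNReal.ofReal (ε * s ^ r) := by rw [← ENNReal.ofReal_mul hsr, mul_comm]

/-- The weight of the gain term is dominated by half of the loss rate up to a constant. -/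
def GainBound (α₁ α₂ : ℝ → ℝ) (β : ℝ → ℝ → ℝ) (r C : ℝ) : Prop :=
  ∀ᵐ s ∂halfLine, ENNReal.ofReal (α₂ s) *
    ∫⁻ m in Icc 0 s, ENNReal.ofReal (β m s) * ENNReal.ofReal (1 + m ^ r) ≤
      ENNReal.ofReal ((α₁ s / 2 + C) * (1 + s ^ r))

/-- For large `s` the moments of orders `0` and `r` are both at most a small multiple of `s ^ r`,
which beats the comparison constant `M`. For the remaining `s` the rate `α₂` is bounded, and the
constant `C` takes over. The threshold `r₁` does not depend on `r`, whereas `C` may. -/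
theorem exists_gainBound {α₁ α₂ : ℝ → ℝ} {M : ℝ} (hM : 0 < M) (hα₂ : LocEssBounded α₂)
    (hcomp : ∀ᵐ m ∂halfLine, α₂ m ≤ M * α₁ m) (hα₁ : ∀ᵐ m ∂halfLine, 0 ≤ α₁ m)
    {β : ℝ → ℝ → ℝ} (hβmeas : Measurable fun p : ℝ × ℝ => β p.1 p.2)
    (hβnonneg : ∀ m s, 0 ≤ β m s) {l β₀ : ℝ} (hl : 0 ≤ l)
    (hnβ : ∀ s : ℝ, 0 ≤ s → MomentBound (fun m => β m s) β₀ l s)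
    {r₀ s₀ : ℝ} (hr₀ : 0 ≤ r₀) (hequi : EquiIntegrableKernel β r₀ s₀) :
    ∃ r₁ : ℝ, max l r₀ < r₁ ∧ ∀ r : ℝ, r₁ ≤ r → ∃ C : ℝ, 0 ≤ C ∧ GainBound α₁ α₂ β r C := by
  -- Two moments, each at most `ε s ^ r`, and the factor `M` give `M α₁ · 2 ε s ^ r = (α₁ / 3) s ^
  -- r`, below the allowed half of the loss rate.
  set ε : ℝ := 1 / (6 * M) with hε
  have hε0 : 0 < ε := by positivity
  obtain ⟨r₁, hr₁, hmom⟩ := exists_moment_le hβmeas hβnonneg hr₀ hequi hε0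
  refine ⟨max r₁ (l + 1), max_lt (lt_max_of_lt_right (by linarith)) (lt_max_of_lt_left hr₁),
    fun r hr => ?_⟩
  have hrl : 0 < r - l := by linarith [le_max_right r₁ (l + 1)]
  have hrr : r₁ ≤ r := (le_max_left _ _).trans hr
  have hr0 : 0 ≤ r := by linarith
  -- the zeroth moment is negligible for large `s`
  have hlim : Tendsto (fun s : ℝ => 2 * |β₀| * s ^ (-(r - l))) atTop (𝓝 0) := by
    simpa using (tendsto_rpow_neg_atTop hrl).const_mul (2 * |β₀|)
  obtain ⟨R₀, hR₀⟩ := eventually_atTop.1 (hlim.eventually_le_const hε0)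
  -- Beyond `R` the zeroth moment is negligible, `1 ≤ s ^ l` holds, and the moment estimate from
  -- equi-integrability applies.
  set R : ℝ := max (max R₀ 1) s₀ with hR
  obtain ⟨C₂, hC₂⟩ := hα₂.2 R
  set C : ℝ := |C₂| * (|β₀| * (1 + R ^ l)) with hC
  have hR1 : 1 ≤ R := (le_max_right R₀ 1).trans (le_max_left _ _)
  have hR0 : 0 ≤ R := by linarith
  have hRl : 0 ≤ R ^ l := Real.rpow_nonneg hR0 l
  refine ⟨C, by positivity, ?_⟩
  have hC₂' : ∀ᵐ s ∂halfLine, s ≤ R → |α₂ s| ≤ C₂ := by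
    rw [ae_restrict_iff' measurableSet_Icc] at hC₂
    rw [ae_restrict_iff' measurableSet_Ici]
    filter_upwards [hC₂] with s hs h0 hsR using hs ⟨h0, hsR⟩
  filter_upwards [hC₂', hcomp, hα₁, ae_restrict_mem measurableSet_Ici] with s h1 h2 h3 hs
  have hs0 : (0 : ℝ) ≤ s := hs
  have hsr : 0 ≤ s ^ r := Real.rpow_nonneg hs0 r
  have hsl : 0 ≤ s ^ l := Real.rpow_nonneg hs0 l
  have hβm : Measurable fun m => ENNReal.ofReal (β m s) :=
    (hβmeas.comp (measurable_id.prodMk measurable_const)).ennreal_ofReal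
  have hmb : ∫⁻ m in Icc 0 s, ENNReal.ofReal (β m s) ≤ ENNReal.ofReal (|β₀| * (1 + s ^ l)) :=
    (hnβ s hs0).trans (ENNReal.ofReal_le_ofReal (by
      have := le_abs_self β₀
      gcongr))
  rcases le_total s R with hsR | hsR
  · calc ENNReal.ofReal (α₂ s) *
        ∫⁻ m in Icc 0 s, ENNReal.ofReal (β m s) * ENNReal.ofReal (1 + m ^ r)
        ≤ ENNReal.ofReal |C₂| *
          ∫⁻ m in Icc 0 s, ENNReal.ofReal (β m s) * ENNReal.ofReal (1 + s ^ r) := by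
          gcongr ?_ * ?_
          · exact ENNReal.ofReal_le_ofReal ((le_abs_self _).trans ((h1 hsR).trans (le_abs_self _)))
          · refine setLIntegral_mono' measurableSet_Icc fun m hm => ?_
            gcongr
            · exact hm.1
            · exact hm.2
      _ ≤ ENNReal.ofReal |C₂| *
          (ENNReal.ofReal (|β₀| * (1 + R ^ l)) * ENNReal.ofReal (1 + s ^ r)) := by
          rw [lintegral_mul_const _ hβm]
          gcongr
          exact hmb.trans (ENNReal.ofReal_le_ofReal (by gcongr))
      _ = ENNReal.ofReal (C * (1 + s ^ r)) := by
          rw [← ENNReal.ofReal_mul (by positivity), ← ENNReal.ofReal_mul (abs_nonneg _), hC]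
          congr 1
          ring
      _ ≤ ENNReal.ofReal ((α₁ s / 2 + C) * (1 + s ^ r)) := by
          refine ENNReal.ofReal_le_ofReal ?_
          gcongr
          linarith
  · have hs1 : 1 ≤ s := hR1.trans hsR
    have hspos : 0 < s := by linarith
    have hlow : |β₀| * (1 + s ^ l) ≤ ε * s ^ r := by
      have h4 := hR₀ s (((le_max_left _ _).trans (le_max_left _ _)).trans hsR)
      have h5 : (1 : ℝ) ≤ s ^ l := Real.one_le_rpow hs1 hl
      have h6 : s ^ l = s ^ (-(r - l)) * s ^ r := by
        rw [← Real.rpow_add hspos]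
        congr 1
        ring
      calc |β₀| * (1 + s ^ l) ≤ |β₀| * (s ^ l + s ^ l) := by gcongr
        _ = 2 * |β₀| * s ^ (-(r - l)) * s ^ r := by rw [h6]; ring
        _ ≤ ε * s ^ r := by gcongr
    have hhigh := hmom r hrr s ((le_max_right _ _).trans hsR) hspos
    have hsum : ∫⁻ m in Icc 0 s, ENNReal.ofReal (β m s) * ENNReal.ofReal (1 + m ^ r) ≤
        ENNReal.ofReal (2 * ε * s ^ r) := by
      calc ∫⁻ m in Icc 0 s, ENNReal.ofReal (β m s) * ENNReal.ofReal (1 + m ^ r)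
          = ∫⁻ m in Icc 0 s, (ENNReal.ofReal (β m s) +
            ENNReal.ofReal (β m s) * ENNReal.ofReal (m ^ r)) := by
            refine setLIntegral_congr_fun measurableSet_Icc fun m hm => ?_
            rw [ENNReal.ofReal_add zero_le_one (Real.rpow_nonneg hm.1 r), mul_add,
              ENNReal.ofReal_one, mul_one]
        _ = (∫⁻ m in Icc 0 s, ENNReal.ofReal (β m s)) +
            ∫⁻ m in Icc 0 s, ENNReal.ofReal (β m s) * ENNReal.ofReal (m ^ r) :=
            lintegral_add_left hβm _
        _ ≤ ENNReal.ofReal (ε * s ^ r) + ENNReal.ofReal (ε * s ^ r) :=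
            add_le_add (hmb.trans (ENNReal.ofReal_le_ofReal hlow)) hhigh
        _ = ENNReal.ofReal (2 * ε * s ^ r) := by
            rw [← ENNReal.ofReal_add (by positivity) (by positivity)]
            congr 1
            ring
    have hMα : 0 ≤ M * α₁ s := by positivity
    calc ENNReal.ofReal (α₂ s) *
        ∫⁻ m in Icc 0 s, ENNReal.ofReal (β m s) * ENNReal.ofReal (1 + m ^ r)
        ≤ ENNReal.ofReal (M * α₁ s) * ENNReal.ofReal (2 * ε * s ^ r) := by
          gcongr
      _ = ENNReal.ofReal (α₁ s / 3 * s ^ r) := by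
          rw [← ENNReal.ofReal_mul hMα, hε]
          congr 1
          field_simp
          ring
      _ ≤ ENNReal.ofReal ((α₁ s / 2 + C) * (1 + s ^ r)) := by
          refine ENNReal.ofReal_le_ofReal ?_
          have hC0 : 0 ≤ C := by positivity
          gcongr
          · linarith
          · linarith

end Coefficients

/-! ### The weighted measure on the mass axis -/

section MassMeasure

theorem massMeasure_ac (r : ℝ) : massMeasure r ≪ halfLine := withDensity_absolutelyContinuous _ _

theorem ae_massMeasure_eq (r : ℝ) : ae (massMeasure r) = ae halfLine :=
  le_antisymm (massMeasure_ac r).ae_le (halfLine_ac r).ae_le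

theorem ae_massMeasure_nonneg (r : ℝ) : ∀ᵐ m ∂(massMeasure r), (0 : ℝ) ≤ m := by
  rw [ae_massMeasure_eq]; exact ae_restrict_mem measurableSet_Ici

theorem ae_volume_of_ae_massMeasure {r : ℝ} {p : ℝ → Prop} (h : ∀ᵐ m ∂(massMeasure r), p m) :
    ∀ᵐ m : ℝ, 0 ≤ m → p m := by
  rw [ae_massMeasure_eq, ae_restrict_iff' measurableSet_Ici] at h
  exact h

theorem lintegral_massMeasure (r : ℝ) {g : ℝ → ℝ≥0∞} (hg : Measurable g) :
    ∫⁻ m, g m ∂(massMeasure r) = ∫⁻ m in Ici (0 : ℝ), ENNReal.ofReal (1 + m ^ r) * g m := by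
  rw [massMeasure, lintegral_withDensity_eq_lintegral_mul _ (by fun_prop) hg]
  rfl

end MassMeasure

/-! ### Loss and gain operators -/

section LossGain

variable {N : ℕ} {Ω : Set (Sp N)} {X : Type*} [NormedAddCommGroup X] [NormedSpace ℝ X]

/-- A loss rate between `α₁` and `α₂`, which are comparable with each other. -/
structure IsLossRate (Ω : Set (Sp N)) (Reg : (Sp N → ℝ) → Prop) (a : Sp N → ℝ → ℝ)
    (α₁ α₂ : ℝ → ℝ) (M : ℝ) : Prop where
  measurable : Measurable fun p : Sp N × ℝ => a p.1 p.2
  measurable₁ : Measurable α₁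
  locBdd₂ : LocEssBounded α₂
  reg : ∀ᵐ m ∂halfLine, Reg fun x => a x m
  bounds : ∀ᵐ m ∂halfLine, ∀ᵐ x ∂(volume.restrict Ω), α₁ m ≤ a x m ∧ a x m ≤ α₂ m
  comparable : ∀ᵐ m ∂halfLine, 0 ≤ α₁ m ∧ α₁ m ≤ α₂ m ∧ α₂ m ≤ M * α₁ m

/-- A nonnegative gain kernel dominated by `α₂(s) β(m, s)`. -/
structure IsGainKernel (Ω : Set (Sp N)) (Reg : (Sp N → ℝ) → Prop) (κ : Sp N → ℝ → ℝ → ℝ)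
    (α₂ : ℝ → ℝ) (β : ℝ → ℝ → ℝ) : Prop where
  measurable : Measurable fun p : Sp N × ℝ × ℝ => κ p.1 p.2.1 p.2.2
  measurable_dom : Measurable fun p : ℝ × ℝ => β p.1 p.2
  dom_nonneg : ∀ m s, 0 ≤ β m s
  reg : ∀ᵐ p ∂(volume : Measure (ℝ × ℝ)), 0 ≤ p.1 → p.1 < p.2 → Reg fun x => κ x p.1 p.2
  bounds : ∀ᵐ p ∂(volume : Measure (ℝ × ℝ)), 0 ≤ p.1 → p.1 < p.2 →
    ∀ᵐ x ∂(volume.restrict Ω), 0 ≤ κ x p.1 p.2 ∧ κ x p.1 p.2 ≤ α₂ p.2 * β p.1 p.2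

section Fibre

theorem smul_add_mem_positiveCone {ι : X →ₗ[ℝ] FunOn Ω} {a : Sp N → ℝ} {c : ℝ} {u v : X}
    (ha : ∀ᵐ x ∂(volume.restrict Ω), a x ≤ c)
    (huv : ∀ᵐ x ∂(volume.restrict Ω), ι v x = -a x * ι u x) (hu : u ∈ positiveCone ι) :
    c • u + v ∈ positiveCone ι := by
  rw [mem_positiveCone_iff] at *
  filter_upwards [ha, huv, ae_map_add ι (c • u) v, ae_map_smul ι c u, hu] with x h1 h2 h3 h4 h5
  rw [h3, h4, h2, show c * ι u x + -a x * ι u x = (c - a x) * ι u x by ring]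
  exact mul_nonneg (sub_nonneg.2 h1) h5

variable [MeasurableSpace X] {ι : X →ₗ[ℝ] FunOn Ω} {Reg : (Sp N → ℝ) → Prop}

/-- Adding an upper bound `c` of the rate leaves the multiplier `c - a`, which lies between `0` and
`c - α`. In this form the norm benefits from the sign of the loss. -/
theorem IsFunctionSpace.norm_smul_add_le (hX : IsFunctionSpace ι Reg) {a : Sp N → ℝ} {α c : ℝ}
    {u v : X} (ha : ∀ᵐ x ∂(volume.restrict Ω), α ≤ a x ∧ a x ≤ c)
    (huv : ∀ᵐ x ∂(volume.restrict Ω), ι v x = -a x * ι u x) (hαc : α ≤ c) :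
    ‖c • u + v‖ ≤ (c - α) * ‖u‖ := by
  refine hX.norm_le _ _ _ (sub_nonneg.2 hαc) ?_
  filter_upwards [ha, huv, ae_map_add ι (c • u) v, ae_map_smul ι c u] with x h1 h2 h3 h4
  rw [h3, h4, h2, show c * ι u x + -a x * ι u x = (c - a x) * ι u x by ring, abs_mul,
    abs_of_nonneg (sub_nonneg.2 h1.2)]
  gcongr
  exact h1.1

theorem IsFunctionSpace.le_norm_of_loss (hX : IsFunctionSpace ι Reg) {a : Sp N → ℝ} {α : ℝ}
    {u v : X} (hα : 0 ≤ α) (ha : ∀ᵐ x ∂(volume.restrict Ω), α ≤ a x)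
    (huv : ∀ᵐ x ∂(volume.restrict Ω), ι v x = -a x * ι u x) : α * ‖u‖ ≤ ‖v‖ := by
  have h := hX.norm_le (α • u) v 1 zero_le_one (by
    filter_upwards [ha, huv, ae_map_smul ι α u] with x h1 h2 h3
    rw [h3, h2, abs_mul, abs_mul, abs_neg, one_mul]
    gcongr)
  rwa [norm_smul, Real.norm_of_nonneg hα, one_mul] at h

theorem IsFunctionSpace.norm_loss_le (hX : IsFunctionSpace ι Reg) {a : Sp N → ℝ} {c : ℝ}
    {u v : X} (hc : 0 ≤ c) (ha : ∀ᵐ x ∂(volume.restrict Ω), 0 ≤ a x ∧ a x ≤ c)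
    (huv : ∀ᵐ x ∂(volume.restrict Ω), ι v x = -a x * ι u x) : ‖v‖ ≤ c * ‖u‖ := by
  refine hX.norm_le _ _ _ hc ?_
  filter_upwards [ha, huv] with x h1 h2
  rw [h2, abs_mul, abs_neg, abs_of_nonneg h1.1]
  gcongr
  exact h1.2

end Fibre

variable [MeasurableSpace X]
  {ι : X →ₗ[ℝ] FunOn Ω} {Reg : (Sp N → ℝ) → Prop} {a : Sp N → ℝ → ℝ} {α₁ α₂ : ℝ → ℝ}
  {M r C : ℝ} {κ : Sp N → ℝ → ℝ → ℝ} {β : ℝ → ℝ → ℝ}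

theorem ae_massMeasure_bounds (ha : IsLossRate Ω Reg a α₁ α₂ M) (r : ℝ) :
    ∀ᵐ m ∂(massMeasure r), 0 ≤ α₁ m ∧ α₁ m ≤ α₂ m ∧ α₂ m ≤ M * α₁ m ∧
      ∀ᵐ x ∂(volume.restrict Ω), α₁ m ≤ a x m ∧ a x m ≤ α₂ m := by
  rw [ae_massMeasure_eq]
  filter_upwards [ha.bounds, ha.comparable] with m h1 h2
  exact ⟨h2.1, h2.2.1, h2.2.2, h1⟩

theorem integrable_of_mem_lossGraph (hX : IsFunctionSpace ι Reg)
    (ha : IsLossRate Ω Reg a α₁ α₂ M) {u v : BochnerL1 X r} (huv : (u, v) ∈ lossGraph ι a r) :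
    Integrable (fun m => α₁ m * ‖u m‖) (massMeasure r) := by
  refine (L1.integrable_coeFn v).mono
    (ha.measurable₁.aestronglyMeasurable.mul (Lp.aestronglyMeasurable u).norm) ?_
  filter_upwards [ae_massMeasure_bounds ha r, huv] with m h1 h2
  rw [norm_mul, norm_norm, Real.norm_of_nonneg h1.1]
  exact hX.le_norm_of_loss h1.1 (h1.2.2.2.mono fun x hx => hx.1) h2

theorem exists_mem_lossGraph (hX : IsFunctionSpace ι Reg) (ha : IsLossRate Ω Reg a α₁ α₂ M)
    {u : BochnerL1 X r} (hu : Integrable (fun m => α₁ m * ‖u m‖) (massMeasure r)) :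
    ∃ v, (u, v) ∈ lossGraph ι a r := by
  obtain ⟨w, hw, hwu⟩ := hX.mul ℝ (massMeasure r) (fun m x => a x m)
    (ha.measurable.comp measurable_swap) (by
      have hreg := ha.reg
      rw [← ae_massMeasure_eq r] at hreg
      filter_upwards [hreg, ae_massMeasure_bounds ha r] with m h1 h2
      refine ⟨h1, α₂ m, ?_⟩
      filter_upwards [h2.2.2.2] with x hx
      rw [abs_of_nonneg (h2.1.trans hx.1)]
      exact hx.2) u (Lp.aestronglyMeasurable u)
  have hneg : ∀ᵐ m ∂(massMeasure r), ∀ᵐ x ∂(volume.restrict Ω),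
      ι (-w m) x = -a x m * ι (u m) x := by
    filter_upwards [hwu] with m h1
    filter_upwards [h1, ae_map_smul ι (-1) (w m)] with x h2 h3
    rw [neg_one_smul] at h3
    rw [h3, h2]; ring
  have hint : Integrable (fun m => -w m) (massMeasure r) := by
    refine (hu.const_mul M).mono hw.neg ?_
    filter_upwards [hneg, ae_massMeasure_bounds ha r] with m h1 h2
    have h3 : 0 ≤ α₂ m := h2.1.trans h2.2.1
    have h4 := hX.norm_loss_le h3
      (h2.2.2.2.mono fun x hx => ⟨h2.1.trans hx.1, hx.2⟩) h1
    refine h4.trans ((mul_le_mul_of_nonneg_right h2.2.2.1 (norm_nonneg _)).trans ?_)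
    rw [mul_assoc]
    exact le_abs_self _
  refine ⟨hint.toL1 _, ?_⟩
  filter_upwards [hneg, hint.coeFn_toL1] with m h1 h2
  change ∀ᵐ x ∂(volume.restrict Ω), ι (hint.toL1 _ m) x = _
  rw [h2]
  exact h1

/-- Because `α₁ ≤ a ≤ α₂ ≤ M α₁`, the domain depends on `α₁` alone. This identifies the domains of
the loss operators with rates `a` and `α₁`, and makes integrability of `α₁ ‖u(m)‖` the working
criterion. -/
theorem mem_lossOp_domain_iff (hX : IsFunctionSpace ι Reg) (ha : IsLossRate Ω Reg a α₁ α₂ M)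
    {u : BochnerL1 X r} :
    u ∈ (lossOp ι a r).domain ↔ Integrable (fun m => α₁ m * ‖u m‖) (massMeasure r) := by
  rw [LinearPMap.mem_domain_iff, lossOp_graph hX.injective]
  exact ⟨fun ⟨v, hv⟩ => integrable_of_mem_lossGraph hX ha hv, exists_mem_lossGraph hX ha⟩

/-- The kernel `α₂(s) β(m, s)` cut off to `0 ≤ m < s`. -/
noncomputable def domKernel (α₂ : ℝ → ℝ) (β : ℝ → ℝ → ℝ) (p : ℝ × ℝ) : ℝ :=
  {p : ℝ × ℝ | 0 ≤ p.1 ∧ p.1 < p.2}.indicator (fun p => α₂ p.2 * β p.1 p.2) p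

theorem domKernel_of_lt {p : ℝ × ℝ} (hp : 0 ≤ p.1 ∧ p.1 < p.2) :
    domKernel α₂ β p = α₂ p.2 * β p.1 p.2 :=
  indicator_of_mem (s := {p : ℝ × ℝ | 0 ≤ p.1 ∧ p.1 < p.2}) hp _

theorem domKernel_of_not {p : ℝ × ℝ} (hp : ¬(0 ≤ p.1 ∧ p.1 < p.2)) : domKernel α₂ β p = 0 :=
  indicator_of_notMem (s := {p : ℝ × ℝ | 0 ≤ p.1 ∧ p.1 < p.2}) hp _

theorem measurableSet_lower : MeasurableSet {p : ℝ × ℝ | 0 ≤ p.1 ∧ p.1 < p.2} :=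
  (measurableSet_le measurable_const measurable_fst).inter
    (measurableSet_lt measurable_fst measurable_snd)

theorem measurable_domKernel (hα : Measurable α₂)
    (hβ : Measurable fun p : ℝ × ℝ => β p.1 p.2) : Measurable (domKernel α₂ β) :=
  ((hα.comp measurable_snd).mul hβ).indicator measurableSet_lower

theorem lintegral_domKernel_le (hα : Measurable α₂)
    (hβ : Measurable fun p : ℝ × ℝ => β p.1 p.2) (hβ0 : ∀ m s, 0 ≤ β m s)
    (hC : GainBound α₁ α₂ β r C) :
    ∀ᵐ s ∂(volume : Measure ℝ), ∫⁻ m, ENNReal.ofReal (domKernel α₂ β (m, s)) ∂(massMeasure r) ≤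
      (Ici (0 : ℝ)).indicator
        (fun s => ENNReal.ofReal (1 + s ^ r) * ENNReal.ofReal (α₁ s / 2 + C)) s := by
  have hk := measurable_domKernel hα hβ
  rw [GainBound, ae_restrict_iff' measurableSet_Ici] at hC
  filter_upwards [hC] with s hs
  have hks : Measurable fun m => ENNReal.ofReal (domKernel α₂ β (m, s)) :=
    (hk.comp (measurable_id.prodMk measurable_const)).ennreal_ofReal
  rw [lintegral_massMeasure r hks]
  by_cases h0 : 0 ≤ s
  · rw [indicator_of_mem (mem_Ici.2 h0)]
    have hsr : 0 ≤ s ^ r := Real.rpow_nonneg h0 r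
    have h1 := hs h0
    rw [mul_comm (α₁ s / 2 + C), ENNReal.ofReal_mul (by positivity)] at h1
    refine le_trans ?_ h1
    rw [← lintegral_const_mul']
    swap
    · exact ENNReal.ofReal_ne_top
    rw [← lintegral_indicator measurableSet_Ici, ← lintegral_indicator measurableSet_Icc]
    refine lintegral_mono fun m => ?_
    by_cases hm : 0 ≤ m ∧ m < s
    · rw [indicator_of_mem (mem_Ici.2 hm.1), indicator_of_mem (mem_Icc.2 ⟨hm.1, hm.2.le⟩),
        domKernel_of_lt (p := (m, s)) hm,
        ENNReal.ofReal_mul' (hβ0 m s), mul_comm, mul_assoc]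
    · rw [indicator_apply]
      split_ifs
      · rw [domKernel_of_not (p := (m, s)) hm]
        simp
      · exact zero_le
  · rw [setLIntegral_congr_fun (g := fun _ => 0) measurableSet_Ici]
    · simp
    · intro m hm
      dsimp only
      rw [domKernel_of_not (p := (m, s)) fun h => h0 (h.1.trans h.2.le)]
      simp

/-- Tonelli with the `m`-integral inside: `GainBound` trades the weight `1 + m ^ r` of the produced
mass for the weight `1 + s ^ r` of the parent mass. Hence the measure is weighted in `m` and
Lebesgue in `s` on the left, weighted in `s` on the right. -/
theorem lintegral_domKernel_mul_le (hα : Measurable α₂)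
    (hβ : Measurable fun p : ℝ × ℝ => β p.1 p.2) (hβ0 : ∀ m s, 0 ≤ β m s)
    (hα₁ : Measurable α₁) (hC : GainBound α₁ α₂ β r C) {g : ℝ → ℝ≥0∞} (hg : Measurable g) :
    ∫⁻ p, ENNReal.ofReal (domKernel α₂ β p) * g p.2 ∂((massMeasure r).prod volume) ≤
      ∫⁻ s, ENNReal.ofReal (α₁ s / 2 + C) * g s ∂(massMeasure r) := by
  have hk := (measurable_domKernel hα hβ).ennreal_ofReal
  have hkg : Measurable fun p : ℝ × ℝ => ENNReal.ofReal (domKernel α₂ β p) * g p.2 :=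
    hk.mul (hg.comp measurable_snd)
  rw [lintegral_prod_symm' _ hkg, lintegral_massMeasure r (by fun_prop), ← lintegral_indicator measurableSet_Ici]
  refine lintegral_mono_ae ?_
  filter_upwards [lintegral_domKernel_le hα hβ hβ0 hC] with s hs
  have hks : Measurable fun m => ENNReal.ofReal (domKernel α₂ β (m, s)) :=
    hk.comp (measurable_id.prodMk measurable_const)
  rw [lintegral_mul_const _ hks]
  refine (mul_le_mul_left hs (g s)).trans (le_of_eq ?_)
  by_cases h0 : s ∈ Ici (0 : ℝ)
  · rw [indicator_of_mem h0, indicator_of_mem h0, mul_assoc]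
  · rw [indicator_of_notMem h0, indicator_of_notMem h0, zero_mul]

variable [BorelSpace X] [CompleteSpace X]

/-- The product `κ(·, m, s) u(s)` is a Bochner integrable `X`-valued function of `(m, s)`, and
`v(m)` is its integral over `s`. The norm bound, the support property and positivity are all
inherited from this integrand. -/
theorem exists_mem_gainGraph (hX : IsFunctionSpace ι Reg) (ha : IsLossRate Ω Reg a α₁ α₂ M)
    (hκ : IsGainKernel Ω Reg κ α₂ β) (hC0 : 0 ≤ C) (hC : GainBound α₁ α₂ β r C)
    {u : BochnerL1 X r} (hu : Integrable (fun m => α₁ m * ‖u m‖) (massMeasure r)) :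
    ∃ v, (u, v) ∈ gainGraph ι κ r ∧
      ‖v‖ ≤ ∫ m, (α₁ m / 2 + C) * ‖u m‖ ∂(massMeasure r) ∧
      (∀ n : ℝ, (∀ᵐ m ∂(massMeasure r), n < m → u m = 0) →
        ∀ᵐ m ∂(massMeasure r), n < m → v m = 0) ∧
      (u ∈ positiveConeL1 ι r → v ∈ positiveConeL1 ι r) := by
  classical
  set μ := massMeasure r with hμ
  obtain ⟨ev, hev, hevι⟩ := hX.eval
  have hα₂ : Measurable α₂ := ha.locBdd₂.1
  have hum : Measurable (u : ℝ → X) := (Lp.stronglyMeasurable u).measurable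
  have hac : μ.prod volume ≪ (volume : Measure (ℝ × ℝ)) := by
    rw [Measure.volume_eq_prod]
    exact ((massMeasure_ac r).trans Measure.restrict_le_self.absolutelyContinuous).prod
      Measure.AbsolutelyContinuous.rfl
  have hsnd : ∀ {p : ℝ → Prop}, (∀ᵐ m ∂μ, p m) → ∀ᵐ q ∂(μ.prod volume), 0 ≤ q.2 → p q.2 :=
    fun h => Measure.quasiMeasurePreserving_snd.ae (ae_volume_of_ae_massMeasure h)
  -- Nothing is assumed about `κ` outside `0 ≤ m < s`; the cutoff makes integration over all `s` the
  -- same as over `s > m`.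
  set φ : ℝ × ℝ → Sp N → ℝ := fun p x => if 0 ≤ p.1 ∧ p.1 < p.2 then κ x p.1 p.2 else 0 with hφ
  have hφm : Measurable fun q : (ℝ × ℝ) × Sp N => φ q.1 q.2 := by
    refine Measurable.ite (measurable_fst measurableSet_lower) ?_ measurable_const
    exact hκ.measurable.comp (measurable_snd.prodMk measurable_fst)
  have hφb : ∀ᵐ p ∂(μ.prod volume), Reg (φ p) ∧
      ∀ᵐ x ∂(volume.restrict Ω), 0 ≤ φ p x ∧ φ p x ≤ domKernel α₂ β p := by
    filter_upwards [hac.ae_le hκ.reg, hac.ae_le hκ.bounds] with p h1 h2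
    by_cases hp : 0 ≤ p.1 ∧ p.1 < p.2
    · rw [domKernel_of_lt hp]
      simp only [hφ, hp, and_self, if_true]
      exact ⟨h1 hp.1 hp.2, h2 hp.1 hp.2⟩
    · rw [domKernel_of_not hp]
      simp only [hφ, hp, if_false]
      exact ⟨hX.reg_zero, Eventually.of_forall fun x => ⟨le_rfl, le_rfl⟩⟩
  obtain ⟨w, hw, hwu⟩ := hX.mul (ℝ × ℝ) (μ.prod volume) φ hφm
    (hφb.mono fun p hp => ⟨hp.1, domKernel α₂ β p, hp.2.mono fun x hx => by
      rw [abs_of_nonneg hx.1]; exact hx.2⟩) (fun p => u p.2)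
    ((Lp.stronglyMeasurable u).comp_measurable measurable_snd).aestronglyMeasurable
  have hk0 : ∀ᵐ p ∂(μ.prod volume), 0 ≤ domKernel α₂ β p := by
    filter_upwards [hsnd (ae_massMeasure_bounds ha r)] with p h1
    by_cases hp : 0 ≤ p.1 ∧ p.1 < p.2
    · rw [domKernel_of_lt hp]
      have h2 := h1 (hp.1.trans hp.2.le)
      exact mul_nonneg (h2.1.trans h2.2.1) (hκ.dom_nonneg _ _)
    · rw [domKernel_of_not hp]
  have hwb : ∀ᵐ p ∂(μ.prod volume), ‖w p‖ ≤ domKernel α₂ β p * ‖u p.2‖ := by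
    filter_upwards [hk0, hwu, hφb] with p h0 h1 h2
    refine hX.norm_le _ _ _ h0 ?_
    filter_upwards [h1, h2.2] with x h3 h4
    rw [h3, abs_mul, abs_of_nonneg h4.1]
    gcongr
    exact h4.2
  have hEint : Integrable (fun m => (α₁ m / 2 + C) * ‖u m‖) μ := by
    refine ((hu.const_mul (1 / 2)).add ((L1.integrable_coeFn u).norm.const_mul C)).congr ?_
    filter_upwards with m
    simp only [Pi.add_apply]
    ring
  have hEnn : 0 ≤ᵐ[μ] fun m => (α₁ m / 2 + C) * ‖u m‖ := by
    filter_upwards [ae_massMeasure_bounds ha r] with m h1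
    have := h1.1
    positivity
  have hnorm : ∫⁻ p, ‖w p‖ₑ ∂(μ.prod volume) ≤
      ENNReal.ofReal (∫ m, (α₁ m / 2 + C) * ‖u m‖ ∂μ) := by
    calc ∫⁻ p, ‖w p‖ₑ ∂(μ.prod volume)
        ≤ ∫⁻ p, ENNReal.ofReal (domKernel α₂ β p) * ‖u p.2‖ₑ ∂(μ.prod volume) := by
          refine lintegral_mono_ae ?_
          filter_upwards [hwb, hk0] with p h1 h2
          rw [← ofReal_norm, ← ofReal_norm, ← ENNReal.ofReal_mul h2]
          exact ENNReal.ofReal_le_ofReal h1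
      _ ≤ ∫⁻ s, ENNReal.ofReal (α₁ s / 2 + C) * ‖u s‖ₑ ∂μ :=
          lintegral_domKernel_mul_le hα₂ hκ.measurable_dom hκ.dom_nonneg ha.measurable₁ hC hum.enorm
      _ = ENNReal.ofReal (∫ m, (α₁ m / 2 + C) * ‖u m‖ ∂μ) := by
          rw [ofReal_integral_eq_lintegral_ofReal hEint hEnn]
          refine lintegral_congr_ae ?_
          filter_upwards [ae_massMeasure_bounds ha r] with m h1
          have := h1.1
          rw [ENNReal.ofReal_mul (by positivity), ofReal_norm]
  have hwi : Integrable w (μ.prod volume) := ⟨hw, hnorm.trans_lt ENNReal.ofReal_lt_top⟩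
  have hvi : Integrable (fun m => ∫ s, w (m, s)) μ := hwi.integral_prod_left
  have hvae := hvi.coeFn_toL1
  have hwu' := Measure.ae_ae_of_ae_prod hwu
  have hwb' := Measure.ae_ae_of_ae_prod hwb
  refine ⟨hvi.toL1 _, ⟨fun q => ev q.1 (u q.2), ⟨?_, ?_⟩, ?_⟩, ?_, ?_, ?_⟩
  · exact (hev.comp (measurable_fst.prodMk (hum.comp measurable_snd))).aestronglyMeasurable
  · exact Eventually.of_forall fun m => hevι (u m)
  · filter_upwards [hwu', hwi.prod_right_ae, hvae, ae_massMeasure_nonneg r] with m h1 h2 h3 hm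
    have h4 := hX.integral volume (fun s => w (m, s)) (fun x s => φ (m, s) x * ev x (u s)) h2
      ((hφm.comp ((measurable_const.prodMk measurable_snd).prodMk measurable_fst)).mul
        (hev.comp (measurable_fst.prodMk (hum.comp measurable_snd)))) (by
        filter_upwards [h1] with s h5
        filter_upwards [h5, hevι (u s)] with x h6 h7
        rw [h6, h7])
    filter_upwards [h4] with x h5
    have e : (fun s => φ (m, s) x * ev x (u s)) =
        (Ioi m).indicator fun s => κ x m s * ev x (u s) := by
      funext s
      by_cases hs : m < s
      · simp [hφ, hm, hs]
      · simp [hφ, hs]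
    rw [e, integrable_indicator_iff measurableSet_Ioi, integral_indicator measurableSet_Ioi] at h5
    refine ⟨h5.1, ?_⟩
    change ι (hvi.toL1 _ m) x = _
    rw [h3]
    exact h5.2
  · have h0 : 0 ≤ ∫ m, (α₁ m / 2 + C) * ‖u m‖ ∂μ := integral_nonneg_of_ae hEnn
    rw [← ENNReal.ofReal_le_ofReal_iff h0]
    refine le_trans ?_ hnorm
    rw [ofReal_norm, Lp.enorm_def, eLpNorm_one_eq_lintegral_enorm]
    calc ∫⁻ m, ‖hvi.toL1 _ m‖ₑ ∂μ = ∫⁻ m, ‖(∫ s, w (m, s))‖ₑ ∂μ := by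
          refine lintegral_congr_ae ?_
          filter_upwards [hvae] with m h1
          rw [h1]
      _ ≤ ∫⁻ m, (∫⁻ s, ‖w (m, s)‖ₑ) ∂μ :=
          lintegral_mono fun m => enorm_integral_le_lintegral_enorm _
      _ = ∫⁻ p, ‖w p‖ₑ ∂(μ.prod volume) := (lintegral_prod _ hw.enorm).symm
  · intro n hn
    have hn' := ae_volume_of_ae_massMeasure hn
    filter_upwards [hvae, hwb', ae_massMeasure_nonneg r] with m h1 h2 h3 hnm
    rw [h1]
    refine integral_eq_zero_of_ae ?_
    filter_upwards [h2, hn'] with s h4 h5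
    refine norm_le_zero_iff.1 (h4.trans (le_of_eq ?_))
    by_cases hs : m < s
    · rw [h5 (h3.trans hs.le) (hnm.trans hs), norm_zero, mul_zero]
    · rw [domKernel_of_not (p := (m, s)) fun h => hs h.2, zero_mul]
  · intro hpos
    have hpos' : ∀ᵐ m ∂μ, u m ∈ positiveCone ι := hpos
    have hwp : ∀ᵐ p ∂(μ.prod volume), w p ∈ positiveCone ι := by
      filter_upwards [hwu, hφb, hsnd hpos'] with p h1 h2 h3
      rw [mem_positiveCone_iff]
      by_cases hp : 0 ≤ p.1 ∧ p.1 < p.2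
      · filter_upwards [h1, h2.2, mem_positiveCone_iff.1 (h3 (hp.1.trans hp.2.le))]
          with x h4 h5 h6
        rw [h4]
        exact mul_nonneg h5.1 h6
      · filter_upwards [h1] with x h4
        rw [h4]
        simp [hφ, hp]
    change ∀ᵐ m ∂μ, hvi.toL1 _ m ∈ positiveCone ι
    filter_upwards [hvae, Measure.ae_ae_of_ae_prod hwp] with m h1 h2
    rw [h1]
    exact hX.isClosedCone.integral_mem h2

end LossGain

/-! ### Graph of a sum of partially defined operators -/

section LinearPMaps

variable {E : Type*} [NormedAddCommGroup E] [NormedSpace ℝ E]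

theorem mem_graph_add_iff {f g : E →ₗ.[ℝ] E} {u v : E} :
    (u, v) ∈ (f + g).graph ↔ ∃ v₁ v₂, (u, v₁) ∈ f.graph ∧ (u, v₂) ∈ g.graph ∧ v = v₁ + v₂ := by
  simp only [LinearPMap.mem_graph_iff]
  constructor
  · rintro ⟨y, rfl, rfl⟩
    exact ⟨_, _, ⟨⟨y, y.2.1⟩, rfl, rfl⟩, ⟨⟨y, y.2.2⟩, rfl, rfl⟩, rfl⟩
  · rintro ⟨_, _, ⟨y, rfl, rfl⟩, ⟨z, hz, rfl⟩, rfl⟩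
    obtain ⟨z, hz'⟩ := z
    simp only at hz
    subst hz
    exact ⟨⟨y, y.2, hz'⟩, rfl, rfl⟩

end LinearPMaps

/-! ### Truncation in the mass variable and the positive cone -/

section Bochner

variable {X : Type*} [NormedAddCommGroup X] {r : ℝ}

theorem exists_subseq_tendsto_ae {u : ℕ → BochnerL1 X r} {v : BochnerL1 X r}
    (h : Tendsto u atTop (𝓝 v)) : ∃ ns : ℕ → ℕ, StrictMono ns ∧
      ∀ᵐ m ∂(massMeasure r), Tendsto (fun k => u (ns k) m) atTop (𝓝 (v m)) :=
  (tendstoInMeasure_of_tendsto_Lp h).exists_seq_tendsto_ae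

theorem norm_le_integral_of_ae_le {u : BochnerL1 X r} {g : ℝ → ℝ}
    (hg : Integrable g (massMeasure r)) (h : ∀ᵐ m ∂(massMeasure r), ‖u m‖ ≤ g m) :
    ‖u‖ ≤ ∫ m, g m ∂(massMeasure r) := by
  rw [L1.norm_eq_integral_norm]
  exact integral_mono_ae (L1.integrable_coeFn u).norm hg h

theorem integrable_indicator_Iic (n : ℝ) (u : BochnerL1 X r) :
    Integrable ((Iic n).indicator u) (massMeasure r) :=
  (L1.integrable_coeFn u).indicator measurableSet_Iic

variable [NormedSpace ℝ X]

/-- Multiplication by the characteristic function of `m ≤ n`. -/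
noncomputable def trunc (X : Type*) [NormedAddCommGroup X] [NormedSpace ℝ X] (r n : ℝ) :
    BochnerL1 X r →ₗ[ℝ] BochnerL1 X r where
  toFun u := (integrable_indicator_Iic n u).toL1 _
  map_add' u v := by
    refine Lp.ext ?_
    filter_upwards [(integrable_indicator_Iic n u).coeFn_toL1,
      (integrable_indicator_Iic n v).coeFn_toL1, (integrable_indicator_Iic n (u + v)).coeFn_toL1,
      Lp.coeFn_add u v, Lp.coeFn_add ((integrable_indicator_Iic n u).toL1 _)
        ((integrable_indicator_Iic n v).toL1 _)] with m h1 h2 h3 h4 h5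
    rw [h3, h5, Pi.add_apply, h1, h2]
    by_cases hm : m ∈ Iic n
    · simp only [indicator_of_mem hm, h4, Pi.add_apply]
    · simp only [indicator_of_notMem hm, add_zero]
  map_smul' c u := by
    refine Lp.ext ?_
    filter_upwards [(integrable_indicator_Iic n u).coeFn_toL1,
      (integrable_indicator_Iic n (c • u)).coeFn_toL1, Lp.coeFn_smul c u,
      Lp.coeFn_smul c ((integrable_indicator_Iic n u).toL1 _)] with m h1 h3 h4 h5
    rw [h3, RingHom.id_apply, h5, Pi.smul_apply, h1]
    by_cases hm : m ∈ Iic n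
    · simp only [indicator_of_mem hm, h4, Pi.smul_apply]
    · simp only [indicator_of_notMem hm, smul_zero]

theorem trunc_coeFn (n : ℝ) (u : BochnerL1 X r) :
    ∀ᵐ m ∂(massMeasure r), trunc X r n u m = if m ≤ n then u m else 0 := by
  classical
  filter_upwards [(integrable_indicator_Iic n u).coeFn_toL1] with m h
  refine h.trans ?_
  rw [indicator_apply]
  rfl

theorem norm_trunc_le (n : ℝ) (u : BochnerL1 X r) : ‖trunc X r n u‖ ≤ ‖u‖ := by
  refine Lp.norm_le_norm_of_ae_le ?_
  filter_upwards [trunc_coeFn n u] with m h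
  rw [h]
  split_ifs <;> simp

theorem trunc_eq_self {n : ℝ} {u : BochnerL1 X r}
    (h : ∀ᵐ m ∂(massMeasure r), n < m → u m = 0) : trunc X r n u = u := by
  refine Lp.ext ?_
  filter_upwards [h, trunc_coeFn n u] with m h1 h2
  rw [h2]
  split_ifs with hm
  · rfl
  · exact (h1 (not_le.1 hm)).symm

theorem trunc_eq_zero_of_lt (n : ℝ) (u : BochnerL1 X r) :
    ∀ᵐ m ∂(massMeasure r), n < m → trunc X r n u m = 0 := by
  filter_upwards [trunc_coeFn n u] with m h hm
  rw [h, if_neg (not_le.2 hm)]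

theorem tendsto_trunc (u : BochnerL1 X r) :
    Tendsto (fun n : ℕ => trunc X r n u) atTop (𝓝 u) := by
  rw [tendsto_iff_norm_sub_tendsto_zero]
  have h1 : ∀ n : ℕ, ‖trunc X r n u - u‖ =
      ∫ m, ‖trunc X r n u m - u m‖ ∂(massMeasure r) := by
    intro n
    rw [L1.norm_eq_integral_norm]
    refine integral_congr_ae ?_
    filter_upwards [Lp.coeFn_sub (trunc X r n u) u] with m h
    rw [h, Pi.sub_apply]
  simp only [h1]
  rw [← integral_zero ℝ ℝ (μ := massMeasure r)]
  refine tendsto_integral_of_dominated_convergence (fun m => ‖u m‖) (fun n => ?_)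
    (L1.integrable_coeFn u).norm (fun n => ?_) ?_
  · exact ((Lp.aestronglyMeasurable _).sub (Lp.aestronglyMeasurable _)).norm
  · filter_upwards [trunc_coeFn n u] with m h
    rw [h]
    split_ifs <;> simp
  · have h2 : ∀ᵐ m ∂(massMeasure r), ∀ n : ℕ, trunc X r n u m = if m ≤ n then u m else 0 :=
      ae_all_iff.2 fun n => trunc_coeFn n u
    filter_upwards [h2] with m h
    refine tendsto_const_nhds.congr' ?_
    filter_upwards [eventually_ge_atTop ⌈m⌉₊] with n hn
    have : m ≤ n := (Nat.le_ceil m).trans (by exact_mod_cast hn)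
    rw [h, if_pos this, sub_self, norm_zero]

/-- Transport does not mix masses, so it commutes with a cutoff in `m`. This is what allows the
truncated equation to be solved exactly. -/
theorem trunc_mem_transportGraph {T : ℝ → X →ₗ.[ℝ] X} (n : ℝ) {u v : BochnerL1 X r}
    (h : (u, v) ∈ transportGraph T r) : (trunc X r n u, trunc X r n v) ∈ transportGraph T r := by
  filter_upwards [h, trunc_coeFn n u, trunc_coeFn n v] with m h1 h2 h3
  rw [h2, h3]
  split_ifs
  · exact h1
  · exact (T m).graph.zero_mem

/-- Closedness comes from an a.e. convergent subsequence and the closedness of the cone in each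
fibre. -/
theorem isClosedCone_positiveConeL1 {N : ℕ} {Ω : Set (Sp N)} [MeasurableSpace X]
    {ι : X →ₗ[ℝ] FunOn Ω} {Reg : (Sp N → ℝ) → Prop} (hX : IsFunctionSpace ι Reg) (r : ℝ) :
    IsClosedCone (positiveConeL1 ι r) where
  isClosed := by
    refine IsSeqClosed.isClosed fun u v hu hv => ?_
    obtain ⟨ns, -, hns⟩ := exists_subseq_tendsto_ae hv
    have hu' : ∀ᵐ m ∂(massMeasure r), ∀ n, u n m ∈ positiveCone ι := ae_all_iff.2 hu
    filter_upwards [hns, hu'] with m h1 h2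
    exact hX.isClosed_cone.mem_of_tendsto h1 (Eventually.of_forall fun k => h2 _)
  zero_mem := by
    filter_upwards [Lp.coeFn_zero X 1 (massMeasure r)] with m h
    rw [h]
    exact hX.isClosedCone.zero_mem
  add_mem u hu v hv := by
    filter_upwards [hu, hv, Lp.coeFn_add u v] with m h1 h2 h3
    rw [h3]
    exact hX.isClosedCone.add_mem _ h1 _ h2
  smul_mem c hc u hu := by
    filter_upwards [hu, Lp.coeFn_smul c u] with m h1 h2
    rw [h2]
    exact hX.isClosedCone.smul_mem c hc _ h1

theorem trunc_mem_positiveConeL1 {N : ℕ} {Ω : Set (Sp N)} {ι : X →ₗ[ℝ] FunOn Ω} (n : ℝ)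
    {u : BochnerL1 X r} (hu : u ∈ positiveConeL1 ι r) : trunc X r n u ∈ positiveConeL1 ι r := by
  filter_upwards [hu, trunc_coeFn n u] with m h1 h2
  rw [h2]
  split_ifs
  · exact h1
  · rw [map_zero]

end Bochner

/-! ### The a priori estimate and the truncated perturbation -/

section Generation

variable {N : ℕ} {Ω : Set (Sp N)} {X : Type*} [NormedAddCommGroup X] [NormedSpace ℝ X]
  [MeasurableSpace X]
  {ι : X →ₗ[ℝ] FunOn Ω} {Reg : (Sp N → ℝ) → Prop} {a : Sp N → ℝ → ℝ} {α₁ α₂ : ℝ → ℝ}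
  {M r C : ℝ} {κ : Sp N → ℝ → ℝ → ℝ} {β : ℝ → ℝ → ℝ} {T : ℝ → X →ₗ.[ℝ] X}

theorem norm_loss_le_integral (hX : IsFunctionSpace ι Reg) (ha : IsLossRate Ω Reg a α₁ α₂ M)
    {u v : BochnerL1 X r} (huv : (u, v) ∈ lossGraph ι a r) :
    ‖v‖ ≤ M * ∫ m, α₁ m * ‖u m‖ ∂(massMeasure r) := by
  have hu := integrable_of_mem_lossGraph hX ha huv
  rw [← integral_const_mul]
  refine norm_le_integral_of_ae_le (hu.const_mul M) ?_
  filter_upwards [huv, ae_massMeasure_bounds ha r] with m h1 h2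
  have h3 : 0 ≤ α₂ m := h2.1.trans h2.2.1
  refine (hX.norm_loss_le h3 (h2.2.2.2.mono fun x hx => ⟨h2.1.trans hx.1, hx.2⟩) h1).trans ?_
  rw [← mul_assoc]
  exact mul_le_mul_of_nonneg_right h2.2.2.1 (norm_nonneg _)

variable [BorelSpace X] [CompleteSpace X]

theorem gainOp_domain_ge (hX : IsFunctionSpace ι Reg) (ha : IsLossRate Ω Reg a α₁ α₂ M)
    (hκ : IsGainKernel Ω Reg κ α₂ β) (hC0 : 0 ≤ C) (hC : GainBound α₁ α₂ β r C) :
    (lossOp ι a r).domain ≤ (gainOp ι κ r).domain := by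
  intro u hu
  obtain ⟨v, hv, -⟩ := exists_mem_gainGraph hX ha hκ hC0 hC ((mem_lossOp_domain_iff hX ha).1 hu)
  rw [LinearPMap.mem_domain_iff, gainOp_graph hX.injective]
  exact ⟨v, hv⟩

/-- The gain graph is single-valued, so `v` is the function constructed in `exists_mem_gainGraph`
and inherits its norm bound. The constant `1 / 2 < 1` is what lets the loss absorb the gain. -/
theorem norm_gain_le (hX : IsFunctionSpace ι Reg) (ha : IsLossRate Ω Reg a α₁ α₂ M)
    (hκ : IsGainKernel Ω Reg κ α₂ β) (hC0 : 0 ≤ C) (hC : GainBound α₁ α₂ β r C)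
    {u v : BochnerL1 X r} (hu : Integrable (fun m => α₁ m * ‖u m‖) (massMeasure r))
    (huv : (u, v) ∈ gainGraph ι κ r) :
    ‖v‖ ≤ (∫ m, α₁ m * ‖u m‖ ∂(massMeasure r)) / 2 + C * ‖u‖ := by
  obtain ⟨v', hv', hn, -⟩ := exists_mem_gainGraph hX ha hκ hC0 hC hu
  have e : v = v' := by
    rw [← gainOp_graph hX.injective] at huv hv'
    exact LinearPMap.mem_graph_snd_inj _ huv hv' rfl
  rw [e]
  refine hn.trans (le_of_eq ?_)
  rw [L1.norm_eq_integral_norm, ← integral_div, ← integral_const_mul,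
    ← integral_add (hu.div_const 2) ((L1.integrable_coeFn u).norm.const_mul C)]
  refine integral_congr_ae (Eventually.of_forall fun m => ?_)
  dsimp only
  ring

/-- The basic estimate: `K - C` is dissipative, with control of the loss term. -/
theorem dissipative_estimate (hX : IsFunctionSpace ι Reg) (ha : IsLossRate Ω Reg a α₁ α₂ M)
    (hκ : IsGainKernel Ω Reg κ α₂ β) (hC0 : 0 ≤ C) (hC : GainBound α₁ α₂ β r C)
    (hT : TransportAssumption ι T r) (c : ℝ) {u v₀ v₁ v₂ : BochnerL1 X r}
    (h₀ : (u, v₀) ∈ transportGraph T r) (h₁ : (u, v₁) ∈ lossGraph ι a r)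
    (h₂ : (u, v₂) ∈ gainGraph ι κ r) :
    (c - C) * ‖u‖ + (∫ m, α₁ m * ‖u m‖ ∂(massMeasure r)) / 2 ≤
      ‖c • u - (v₀ + v₁ + v₂)‖ := by
  obtain ⟨G, hG, -⟩ := hT
  have hu := integrable_of_mem_lossGraph hX ha h₁
  have hgain := norm_gain_le hX ha hκ hC0 hC hu h₂
  set f := c • u - (v₀ + v₁ + v₂) with hf
  have hG' := (massMeasure_ac r).ae_le hG
  have hfib : ∀ᵐ m ∂(massMeasure r), c * ‖u m‖ + α₁ m * ‖u m‖ ≤ ‖f m‖ + ‖v₂ m‖ := by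
    filter_upwards [hG', ae_massMeasure_bounds ha r, h₀, h₁,
      Lp.coeFn_sub (c • u) (v₀ + v₁ + v₂), Lp.coeFn_smul c u, Lp.coeFn_add (v₀ + v₁) v₂,
      Lp.coeFn_add v₀ v₁] with m g1 g2 g3 g4 g5 g6 g7 g8
    -- Dissipativity of `T m` is used at `c + α₂ m` rather than at `c`: the loss then enters as `α₂
    -- u + v₁`, of norm at most `(α₂ - α₁) ‖u‖`, and `α₁ ‖u‖` survives on the left.
    have k1 := norm_le_of_tendsto_quotient g1.1.contractive ((g1.2 _ _).1 g3) (c + α₂ m)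
    have k2 := hX.norm_smul_add_le g2.2.2.2 g4 g2.2.1
    have e : (c + α₂ m) • u m - v₀ m = f m + (α₂ m • u m + v₁ m) + v₂ m := by
      rw [hf, g5, Pi.sub_apply, g6, g7, Pi.smul_apply, Pi.add_apply, g8, Pi.add_apply]
      module
    rw [e] at k1
    have k3 := norm_add₃_le (a := f m) (b := α₂ m • u m + v₁ m) (c := v₂ m)
    linarith
  have hint := integral_mono_ae (((L1.integrable_coeFn u).norm.const_mul c).add hu)
    ((L1.integrable_coeFn f).norm.add (L1.integrable_coeFn v₂).norm) hfib
  simp only [Pi.add_apply] at hint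
  rw [integral_add ((L1.integrable_coeFn u).norm.const_mul c) hu, integral_const_mul,
    integral_add (L1.integrable_coeFn f).norm (L1.integrable_coeFn v₂).norm,
    ← L1.norm_eq_integral_norm, ← L1.norm_eq_integral_norm, ← L1.norm_eq_integral_norm] at hint
  linarith

/-- Loss and gain on truncated functions, shifted by a constant that makes them positive. -/
theorem exists_truncated_perturbation (hX : IsFunctionSpace ι Reg)
    (ha : IsLossRate Ω Reg a α₁ α₂ M) (hκ : IsGainKernel Ω Reg κ α₂ β) (hC0 : 0 ≤ C)
    (hC : GainBound α₁ α₂ β r C) (n : ℝ) :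
    ∃ (d : ℝ) (Q : BochnerL1 X r →L[ℝ] BochnerL1 X r), 0 ≤ d ∧ ‖Q‖ ≤ d + C ∧
      (∀ u ∈ positiveConeL1 ι r, Q u ∈ positiveConeL1 ι r) ∧
      ∀ u, ∃ v₁ v₂, (trunc X r n u, v₁) ∈ lossGraph ι a r ∧
        (trunc X r n u, v₂) ∈ gainGraph ι κ r ∧ Q u = d • trunc X r n u + (v₁ + v₂) ∧
        trunc X r n (v₁ + v₂) = v₁ + v₂ := by
  obtain ⟨d₀, hd₀⟩ := ha.locBdd₂.2 n
  set d : ℝ := max d₀ 0 with hd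
  have hd0 : 0 ≤ d := le_max_right _ _
  have hαd : ∀ᵐ m ∂(massMeasure r), m ≤ n → α₂ m ≤ d := by
    rw [ae_massMeasure_eq, ae_restrict_iff' measurableSet_Ici]
    rw [ae_restrict_iff' measurableSet_Icc] at hd₀
    filter_upwards [hd₀] with m h1 h2 h3
    exact (le_abs_self _).trans ((h1 ⟨h2, h3⟩).trans (le_max_left _ _))
  have hint : ∀ u : BochnerL1 X r,
      Integrable (fun m => α₁ m * ‖trunc X r n u m‖) (massMeasure r) := by
    intro u
    refine ((L1.integrable_coeFn u).norm.const_mul d).mono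
      (ha.measurable₁.aestronglyMeasurable.mul (Lp.aestronglyMeasurable _).norm) ?_
    filter_upwards [hαd, ae_massMeasure_bounds ha r, trunc_coeFn n u] with m h1 h2 h3
    rw [h3, norm_mul, norm_mul, Real.norm_of_nonneg h2.1, Real.norm_of_nonneg hd0, norm_norm,
      norm_norm]
    split_ifs with hm
    · gcongr
      exact h2.2.1.trans (h1 hm)
    · rw [norm_zero, mul_zero]
      positivity
  set V := lossOp ι a r + gainOp ι κ r with hV
  have hdom : ∀ u, trunc X r n u ∈ V.domain := fun u => by
    have h1 := (mem_lossOp_domain_iff hX ha).2 (hint u)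
    exact ⟨h1, gainOp_domain_ge hX ha hκ hC0 hC h1⟩
  -- For `m ≤ n` the rate `α₂` is at most `d`, so every truncated function lies in the domain of
  -- loss plus gain, and `d` plus the loss is positive.
  let Q₀ : BochnerL1 X r →ₗ[ℝ] BochnerL1 X r :=
    d • trunc X r n + V.toFun ∘ₗ (trunc X r n).codRestrict V.domain hdom
  have hQ : ∀ u, ∃ v₁ v₂, (trunc X r n u, v₁) ∈ lossGraph ι a r ∧
      (trunc X r n u, v₂) ∈ gainGraph ι κ r ∧ Q₀ u = d • trunc X r n u + (v₁ + v₂) ∧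
      (∀ᵐ m ∂(massMeasure r), n < m → v₂ m = 0) ∧
      (trunc X r n u ∈ positiveConeL1 ι r → v₂ ∈ positiveConeL1 ι r) := by
    intro u
    obtain ⟨v₁, hv₁⟩ := exists_mem_lossGraph hX ha (hint u)
    obtain ⟨v₂, hv₂, -, hsupp, hpos⟩ := exists_mem_gainGraph hX ha hκ hC0 hC (hint u)
    refine ⟨v₁, v₂, hv₁, hv₂, ?_, hsupp n (trunc_eq_zero_of_lt n u), hpos⟩
    have h1 : (trunc X r n u, v₁ + v₂) ∈ V.graph := by
      rw [hV, mem_graph_add_iff, lossOp_graph hX.injective, gainOp_graph hX.injective]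
      exact ⟨v₁, v₂, hv₁, hv₂, rfl⟩
    have h2 := V.mem_graph ⟨trunc X r n u, hdom u⟩
    have h3 := LinearPMap.mem_graph_snd_inj _ h2 h1 rfl
    rw [← h3]
    rfl
  have hsupp₁ : ∀ u v₁, (trunc X r n u, v₁) ∈ lossGraph ι a r →
      ∀ᵐ m ∂(massMeasure r), n < m → v₁ m = 0 := by
    intro u v₁ h
    filter_upwards [h, trunc_eq_zero_of_lt n u] with m h1 h2 hm
    rw [h2 hm] at h1
    refine hX.eq_of_ae_eq ?_
    filter_upwards [h1, ae_map_zero ι] with x h3 h4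
    rw [h3, h4, mul_zero]
  have hbound : ∀ u, ‖Q₀ u‖ ≤ (d + C) * ‖u‖ := by
    intro u
    obtain ⟨v₁, v₂, h1, h2, h3, -, -⟩ := hQ u
    rw [h3, ← add_assoc]
    have hgain := norm_gain_le hX ha hκ hC0 hC (hint u) h2
    have hint' := ((L1.integrable_coeFn (trunc X r n u)).norm.const_mul d).sub (hint u)
    -- The term `-∫ α₁ ‖u‖` more than offsets `(∫ α₁ ‖u‖) / 2` from the gain, which leaves the bound
    -- `d + C` needed for the Neumann series.
    have hloss : ‖d • trunc X r n u + v₁‖ ≤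
        ∫ m, (d * ‖trunc X r n u m‖ - α₁ m * ‖trunc X r n u m‖) ∂(massMeasure r) := by
      refine norm_le_integral_of_ae_le hint' ?_
      filter_upwards [h1, hsupp₁ u v₁ h1, trunc_eq_zero_of_lt n u, hαd,
        ae_massMeasure_bounds ha r, Lp.coeFn_add (d • trunc X r n u) v₁,
        Lp.coeFn_smul d (trunc X r n u)] with m k1 k2 k3 k4 k5 k6 k7
      rw [k6, Pi.add_apply, k7, Pi.smul_apply]
      rcases le_or_gt m n with hm | hm
      · rw [← sub_mul]
        exact hX.norm_smul_add_le
          (k5.2.2.2.mono fun x hx => ⟨hx.1, hx.2.trans (k4 hm)⟩) k1 (k5.2.1.trans (k4 hm))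
      · rw [k2 hm, k3 hm]
        simp
    rw [integral_sub ((L1.integrable_coeFn (trunc X r n u)).norm.const_mul d) (hint u),
      integral_const_mul, ← L1.norm_eq_integral_norm] at hloss
    have hpos : 0 ≤ ∫ m, α₁ m * ‖trunc X r n u m‖ ∂(massMeasure r) := by
      refine integral_nonneg_of_ae ?_
      filter_upwards [ae_massMeasure_bounds ha r] with m h
      exact mul_nonneg h.1 (norm_nonneg _)
    have hle := norm_trunc_le n u
    calc ‖d • trunc X r n u + v₁ + v₂‖ ≤ ‖d • trunc X r n u + v₁‖ + ‖v₂‖ := norm_add_le _ _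
      _ ≤ (d + C) * ‖trunc X r n u‖ := by linarith
      _ ≤ (d + C) * ‖u‖ := by gcongr
  refine ⟨d, Q₀.mkContinuous _ hbound, hd0, Q₀.mkContinuous_norm_le (by positivity) hbound,
    fun u hu => ?_, fun u => ?_⟩
  · rw [LinearMap.mkContinuous_apply]
    obtain ⟨v₁, v₂, h1, h2, h3, -, h5⟩ := hQ u
    have hu' := trunc_mem_positiveConeL1 (ι := ι) n hu
    rw [h3, ← add_assoc]
    refine (isClosedCone_positiveConeL1 hX r).add_mem _ ?_ _ (h5 hu')
    change ∀ᵐ m ∂(massMeasure r), 0 ≤ ι ((d • trunc X r n u + v₁ : BochnerL1 X r) m)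
    filter_upwards [h1, hsupp₁ u v₁ h1, trunc_eq_zero_of_lt n u, hαd,
        ae_massMeasure_bounds ha r, Lp.coeFn_add (d • trunc X r n u) v₁,
        Lp.coeFn_smul d (trunc X r n u), hu'] with m k1 k2 k3 k4 k5 k6 k7 k8
    rw [k6, Pi.add_apply, k7, Pi.smul_apply]
    rcases le_or_gt m n with hm | hm
    · exact smul_add_mem_positiveCone (k5.2.2.2.mono fun x hx => hx.2.trans (k4 hm)) k1 k8
    · rw [k2 hm, k3 hm, smul_zero, add_zero, map_zero]
  · obtain ⟨v₁, v₂, h1, h2, h3, h4, -⟩ := hQ u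
    refine ⟨v₁, v₂, h1, h2, h3, trunc_eq_self ?_⟩
    filter_upwards [hsupp₁ u v₁ h1, h4, Lp.coeFn_add v₁ v₂] with m k1 k2 k3 hm
    rw [k3, Pi.add_apply, k1 hm, k2 hm, add_zero]

end Generation

/-- Positive solution of `g = f + B g` by the Neumann series. -/
theorem exists_neumann {E : Type*} [NormedAddCommGroup E] [NormedSpace ℝ E] [CompleteSpace E]
    {B : E →L[ℝ] E} (hB : ‖B‖ < 1) {P : Set E} (hP : IsClosedCone P)
    (hBP : ∀ u ∈ P, B u ∈ P) (f : E) : ∃ g, g = f + B g ∧ (f ∈ P → g ∈ P) := by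
  have hs := summable_geometric_of_norm_lt_one hB
  refine ⟨(∑' k : ℕ, B ^ k) f, ?_, fun hf => ?_⟩
  · have h1 := mul_neg_geom_series B hB
    have h2 := DFunLike.congr_fun h1 f
    rw [mul_apply_eq_comp, one_apply_eq_self, _root_.sub_apply, one_apply_eq_self] at h2
    exact sub_eq_iff_eq_add.1 h2
  · have h1 := hs.hasSum.mapL (ContinuousLinearMap.apply ℝ E f)
    refine hP.hasSum_mem h1 fun k => ?_
    change (B ^ k) f ∈ P
    induction k with
    | zero => simpa using hf
    | succ k ih =>
      rw [pow_succ', mul_apply_eq_comp]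
      exact hBP _ ih

/-- Fatou's lemma for the loss term. -/
theorem integral_loss_le_of_tendsto {X : Type*} [NormedAddCommGroup X] {α₁ : ℝ → ℝ} {r : ℝ}
    (hα : Measurable α₁) (hα0 : ∀ᵐ m ∂(massMeasure r), 0 ≤ α₁ m)
    {φ : ℕ → BochnerL1 X r} {ψ : BochnerL1 X r} (hφ : Tendsto φ atTop (𝓝 ψ))
    (hint : ∀ k, Integrable (fun m => α₁ m * ‖φ k m‖) (massMeasure r)) {c : ℕ → ℝ} {c₀ : ℝ}
    (hc : Tendsto c atTop (𝓝 c₀)) (hc₀ : 0 ≤ c₀)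
    (hle : ∀ k, ∫ m, α₁ m * ‖φ k m‖ ∂(massMeasure r) ≤ c k) :
    Integrable (fun m => α₁ m * ‖ψ m‖) (massMeasure r) ∧
      ∫ m, α₁ m * ‖ψ m‖ ∂(massMeasure r) ≤ c₀ := by
  have hnn : ∀ w : BochnerL1 X r, 0 ≤ᵐ[massMeasure r] fun m => α₁ m * ‖w m‖ := fun w =>
    hα0.mono fun m h => mul_nonneg h (norm_nonneg _)
  obtain ⟨ns, hns, hae⟩ := exists_subseq_tendsto_ae hφ
  have hfatou : ∫⁻ m, ENNReal.ofReal (α₁ m * ‖ψ m‖) ∂(massMeasure r) ≤ ENNReal.ofReal c₀ := by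
    calc ∫⁻ m, ENNReal.ofReal (α₁ m * ‖ψ m‖) ∂(massMeasure r)
        = ∫⁻ m, liminf (fun k => ENNReal.ofReal (α₁ m * ‖φ (ns k) m‖)) atTop
            ∂(massMeasure r) := by
          refine lintegral_congr_ae ?_
          filter_upwards [hae] with m h1
          exact (ENNReal.tendsto_ofReal (h1.norm.const_mul (α₁ m))).liminf_eq.symm
      _ ≤ liminf (fun k => ∫⁻ m, ENNReal.ofReal (α₁ m * ‖φ (ns k) m‖)
            ∂(massMeasure r)) atTop :=
          lintegral_liminf_le' fun k => (hint (ns k)).aemeasurable.ennreal_ofReal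
      _ ≤ liminf (fun k => ENNReal.ofReal (c (ns k))) atTop := by
          refine liminf_le_liminf (Eventually.of_forall fun k => ?_)
          rw [← ofReal_integral_eq_lintegral_ofReal (hint (ns k)) (hnn _)]
          exact ENNReal.ofReal_le_ofReal (hle (ns k))
      _ = ENNReal.ofReal c₀ :=
          (ENNReal.tendsto_ofReal (hc.comp hns.tendsto_atTop)).liminf_eq
  have hψ : Integrable (fun m => α₁ m * ‖ψ m‖) (massMeasure r) := by
    refine ⟨hα.aestronglyMeasurable.mul (Lp.aestronglyMeasurable _).norm, ?_⟩
    rw [hasFiniteIntegral_iff_ofReal (hnn _)]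
    exact hfatou.trans_lt ENNReal.ofReal_lt_top
  refine ⟨hψ, ?_⟩
  rw [← ENNReal.ofReal_le_ofReal_iff hc₀, ofReal_integral_eq_lintegral_ofReal hψ (hnn _)]
  exact hfatou

theorem mk_sub_mem {E : Type*} [NormedAddCommGroup E] [NormedSpace ℝ E] {G : Submodule ℝ (E × E)}
    {u v u' v' : E} (h : (u, v) ∈ G) (h' : (u', v') ∈ G) : (u - u', v - v') ∈ G :=
  G.sub_mem h h'

theorem resolvent_sub {E : Type*} [NormedAddCommGroup E] [NormedSpace ℝ E] {c : ℝ}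
    {u v₀ v₁ v₂ u' v₀' v₁' v₂' : E} :
    c • u - (v₀ + v₁ + v₂) - (c • u' - (v₀' + v₁' + v₂')) =
      c • (u - u') - ((v₀ - v₀') + (v₁ - v₁') + (v₂ - v₂')) := by
  module

/-! ### Solving the resolvent equation, and the generation theorem -/

section Generation

variable {N : ℕ} {Ω : Set (Sp N)} {X : Type*} [NormedAddCommGroup X] [NormedSpace ℝ X]
  [MeasurableSpace X] [CompleteSpace X]
  {ι : X →ₗ[ℝ] FunOn Ω} {Reg : (Sp N → ℝ) → Prop} {a : Sp N → ℝ → ℝ} {α₁ α₂ : ℝ → ℝ}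
  {M r C : ℝ} {κ : Sp N → ℝ → ℝ → ℝ} {β : ℝ → ℝ → ℝ} {T : ℝ → X →ₗ.[ℝ] X}

theorem exists_transport_resolvent (hX : IsFunctionSpace ι Reg) (hT : TransportAssumption ι T r)
    {c : ℝ} (hc : 0 < c) :
    ∃ R : BochnerL1 X r →L[ℝ] BochnerL1 X r, ‖R‖ ≤ c⁻¹ ∧
      (∀ u v, (u, v) ∈ transportGraph T r ↔ u = R (c • u - v)) ∧
      ∀ f ∈ positiveConeL1 ι r, R f ∈ positiveConeL1 ι r := by
  obtain ⟨-, -, S, hS, hSG, -⟩ := hT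
  have h := exists_resolvent_of_dissipative (A := transportOp T r) (P := positiveConeL1 ι r)
    (c := c) hc
    (fun u v huv => norm_le_of_tendsto_quotient hS.contractive ((hSG u v).1 huv) c)
    (fun f => hS.resolvent (isClosedCone_positiveConeL1 hX r) hSG hc f)
  rwa [transportOp_graph] at h

variable [BorelSpace X]

/-- With `R` the resolvent of `T₀` at `c + d` and `Q = d + A + B` on truncated functions, one solves
`g = f + Q R g` and takes the truncation of `R g`. Since `‖Q‖ ≤ d + C` and `‖R‖ ≤ (c + d)⁻¹`, the
series converges precisely because `C < c`. All its terms are positive if `f` is. -/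
theorem exists_solution_trunc (hX : IsFunctionSpace ι Reg) (ha : IsLossRate Ω Reg a α₁ α₂ M)
    (hκ : IsGainKernel Ω Reg κ α₂ β) (hC0 : 0 ≤ C) (hC : GainBound α₁ α₂ β r C)
    (hT : TransportAssumption ι T r) {c : ℝ} (hc : C < c) {n : ℝ} {f : BochnerL1 X r}
    (hf : trunc X r n f = f) :
    ∃ u v₀ v₁ v₂, (u, v₀) ∈ transportGraph T r ∧ (u, v₁) ∈ lossGraph ι a r ∧
      (u, v₂) ∈ gainGraph ι κ r ∧ c • u - (v₀ + v₁ + v₂) = f ∧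
      (f ∈ positiveConeL1 ι r → u ∈ positiveConeL1 ι r) := by
  obtain ⟨d, Q, hd, hQ, hQP, hQu⟩ := exists_truncated_perturbation hX ha hκ hC0 hC n
  have hcd : 0 < c + d := by linarith
  obtain ⟨R, hR, hRG, hRP⟩ := exists_transport_resolvent hX hT hcd
  have hB : ‖Q.comp R‖ < 1 := by
    calc ‖Q.comp R‖ ≤ ‖Q‖ * ‖R‖ := Q.opNorm_comp_le R
      _ ≤ (d + C) * (c + d)⁻¹ := by gcongr
      _ < 1 := by
        rw [← div_eq_mul_inv, div_lt_one hcd]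
        linarith
  obtain ⟨g, hg, hgP⟩ := exists_neumann hB (isClosedCone_positiveConeL1 hX r)
    (fun u hu => hQP _ (hRP u hu)) f
  obtain ⟨v₁, v₂, h1, h2, h3, h4⟩ := hQu (R g)
  have hTR : (R g, (c + d) • R g - g) ∈ transportGraph T r := by
    rw [hRG, sub_sub_cancel]
  have hTn := trunc_mem_transportGraph n hTR
  refine ⟨trunc X r n (R g), _, v₁, v₂, hTn, h1, h2, ?_, fun hfP =>
    trunc_mem_positiveConeL1 n (hRP _ (hgP hfP))⟩
  -- Truncation fixes `f`, and also the loss and gain of a truncated function, because no mass above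
  -- `n` is created. The shift `d` then cancels against the one in the resolvent.
  have h5 : trunc X r n g = f + d • trunc X r n (R g) + (v₁ + v₂) := by
    have h6 : trunc X r n (trunc X r n (R g)) = trunc X r n (R g) :=
      trunc_eq_self (trunc_eq_zero_of_lt n _)
    conv_lhs => rw [hg]
    rw [ContinuousLinearMap.comp_apply, h3, map_add, map_add, hf, map_smul, h4, h6, add_assoc]
  rw [map_sub, map_smul, h5]
  module

/-- The difference of two solutions. -/
theorem solution_sub_le (hX : IsFunctionSpace ι Reg) (ha : IsLossRate Ω Reg a α₁ α₂ M)
    (hκ : IsGainKernel Ω Reg κ α₂ β) (hC0 : 0 ≤ C) (hC : GainBound α₁ α₂ β r C)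
    (hT : TransportAssumption ι T r) {c : ℝ} {u v₀ v₁ v₂ f u' v₀' v₁' v₂' f' : BochnerL1 X r}
    (h₀ : (u, v₀) ∈ transportGraph T r) (h₁ : (u, v₁) ∈ lossGraph ι a r)
    (h₂ : (u, v₂) ∈ gainGraph ι κ r) (hf : c • u - (v₀ + v₁ + v₂) = f)
    (h₀' : (u', v₀') ∈ transportGraph T r) (h₁' : (u', v₁') ∈ lossGraph ι a r)
    (h₂' : (u', v₂') ∈ gainGraph ι κ r) (hf' : c • u' - (v₀' + v₁' + v₂') = f') :
    (c - C) * ‖u - u'‖ + (∫ m, α₁ m * ‖(u - u') m‖ ∂(massMeasure r)) / 2 ≤ ‖f - f'‖ := by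
  have k₀ : (u - u', v₀ - v₀') ∈ transportGraph T r := mk_sub_mem h₀ h₀'
  have k₁ : (u - u', v₁ - v₁') ∈ lossGraph ι a r := mk_sub_mem h₁ h₁'
  have k₂ : (u - u', v₂ - v₂') ∈ gainGraph ι κ r := mk_sub_mem h₂ h₂'
  have e : f - f' = c • (u - u') - ((v₀ - v₀') + (v₁ - v₁') + (v₂ - v₂')) := by
    rw [← hf, ← hf', resolvent_sub]
  rw [e]
  exact dissipative_estimate hX ha hκ hC0 hC hT c k₀ k₁ k₂

/-- The limit of approximate solutions. -/
theorem exists_solution_of_tendsto (hX : IsFunctionSpace ι Reg) (ha : IsLossRate Ω Reg a α₁ α₂ M)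
    (hκ : IsGainKernel Ω Reg κ α₂ β) (hC0 : 0 ≤ C) (hC : GainBound α₁ α₂ β r C)
    (hT : TransportAssumption ι T r) {c : ℝ} {u v₀ v₁ v₂ fn : ℕ → BochnerL1 X r}
    {w f : BochnerL1 X r} (hu₀ : ∀ n, (u n, v₀ n) ∈ transportGraph T r)
    (hu₁ : ∀ n, (u n, v₁ n) ∈ lossGraph ι a r) (hu₂ : ∀ n, (u n, v₂ n) ∈ gainGraph ι κ r)
    (hsol : ∀ n, c • u n - (v₀ n + v₁ n + v₂ n) = fn n) (hflim : Tendsto fn atTop (𝓝 f))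
    (hw : Tendsto u atTop (𝓝 w))
    (hzint : ∀ n, Integrable (fun m => α₁ m * ‖(u n - w) m‖) (massMeasure r))
    (hzle : ∀ n, ∫ m, α₁ m * ‖(u n - w) m‖ ∂(massMeasure r) ≤ 2 * ‖fn n - f‖) :
    ∃ v₀ v₁ v₂, (w, v₀) ∈ transportGraph T r ∧ (w, v₁) ∈ lossGraph ι a r ∧
      (w, v₂) ∈ gainGraph ι κ r ∧ c • w - (v₀ + v₁ + v₂) = f := by
  choose z₁ hz₁ using fun n => exists_mem_lossGraph hX ha (hzint n)
  choose z₂ hz₂ using fun n => exists_mem_gainGraph hX ha hκ hC0 hC (hzint n)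
  -- The limit `w` lies in the domain as the difference of `u n` and `u n - w`. Its loss and gain
  -- cannot depend on `n`, so convergence of `v₁` and `v₂` reduces to `z₁ → 0` and `z₂ → 0`.
  have hw₁ : ∀ n, (w, v₁ n - z₁ n) ∈ lossGraph ι a r := fun n => by
    have h : (u n - (u n - w), v₁ n - z₁ n) ∈ lossGraph ι a r :=
      mk_sub_mem (hu₁ n) (hz₁ n)
    rwa [sub_sub_cancel] at h
  have hw₂ : ∀ n, (w, v₂ n - z₂ n) ∈ gainGraph ι κ r := fun n => by
    have h : (u n - (u n - w), v₂ n - z₂ n) ∈ gainGraph ι κ r :=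
      mk_sub_mem (hu₂ n) (hz₂ n).1
    rwa [sub_sub_cancel] at h
  have he₁ : ∀ n, v₁ n = v₁ 0 - z₁ 0 + z₁ n := fun n => by
    have h1 := hw₁ n
    have h2 := hw₁ 0
    rw [← lossOp_graph hX.injective] at h1 h2
    rw [← LinearPMap.mem_graph_snd_inj _ h1 h2 rfl, sub_add_cancel]
  have he₂ : ∀ n, v₂ n = v₂ 0 - z₂ 0 + z₂ n := fun n => by
    have h1 := hw₂ n
    have h2 := hw₂ 0
    rw [← gainOp_graph hX.injective] at h1 h2
    rw [← LinearPMap.mem_graph_snd_inj _ h1 h2 rfl, sub_add_cancel]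
  have hf0 : Tendsto (fun n => ‖fn n - f‖) atTop (𝓝 0) :=
    tendsto_iff_norm_sub_tendsto_zero.1 hflim
  have hw0 : Tendsto (fun n => ‖u n - w‖) atTop (𝓝 0) := tendsto_iff_norm_sub_tendsto_zero.1 hw
  have hM : 0 ≤ |M| := abs_nonneg M
  have hz₁0 : Tendsto z₁ atTop (𝓝 0) := by
    have h1 : Tendsto (fun n => |M| * (2 * ‖fn n - f‖)) atTop (𝓝 0) := by
      simpa using (hf0.const_mul 2).const_mul |M|
    refine squeeze_zero_norm (fun n => ?_) h1
    have h2 := norm_loss_le_integral hX ha (hz₁ n)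
    have h3 : 0 ≤ ∫ m, α₁ m * ‖(u n - w) m‖ ∂(massMeasure r) := by
      refine integral_nonneg_of_ae ?_
      filter_upwards [ae_massMeasure_bounds ha r] with m h
      exact mul_nonneg h.1 (norm_nonneg _)
    have h4 := hzle n
    calc ‖z₁ n‖ ≤ M * ∫ m, α₁ m * ‖(u n - w) m‖ ∂(massMeasure r) := h2
      _ ≤ |M| * ∫ m, α₁ m * ‖(u n - w) m‖ ∂(massMeasure r) := by
        gcongr
        exact le_abs_self M
      _ ≤ |M| * (2 * ‖fn n - f‖) := by gcongr
  have hz₂0 : Tendsto z₂ atTop (𝓝 0) := by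
    have h1 : Tendsto (fun n => ‖fn n - f‖ + C * ‖u n - w‖) atTop (𝓝 0) := by
      simpa using hf0.add (hw0.const_mul C)
    refine squeeze_zero_norm (fun n => ?_) h1
    have h2 := norm_gain_le hX ha hκ hC0 hC (hzint n) (hz₂ n).1
    have h3 := hzle n
    linarith
  -- the transport operator is closed
  obtain ⟨R, -, hRG, -⟩ := exists_transport_resolvent hX hT one_pos
  have hv₀ : ∀ n, v₀ n = c • u n - fn n - (v₁ 0 - z₁ 0 + z₁ n) - (v₂ 0 - z₂ 0 + z₂ n) := by
    intro n
    rw [← he₁ n, ← he₂ n, ← hsol n]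
    abel
  have hv₀lim : Tendsto v₀ atTop
      (𝓝 (c • w - f - (v₁ 0 - z₁ 0 + 0) - (v₂ 0 - z₂ 0 + 0))) := by
    refine Tendsto.congr (fun n => (hv₀ n).symm) ?_
    exact (((hw.const_smul c).sub hflim).sub (hz₁0.const_add _)).sub (hz₂0.const_add _)
  rw [add_zero, add_zero] at hv₀lim
  refine ⟨c • w - f - (v₁ 0 - z₁ 0) - (v₂ 0 - z₂ 0), _, _, ?_, hw₁ 0, hw₂ 0, ?_⟩
  · rw [hRG]
    refine tendsto_nhds_unique hw (Tendsto.congr (fun n => ((hRG _ _).1 (hu₀ n)).symm) ?_)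
    exact (R.continuous.tendsto _).comp ((hw.const_smul (1 : ℝ)).sub hv₀lim)
  · abel

/-- The a priori estimate for differences of truncated solutions makes them a Cauchy sequence and,
through its second term, keeps the limit in the domain of the loss operator. -/
theorem exists_solution (hX : IsFunctionSpace ι Reg) (ha : IsLossRate Ω Reg a α₁ α₂ M)
    (hκ : IsGainKernel Ω Reg κ α₂ β) (hC0 : 0 ≤ C) (hC : GainBound α₁ α₂ β r C)
    (hT : TransportAssumption ι T r) {c : ℝ} (hc : C < c) (f : BochnerL1 X r) :
    ∃ u v₀ v₁ v₂, (u, v₀) ∈ transportGraph T r ∧ (u, v₁) ∈ lossGraph ι a r ∧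
      (u, v₂) ∈ gainGraph ι κ r ∧ c • u - (v₀ + v₁ + v₂) = f ∧
      (f ∈ positiveConeL1 ι r → u ∈ positiveConeL1 ι r) := by
  set fn : ℕ → BochnerL1 X r := fun n => trunc X r n f with hfn
  have hflim : Tendsto fn atTop (𝓝 f) := tendsto_trunc f
  choose u v₀ v₁ v₂ hu₀ hu₁ hu₂ hsol hpos using fun n : ℕ =>
    exists_solution_trunc hX ha hκ hC0 hC hT hc (n := n) (f := fn n)
      (trunc_eq_self (trunc_eq_zero_of_lt n f))
  have hest : ∀ n k, (c - C) * ‖u n - u k‖ +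
      (∫ m, α₁ m * ‖(u n - u k) m‖ ∂(massMeasure r)) / 2 ≤ ‖fn n - fn k‖ := fun n k =>
    solution_sub_le hX ha hκ hC0 hC hT (hu₀ n) (hu₁ n) (hu₂ n) (hsol n) (hu₀ k) (hu₁ k) (hu₂ k)
      (hsol k)
  have hint : ∀ n k, Integrable (fun m => α₁ m * ‖(u n - u k) m‖) (massMeasure r) := by
    intro n k
    have h : (u n - u k, v₁ n - v₁ k) ∈ lossGraph ι a r :=
      mk_sub_mem (hu₁ n) (hu₁ k)
    exact integrable_of_mem_lossGraph hX ha h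
  have hnn : ∀ w : BochnerL1 X r, 0 ≤ᵐ[massMeasure r] fun m => α₁ m * ‖w m‖ := by
    intro w
    filter_upwards [ae_massMeasure_bounds ha r] with m h
    exact mul_nonneg h.1 (norm_nonneg _)
  have hcC : 0 < c - C := by linarith
  -- the approximations converge
  have hcau : CauchySeq u := by
    rw [Metric.cauchySeq_iff]
    intro ε hε
    obtain ⟨n₀, hn₀⟩ := Metric.cauchySeq_iff.1 hflim.cauchySeq ((c - C) * ε) (by positivity)
    refine ⟨n₀, fun n hn k hk => ?_⟩
    have h1 := hn₀ n hn k hk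
    have h2 := hest n k
    have h3 := integral_nonneg_of_ae (hnn (u n - u k))
    rw [dist_eq_norm] at h1 ⊢
    have h4 : (c - C) * ‖u n - u k‖ < (c - C) * ε := by linarith
    exact lt_of_mul_lt_mul_left h4 hcC.le
  obtain ⟨w, hw⟩ := cauchySeq_tendsto_of_complete hcau
  -- Fatou's lemma in `k` with `n` fixed; the factor `2` inverts the `1 / 2` in the a priori
  -- estimate.
  have hz : ∀ n, Integrable (fun m => α₁ m * ‖(u n - w) m‖) (massMeasure r) ∧
      ∫ m, α₁ m * ‖(u n - w) m‖ ∂(massMeasure r) ≤ 2 * ‖fn n - f‖ := fun n =>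
    integral_loss_le_of_tendsto ha.measurable₁ ((ae_massMeasure_bounds ha r).mono fun m h => h.1)
      (hw.const_sub (u n)) (hint n) ((hflim.const_sub (fn n)).norm.const_mul 2) (by positivity)
      fun k => by
        have h1 := hest n k
        have h2 : 0 ≤ (c - C) * ‖u n - u k‖ := by positivity
        linarith
  obtain ⟨v₀', v₁', v₂', h₀, h₁, h₂, h₃⟩ := exists_solution_of_tendsto hX ha hκ hC0 hC hT hu₀ hu₁
    hu₂ hsol hflim hw (fun n => (hz n).1) fun n => (hz n).2
  exact ⟨w, v₀', v₁', v₂', h₀, h₁, h₂, h₃, fun hfP =>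
    (isClosedCone_positiveConeL1 hX r).isClosed.mem_of_tendsto hw
      (Eventually.of_forall fun n => hpos n (trunc_mem_positiveConeL1 n hfP))⟩

/-- Generation for transport–fragmentation operators with general loss rate and gain kernel. -/
theorem generates_transport_loss_gain (hX : IsFunctionSpace ι Reg)
    (ha : IsLossRate Ω Reg a α₁ α₂ M) (hκ : IsGainKernel Ω Reg κ α₂ β) (hC0 : 0 ≤ C)
    (hC : GainBound α₁ α₂ β r C) (hT : TransportAssumption ι T r) :
    (transportOp T r + lossOp ι a r + gainOp ι κ r).domain =
        (transportOp T r).domain ⊓ (lossOp ι a r).domain ∧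
      GeneratesPositiveC0Semigroup (positiveConeL1 ι r)
        (transportOp T r + lossOp ι a r + gainOp ι κ r) := by
  have hdom : (transportOp T r + lossOp ι a r + gainOp ι κ r).domain =
      (transportOp T r).domain ⊓ (lossOp ι a r).domain := by
    change ((transportOp T r).domain ⊓ (lossOp ι a r).domain) ⊓ (gainOp ι κ r).domain = _
    exact inf_eq_left.2 (inf_le_right.trans (gainOp_domain_ge hX ha hκ hC0 hC))
  have hgraph : ∀ u v, (u, v) ∈ (transportOp T r + lossOp ι a r + gainOp ι κ r).graph ↔
      ∃ v₀ v₁ v₂, (u, v₀) ∈ transportGraph T r ∧ (u, v₁) ∈ lossGraph ι a r ∧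
        (u, v₂) ∈ gainGraph ι κ r ∧ v = v₀ + v₁ + v₂ := by
    intro u v
    rw [mem_graph_add_iff]
    simp only [mem_graph_add_iff, transportOp_graph, lossOp_graph hX.injective,
      gainOp_graph hX.injective]
    constructor
    · rintro ⟨_, v₂, ⟨v₀, v₁, h₀, h₁, rfl⟩, h₂, rfl⟩
      exact ⟨v₀, v₁, v₂, h₀, h₁, h₂, rfl⟩
    · rintro ⟨v₀, v₁, v₂, h₀, h₁, h₂, rfl⟩
      exact ⟨_, v₂, ⟨v₀, v₁, h₀, h₁, rfl⟩, h₂, rfl⟩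
  refine ⟨hdom, generatesPositiveC0Semigroup_of_dissipative (isClosedCone_positiveConeL1 hX r) C
    ?_ ?_ ?_⟩
  -- The domain of `T₀` is dense, and truncations of its elements approximate them and lie in both
  -- domains.
  · obtain ⟨-, -, S, hS, hSG, -⟩ := hT
    rw [hdom]
    refine fun x => closure_minimal (fun u hu => ?_) isClosed_closure (hS.dense_domain hSG x)
    rw [SetLike.mem_coe, LinearPMap.mem_domain_iff, transportOp_graph] at hu
    obtain ⟨v, hv⟩ := hu
    refine mem_closure_of_tendsto (tendsto_trunc u) (Eventually.of_forall fun n => ⟨?_, ?_⟩)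
    · rw [SetLike.mem_coe, LinearPMap.mem_domain_iff, transportOp_graph]
      exact ⟨_, trunc_mem_transportGraph n hv⟩
    · obtain ⟨_, _, _, _, _, h⟩ := exists_truncated_perturbation hX ha hκ hC0 hC n
      obtain ⟨v₁, -, hv₁, -⟩ := h u
      rw [SetLike.mem_coe, LinearPMap.mem_domain_iff, lossOp_graph hX.injective]
      exact ⟨v₁, hv₁⟩
  · intro c _ u v huv
    obtain ⟨v₀, v₁, v₂, h₀, h₁, h₂, rfl⟩ := (hgraph u v).1 huv
    have h3 := dissipative_estimate hX ha hκ hC0 hC hT c h₀ h₁ h₂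
    have h4 : 0 ≤ ∫ m, α₁ m * ‖u m‖ ∂(massMeasure r) := by
      refine integral_nonneg_of_ae ?_
      filter_upwards [ae_massMeasure_bounds ha r] with m h
      exact mul_nonneg h.1 (norm_nonneg _)
    linarith
  · intro c hc f
    obtain ⟨u, v₀, v₁, v₂, h₀, h₁, h₂, h₃, h₄⟩ := exists_solution hX ha hκ hC0 hC hT hc f
    refine ⟨u, (hgraph _ _).2 ⟨v₀, v₁, v₂, h₀, h₁, h₂, ?_⟩, h₄⟩
    rw [← h₃, sub_sub_cancel]

end Generation

/-! ### The degenerate case of an empty domain -/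

section Subsingleton

theorem mem_graph_of_subsingleton {E : Type*} [NormedAddCommGroup E] [NormedSpace ℝ E]
    [Subsingleton E] (A : E →ₗ.[ℝ] E) (u v : E) : (u, v) ∈ A.graph := by
  rw [Subsingleton.elim (u, v) 0]
  exact A.graph.zero_mem

theorem generates_of_subsingleton {E : Type*} [NormedAddCommGroup E] [NormedSpace ℝ E]
    [Subsingleton E] (P : Set E) (A : E →ₗ.[ℝ] E) : GeneratesPositiveC0Semigroup P A := by
  refine ⟨fun _ => ContinuousLinearMap.id ℝ E, ⟨rfl, fun _ _ _ _ => rfl, fun u => ?_⟩,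
    fun _ _ _ hu => hu, fun u v => ⟨fun _ => ?_, fun _ => mem_graph_of_subsingleton A u v⟩⟩
  · exact tendsto_const_nhds
  · rw [Subsingleton.elim v 0]
    exact tendsto_const_nhds.congr fun t => Subsingleton.elim _ _

theorem domain_eq_of_subsingleton {E : Type*} [NormedAddCommGroup E] [NormedSpace ℝ E]
    [Subsingleton E] (D D' : Submodule ℝ E) : D = D' := by
  ext u
  rw [Subsingleton.elim u 0]
  exact iff_of_true D.zero_mem D'.zero_mem

variable {N : ℕ} {X : Type*} [NormedAddCommGroup X] [NormedSpace ℝ X] [MeasurableSpace X]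

theorem subsingleton_bochnerL1 {ι : X →ₗ[ℝ] FunOn (∅ : Set (Sp N))} {Reg : (Sp N → ℝ) → Prop}
    (hX : IsFunctionSpace ι Reg) (r : ℝ) : Subsingleton (BochnerL1 X r) := by
  have h0 : ∀ f : X, f = 0 := fun f => hX.eq_of_ae_eq (by simp)
  exact ⟨fun u v => Lp.ext (Eventually.of_forall fun m => (h0 _).trans (h0 _).symm)⟩

theorem generates_of_empty {ι : X →ₗ[ℝ] FunOn (∅ : Set (Sp N))} {Reg : (Sp N → ℝ) → Prop}
    (hX : IsFunctionSpace ι Reg) (r : ℝ) (A : BochnerL1 X r →ₗ.[ℝ] BochnerL1 X r)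
    (D : Submodule ℝ (BochnerL1 X r)) :
    A.domain = D ∧ GeneratesPositiveC0Semigroup (positiveConeL1 ι r) A := by
  have := subsingleton_bochnerL1 hX r
  exact ⟨domain_eq_of_subsingleton _ _, generates_of_subsingleton _ _⟩

end Subsingleton

/-! ### The given coefficients as loss rates and gain kernels -/

section Coefficients

variable {N : ℕ} {Ω : Set (Sp N)} {a : Sp N → ℝ → ℝ} {b : Sp N → ℝ → ℝ → ℝ} {α₁ α₂ : ℝ → ℝ}
  {β : ℝ → ℝ → ℝ} {M : ℝ} {Reg : (Sp N → ℝ) → Prop}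

/-- Nonnegativity of `α₁` follows from `0 ≤ a ≤ α₂ ≤ M α₁` at a single point `x`, which is why `Ω`
must not be null. -/
theorem RateBounds.isLossRate (ha : RateBounds Ω a α₁ α₂ M) (hM : 0 < M)
    [hne : (ae (volume.restrict Ω : Measure (Sp N))).NeBot]
    (hreg : ∀ᵐ m ∂halfLine, Reg fun x => a x m) : IsLossRate Ω Reg a α₁ α₂ M where
  measurable := ha.measurable
  measurable₁ := ha.locBdd₁.1
  locBdd₂ := ha.locBdd₂
  reg := hreg
  bounds := ha.bounds.mono fun m h => h.mono fun x hx => hx.2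
  comparable := by
    filter_upwards [ha.bounds, ha.comparable] with m h1 h2
    obtain ⟨x, h3, h4, h5⟩ := h1.exists
    exact ⟨nonneg_of_mul_nonneg_right ((h3.trans h5).trans h2) hM, h4.trans h5, h2⟩

theorem IsLossRate.isLossRate_const {Reg' : (Sp N → ℝ) → Prop}
    (ha : IsLossRate Ω Reg a α₁ α₂ M) (hconst : ∀ c : ℝ, Reg' fun _ => c) :
    IsLossRate Ω Reg' (fun _ m => α₁ m) α₁ α₂ M where
  measurable := ha.measurable₁.comp measurable_snd
  measurable₁ := ha.measurable₁
  locBdd₂ := ha.locBdd₂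
  reg := Eventually.of_forall fun _ => hconst _
  bounds := ha.comparable.mono fun _ h => Eventually.of_forall fun _ => ⟨le_rfl, h.2.1⟩
  comparable := ha.comparable

theorem ae_snd_of_ae_halfLine {p : ℝ → Prop} (h : ∀ᵐ m ∂halfLine, p m) :
    ∀ᵐ q ∂(volume : Measure (ℝ × ℝ)), 0 ≤ q.2 → p q.2 := by
  rw [ae_restrict_iff' measurableSet_Ici] at h
  rw [Measure.volume_eq_prod]
  exact Measure.quasiMeasurePreserving_snd.ae h

theorem IsLossRate.isGainKernel_const {Reg' : (Sp N → ℝ) → Prop}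
    (ha : IsLossRate Ω Reg a α₁ α₂ M) (hconst : ∀ c : ℝ, Reg' fun _ => c)
    (hβmeas : Measurable fun p : ℝ × ℝ => β p.1 p.2) (hβnonneg : ∀ m s, 0 ≤ β m s) :
    IsGainKernel Ω Reg' (fun _ m s => α₂ s * β m s) α₂ β where
  measurable := (ha.locBdd₂.1.comp (measurable_snd.comp measurable_snd)).mul
    (hβmeas.comp measurable_snd)
  measurable_dom := hβmeas
  dom_nonneg := hβnonneg
  reg := Eventually.of_forall fun p _ _ => hconst _
  bounds := by
    filter_upwards [ae_snd_of_ae_halfLine ha.comparable] with p h hp1 hp2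
    have h1 := h (hp1.trans hp2.le)
    exact Eventually.of_forall fun x =>
      ⟨mul_nonneg (h1.1.trans h1.2.1) (hβnonneg _ _), le_rfl⟩

/-- The domination of `b` by `β` is given for a.e. `x` and then a.e. `(m, s)`; Fubini for null sets
reverses the order, as the fibrewise estimates require. -/
theorem IsLossRate.isGainKernel (ha : IsLossRate Ω Reg a α₁ α₂ M) (hb : IsFragKernel b)
    (hβmeas : Measurable fun p : ℝ × ℝ => β p.1 p.2) (hβnonneg : ∀ m s, 0 ≤ β m s)
    (hbβ : ∀ᵐ x ∂(volume.restrict Ω : Measure (Sp N)), ∀ᵐ p ∂(volume : Measure (ℝ × ℝ)),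
      0 ≤ p.1 → p.1 ≤ p.2 → b x p.1 p.2 ≤ β p.1 p.2)
    (hreg : ∀ᵐ p ∂(volume : Measure (ℝ × ℝ)), 0 ≤ p.1 → p.1 < p.2 →
      Reg fun x => a x p.2 * b x p.1 p.2) :
    IsGainKernel Ω Reg (fun x m s => a x s * b x m s) α₂ β where
  measurable := (ha.measurable.comp
    (measurable_fst.prodMk (measurable_snd.comp measurable_snd))).mul hb.measurable
  measurable_dom := hβmeas
  dom_nonneg := hβnonneg
  reg := hreg
  bounds := by
    have hset : MeasurableSet {q : Sp N × (ℝ × ℝ) |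
        0 ≤ q.2.1 → q.2.1 ≤ q.2.2 → b q.1 q.2.1 q.2.2 ≤ β q.2.1 q.2.2} := by
      have h1 : Measurable fun q : Sp N × (ℝ × ℝ) => q.2.1 := measurable_fst.comp measurable_snd
      have h2 : Measurable fun q : Sp N × (ℝ × ℝ) => q.2.2 := measurable_snd.comp measurable_snd
      exact (measurableSet_le measurable_const h1).imp
        ((measurableSet_le h1 h2).imp
          (measurableSet_le hb.measurable (hβmeas.comp measurable_snd)))
    have hswap := (Measure.ae_ae_comm (p := fun (x : Sp N) (p : ℝ × ℝ) =>
      0 ≤ p.1 → p.1 ≤ p.2 → b x p.1 p.2 ≤ β p.1 p.2) hset).1 hbβ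
    filter_upwards [hswap, ae_snd_of_ae_halfLine ha.comparable, ae_snd_of_ae_halfLine ha.bounds]
      with p h1 h2 h3 hp1 hp2
    have h4 := h2 (hp1.trans hp2.le)
    filter_upwards [h1, h3 (hp1.trans hp2.le)] with x h5 h6
    have h7 := hb.nonneg x p.1 p.2
    exact ⟨mul_nonneg (h4.1.trans h6.1) h7,
      mul_le_mul h6.2 (h5 hp1 hp2.le) h7 (h4.1.trans (h4.2.1))⟩

end Coefficients

/-! ### Generation for the two concrete operators -/

section Generation

variable {N : ℕ} {Ω : Set (Sp N)} {X : Type*} [NormedAddCommGroup X] [NormedSpace ℝ X]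
  [MeasurableSpace X] [CompleteSpace X] [BorelSpace X]
  {ι : X →ₗ[ℝ] FunOn Ω} {Reg : (Sp N → ℝ) → Prop} {a : Sp N → ℝ → ℝ} {α₁ α₂ : ℝ → ℝ}
  {M r C : ℝ} {b : Sp N → ℝ → ℝ → ℝ} {β : ℝ → ℝ → ℝ} {T : ℝ → X →ₗ.[ℝ] X}

theorem generates_opFrakK (hX : IsFunctionSpace ι Reg) (hconst : ∀ c : ℝ, Reg fun _ => c)
    (ha : IsLossRate Ω Reg a α₁ α₂ M) (hβmeas : Measurable fun p : ℝ × ℝ => β p.1 p.2)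
    (hβnonneg : ∀ m s, 0 ≤ β m s) (hC0 : 0 ≤ C) (hC : GainBound α₁ α₂ β r C)
    (hT : TransportAssumption ι T r) :
    (opFrakK ι T α₁ α₂ β r).domain = (transportOp T r).domain ⊓ (lossOp ι a r).domain ∧
      GeneratesPositiveC0Semigroup (positiveConeL1 ι r) (opFrakK ι T α₁ α₂ β r) := by
  have ha' := ha.isLossRate_const hconst
  -- The claimed domain involves the rate `a`, while the operator has the rate `α₁`; both loss
  -- domains are given by integrability of `α₁ ‖u(m)‖`.
  have hdom : (lossOp ι a r).domain = (lossOp ι (fun _ m => α₁ m) r).domain := by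
    ext u
    rw [mem_lossOp_domain_iff hX ha, mem_lossOp_domain_iff hX ha']
  rw [hdom]
  exact generates_transport_loss_gain hX ha' (ha.isGainKernel_const hconst hβmeas hβnonneg)
    hC0 hC hT

theorem generates_opK (hX : IsFunctionSpace ι Reg) (ha : IsLossRate Ω Reg a α₁ α₂ M)
    (hκ : IsGainKernel Ω Reg (fun x m s => a x s * b x m s) α₂ β) (hC0 : 0 ≤ C)
    (hC : GainBound α₁ α₂ β r C) (hT : TransportAssumption ι T r) :
    (opK ι T a b r).domain = (transportOp T r).domain ⊓ (lossOp ι a r).domain ∧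
      GeneratesPositiveC0Semigroup (positiveConeL1 ι r) (opK ι T a b r) :=
  generates_transport_loss_gain hX ha hκ hC0 hC hT

end Generation

end TransFrag

open TransFrag in
theorem theorem3p3 {N : ℕ} (hN : 1 ≤ N) (Ω : Set (Sp N)) (hΩ : IsOpen Ω)
    (hΩ' : Bornology.IsBounded Ω ∨ Ω = Set.univ)
    -- fragmentation rate and its `x`-independent bounds
    (a : Sp N → ℝ → ℝ) (α₁ α₂ : ℝ → ℝ) (M : ℝ) (hM : 0 < M) (ha : RateBounds Ω a α₁ α₂ M)
    -- fragmentation kernel, dominating kernel, and their zeroth moments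
    (b : Sp N → ℝ → ℝ → ℝ) (hb : IsFragKernel b)
    (β : ℝ → ℝ → ℝ) (hβmeas : Measurable fun p : ℝ × ℝ => β p.1 p.2)
    (hβnonneg : ∀ m s, 0 ≤ β m s) (hβsupp : ∀ m s, s < m → β m s = 0)
    (hbβ : ∀ᵐ x ∂(volume.restrict Ω : Measure (Sp N)), ∀ᵐ p ∂(volume : Measure (ℝ × ℝ)),
      0 ≤ p.1 → p.1 ≤ p.2 → b x p.1 p.2 ≤ β p.1 p.2)
    (l b₀ β₀ : ℝ) (hl : 0 ≤ l) (hb₀ : 1 ≤ b₀)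
    (hnb : ∀ᵐ x ∂(volume.restrict Ω : Measure (Sp N)), ∀ᵐ s ∂halfLine,
      MomentBound (fun m => b x m s) b₀ l s)
    (hnβ : ∀ s : ℝ, 0 ≤ s → MomentBound (fun m => β m s) β₀ l s)
    -- equi-integrability
    (r₀ s₀ : ℝ) (hr₀ : 0 ≤ r₀) (hs₀ : 0 ≤ s₀) (hequi : EquiIntegrableKernel β r₀ s₀)
    -- transport operators in `L₁(Ω)` and in `C₀(Ω)`
    (T₁ : ℝ → SpaceL1 Ω →ₗ.[ℝ] SpaceL1 Ω) (T₀ : ℝ → SpaceC0 Ω →ₗ.[ℝ] SpaceC0 Ω) :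
    ∃ r₁ : ℝ, max l r₀ < r₁ ∧ ∀ r : ℝ, r₁ ≤ r →
      -- `X_x = L₁(Ω)`
      (TransportAssumption (ofL1 Ω) T₁ r →
        ((opFrakK (ofL1 Ω) T₁ α₁ α₂ β r).domain =
            (transportOp T₁ r).domain ⊓ (lossOp (ofL1 Ω) a r).domain ∧
          GeneratesPositiveC0Semigroup (positiveConeL1 (ofL1 Ω) r)
            (opFrakK (ofL1 Ω) T₁ α₁ α₂ β r)) ∧
        ((opK (ofL1 Ω) T₁ a b r).domain =
            (transportOp T₁ r).domain ⊓ (lossOp (ofL1 Ω) a r).domain ∧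
          GeneratesPositiveC0Semigroup (positiveConeL1 (ofL1 Ω) r)
            (opK (ofL1 Ω) T₁ a b r))) ∧
      -- `X_x = C₀(Ω)`; here the coefficients are continuous in `x`
      (TransportAssumption (ofC0 Ω) T₀ r →
        (∀ᵐ m ∂halfLine, ContinuousOn (fun x => a x m) (closure Ω)) →
        ((opFrakK (ofC0 Ω) T₀ α₁ α₂ β r).domain =
            (transportOp T₀ r).domain ⊓ (lossOp (ofC0 Ω) a r).domain ∧
          GeneratesPositiveC0Semigroup (positiveConeL1 (ofC0 Ω) r)
            (opFrakK (ofC0 Ω) T₀ α₁ α₂ β r)) ∧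
        ((∀ᵐ p ∂(volume : Measure (ℝ × ℝ)), 0 ≤ p.1 → p.1 ≤ p.2 →
            ContinuousOn (fun x => b x p.1 p.2) (closure Ω)) →
          (opK (ofC0 Ω) T₀ a b r).domain =
              (transportOp T₀ r).domain ⊓ (lossOp (ofC0 Ω) a r).domain ∧
            GeneratesPositiveC0Semigroup (positiveConeL1 (ofC0 Ω) r)
              (opK (ofC0 Ω) T₀ a b r))) := by
  let _ : MeasurableSpace (SpaceL1 Ω) := borel _
  have : BorelSpace (SpaceL1 Ω) := ⟨rfl⟩
  let _ : MeasurableSpace (SpaceC0 Ω) := borel _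
  have : BorelSpace (SpaceC0 Ω) := ⟨rfl⟩
  have hX₁ := isFunctionSpace_ofL1 Ω
  have hX₀ := isFunctionSpace_ofC0 hΩ
  refine (eq_empty_or_nonempty Ω).elim (fun hΩe => ?_) fun hne => ?_
  -- On the empty set the bounds on `a` do not determine the sign of `α₁`, but all spaces are zero
  -- and every claim is trivial.
  · subst hΩe
    refine ⟨max l r₀ + 1, lt_add_one _, fun r _ => ?_⟩
    have h₁ := generates_of_empty hX₁ r
    have h₀ := generates_of_empty hX₀ r
    exact ⟨fun _ => ⟨h₁ _ _, h₁ _ _⟩, fun _ _ => ⟨h₀ _ _, fun _ => h₀ _ _⟩⟩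
  have : (ae (volume.restrict Ω : Measure (Sp N))).NeBot := by
    rw [ae_restrict_neBot]
    exact (hΩ.measure_pos volume hne).ne'
  have ha₁ : IsLossRate Ω (fun _ => True) a α₁ α₂ M :=
    ha.isLossRate hM (Eventually.of_forall fun _ => trivial)
  refine (exists_gainBound hM ha.locBdd₂ ha.comparable
    (ha₁.comparable.mono fun _ h => h.1) hβmeas hβnonneg hl hnβ hr₀ hequi).imp
    fun r₁ hr₁ => ⟨hr₁.1, fun r hrr => (hr₁.2 r hrr).elim fun C hC => ?_⟩
  refine ⟨fun hT => ⟨?_, ?_⟩, fun hT hac => ?_⟩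
  · exact generates_opFrakK hX₁ (fun _ => trivial) ha₁ hβmeas hβnonneg hC.1 hC.2 hT
  · exact generates_opK hX₁ ha₁ (ha₁.isGainKernel hb hβmeas hβnonneg hbβ
      (Eventually.of_forall fun _ _ _ => trivial)) hC.1 hC.2 hT
  · have ha₀ : IsLossRate Ω (fun φ => ContinuousOn φ (closure Ω)) a α₁ α₂ M :=
      ha.isLossRate hM hac
    refine ⟨generates_opFrakK hX₀ (fun _ => continuousOn_const) ha₀ hβmeas hβnonneg hC.1 hC.2 hT,
      fun hbc => generates_opK hX₀ ha₀
        (ha₀.isGainKernel hb hβmeas hβnonneg hbβ ?_) hC.1 hC.2 hT⟩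
    filter_upwards [hbc, ae_snd_of_ae_halfLine hac] with p h1 h2 hp1 hp2
    exact (h2 (hp1.trans hp2.le)).mul (h1 hp1 hp2.le)
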